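/- All graphs are finite and simple. The odd-girth of a graph is the smallest length of an odd cycle ($\infty$ for bipartite graphs). For a positive integer $k$, let $\mathcal{SP}_{2k+1}$ be the class of $K_4$-minor-free graphs of odd-girth at least $2k+1$; a graph $B$ bounds $\mathcal{SP}_{2k+1}$ if every graph in $\mathcal{SP}_{2k+1}$ admits a homomorphism to $B$. For integers $1\le p,q,r\le k$ the triple $\{p,q,r\}$ is $k$-good if $p+q+r$ is odd and $p+q+r\ge 2k+1$, or $p+q+r$ is even and $p\le q+r$, $q\le p+r$, $r\le p+q$. Consider the following algorithm, with input an integer $k$ and a graph $B$. 1. Compute the odd-girth $g$ of $B$. If $g\ne 2k+1$, return NO. 2. Compute the distance function $d_B$ of $B$. Let $\widetilde B$ be the weighted graph on $V(B)$ whose edges are the pairs $xy$ with $1\le d_B(x,y)\le k$, the edge $xy$ having weight $d_B(x,y)$. Compute the set of $k$-good triples. 3. For each edge $xy$ of $\widetilde B$, of weight $p$ say, and each $k$-good triple $\{p,q,r\}$ containing $p$, check whether $\{p,q,r\}$ is realized on $xy$ in $\widetilde B$: there are (not necessarily distinct) vertices $z,z'$ such that $xz,yz,xz',yz'$ are edges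 of $\widetilde B$, $xz$ and $yz'$ have weight $q$, and $yz$ and $xz'$ have weight $r$. At the first edge $xy$ and triple where this fails: * if $p\ge 2$, delete the edge $xy$ from $\widetilde B$ and restart step 3; * if $p=1$ (so $xy$ is an edge of $B$), return the result of the algorithm on $(k,B-xy)$. 4. If no check fails, return YES. Implement it as a random access machine program under the uniform cost measure (each access to a register or to an array cell, arithmetic operation, comparison, assignment and branching costs one step), with $B$ given by its adjacency matrix, the distances and the odd-girth being computed by breadth-first searches from all vertices, and the edges and triples being scanned in lexicographic order. **Theorem.** There is an absolute constant $C$ such that for every $k$ and every graph $B$ of odd-girth $2k+1$ with $n$ vertices and $m$ edges, the program halts on input $(k,B)$, it returns YES if $B$ bounds $\mathcal{SP}_{2k+1}$ and NO if it does not, and its running time is at most $C\,mn^5k^3$. Moreover $mn^5k^3\le mn^8$, so the running time is $O(mn^5k^3)=O(mn^8)$. -/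

import Mathlib

namespace SPBound

/-! ### Graphs: odd-girth, minors, bounds -/

/-- The smallest length of an odd cycle (`⊤` for a bipartite graph). -/
noncomputable def oddGirth {V : Type*} (G : SimpleGraph V) : ℕ∞ :=
  ⨅ (a : V) (w : G.Walk a a) (_ : w.IsCycle ∧ Odd w.length), (w.length : ℕ∞)

/-- `H` is a minor of `G`: there are pairwise disjoint connected (in particular nonempty) branch
sets in `G`, one for each vertex of `H`, with an edge of `G` between the branch sets of any two
adjacent vertices of `H`. -/
def IsMinor {W V : Type*} (H : SimpleGraph W) (G : SimpleGraph V) : Prop :=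
  ∃ S : W → Set V,
    (∀ u, (G.induce (S u)).Connected) ∧
    (∀ u v, u ≠ v → Disjoint (S u) (S v)) ∧
    (∀ u v, H.Adj u v → ∃ x ∈ S u, ∃ y ∈ S v, G.Adj x y)

/-- `SP g` is the class of `K₄`-minor-free graphs of odd-girth at least `g`. -/
def SP (g : ℕ) {V : Type} (G : SimpleGraph V) : Prop :=
  ¬ IsMinor (⊤ : SimpleGraph (Fin 4)) G ∧ (g : ℕ∞) ≤ oddGirth G

/-- `B` bounds a class `C` of graphs: every finite graph in `C` has a homomorphism to `B`. -/
def Bounds {W : Type*} (B : SimpleGraph W) (C : ∀ {V : Type}, SimpleGraph V → Prop) : Prop :=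
  ∀ (V : Type) [Finite V] (G : SimpleGraph V), C G → Nonempty (G →g B)

/-! ### The machine model

A random access machine under the uniform cost measure.  It has named registers and named
two-dimensional arrays, all holding natural numbers.  Every literal, register access, array
access, arithmetic operation, comparison, logical connective, assignment and branching decision
costs one step. -/

/-- The registers. -/
inductive Reg
  | n | k | ans | halt | restart | fail | g | cnt
  | s | l | x | y | z | i | p | q | r | fwd | bwd | ex | ey
  deriving DecidableEq

/-- The arrays: adjacency matrix of the current graph `B`, its distance matrix, the weight matrix
of the current partial distance graph (`0` for a non-edge), the list of good triples. -/
inductive Arr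
  | adj | dist | wt | tri
  deriving DecidableEq

/-- A memory state. -/
structure State where
  reg : Reg → ℕ
  mem : Arr → ℕ → ℕ → ℕ

def State.setReg (st : State) (v : Reg) (a : ℕ) : State :=
  { st with reg := fun v' => if v' = v then a else st.reg v' }

def State.setMem (st : State) (A : Arr) (i j a : ℕ) : State :=
  { st with mem := fun A' i' j' => if A' = A ∧ i' = i ∧ j' = j then a else st.mem A' i' j' }

/-- Arithmetic expressions; `get A i j` reads the array cell `A[i, j]`. -/
inductive Expr
  | lit (c : ℕ)
  | reg (v : Reg)
  | get (A : Arr) (i j : Expr)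
  | add (a b : Expr)
  | mul (a b : Expr)
  | mod (a b : Expr)

def Expr.eval (st : State) : Expr → ℕ
  | lit c => c
  | reg v => st.reg v
  | get A i j => st.mem A (i.eval st) (j.eval st)
  | add a b => a.eval st + b.eval st
  | mul a b => a.eval st * b.eval st
  | mod a b => a.eval st % b.eval st

def Expr.cost : Expr → ℕ
  | lit _ => 1
  | reg _ => 1
  | get _ i j => i.cost + j.cost + 1
  | add a b => a.cost + b.cost + 1
  | mul a b => a.cost + b.cost + 1
  | mod a b => a.cost + b.cost + 1

/-- Boolean tests. -/
inductive Test
  | eq (a b : Expr)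
  | le (a b : Expr)
  | lt (a b : Expr)
  | and (a b : Test)
  | or (a b : Test)

def Test.eval (st : State) : Test → Bool
  | eq a b => decide (a.eval st = b.eval st)
  | le a b => decide (a.eval st ≤ b.eval st)
  | lt a b => decide (a.eval st < b.eval st)
  | and a b => a.eval st && b.eval st
  | or a b => a.eval st || b.eval st

def Test.cost : Test → ℕ
  | eq a b => a.cost + b.cost + 1
  | le a b => a.cost + b.cost + 1
  | lt a b => a.cost + b.cost + 1
  | and a b => a.cost + b.cost + 1
  | or a b => a.cost + b.cost + 1

/-- Programs. -/
inductive Cmd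
  | skip
  | assign (v : Reg) (e : Expr)
  | put (A : Arr) (i j e : Expr)
  | seq (c d : Cmd)
  | ite (b : Test) (c d : Cmd)
  | loop (b : Test) (c : Cmd)

/-- `Exec c s s' t`: the program `c`, started in the state `s`, halts in the state `s'` after
exactly `t` steps. -/
inductive Exec : Cmd → State → State → ℕ → Prop
  | skip (s : State) : Exec .skip s s 1
  | assign (v : Reg) (e : Expr) (s : State) :
      Exec (.assign v e) s (s.setReg v (e.eval s)) (e.cost + 1)
  | put (A : Arr) (i j e : Expr) (s : State) :
      Exec (.put A i j e) s (s.setMem A (i.eval s) (j.eval s) (e.eval s))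
        (i.cost + j.cost + e.cost + 1)
  | seq {c d : Cmd} {s s' s'' : State} {t t' : ℕ} (h : Exec c s s' t) (h' : Exec d s' s'' t') :
      Exec (.seq c d) s s'' (t + t')
  | iteTrue {b : Test} {c d : Cmd} {s s' : State} {t : ℕ} (hb : b.eval s = true)
      (h : Exec c s s' t) : Exec (.ite b c d) s s' (b.cost + 1 + t)
  | iteFalse {b : Test} {c d : Cmd} {s s' : State} {t : ℕ} (hb : b.eval s = false)
      (h : Exec d s s' t) : Exec (.ite b c d) s s' (b.cost + 1 + t)
  | loopTrue {b : Test} {c : Cmd} {s s' s'' : State} {t t' : ℕ} (hb : b.eval s = true)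
      (h : Exec c s s' t) (h' : Exec (.loop b c) s' s'' t') :
      Exec (.loop b c) s s'' (b.cost + 1 + t + t')
  | loopFalse {b : Test} {c : Cmd} {s : State} (hb : b.eval s = false) :
      Exec (.loop b c) s s (b.cost + 1)

/-- The machine is deterministic: final state and number of steps are functions of the program
and the initial state. -/
theorem Exec.det {c : Cmd} {s s₁ s₂ : State} {t₁ t₂ : ℕ} (h₁ : Exec c s s₁ t₁)
    (h₂ : Exec c s s₂ t₂) : s₁ = s₂ ∧ t₁ = t₂ := by
  induction h₁ generalizing s₂ t₂ with
  | skip s => cases h₂; exact ⟨rfl, rfl⟩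
  | assign v e s => cases h₂; exact ⟨rfl, rfl⟩
  | put A i j e s => cases h₂; exact ⟨rfl, rfl⟩
  | seq h h' ih ih' =>
    cases h₂ with
    | seq g g' =>
      obtain ⟨rfl, rfl⟩ := ih g
      obtain ⟨rfl, rfl⟩ := ih' g'
      exact ⟨rfl, rfl⟩
  | iteTrue hb h ih =>
    cases h₂ with
    | iteTrue hb' g => obtain ⟨rfl, rfl⟩ := ih g; exact ⟨rfl, rfl⟩
    | iteFalse hb' g => simp [hb] at hb'
  | iteFalse hb h ih =>
    cases h₂ with
    | iteTrue hb' g => simp [hb] at hb'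
    | iteFalse hb' g => obtain ⟨rfl, rfl⟩ := ih g; exact ⟨rfl, rfl⟩
  | loopTrue hb h h' ih ih' =>
    cases h₂ with
    | loopTrue hb' g g' =>
      obtain ⟨rfl, rfl⟩ := ih g
      obtain ⟨rfl, rfl⟩ := ih' g'
      exact ⟨rfl, rfl⟩
    | loopFalse hb' => simp [hb] at hb'
  | loopFalse hb =>
    cases h₂ with
    | loopTrue hb' g g' => simp [hb] at hb'
    | loopFalse hb' => exact ⟨rfl, rfl⟩

/-! ### Concrete syntax -/

instance : Coe Reg Expr := ⟨Expr.reg⟩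

infixl:65 " +ᵉ " => Expr.add
infixl:70 " *ᵉ " => Expr.mul
infixl:70 " %ᵉ " => Expr.mod
infix:50 " =ᵉ " => Test.eq
infix:50 " ≤ᵉ " => Test.le
infix:50 " <ᵉ " => Test.lt
infixr:35 " ∧ᵉ " => Test.and
infixr:30 " ∨ᵉ " => Test.or
infix:20 " ←ᵉ " => Cmd.assign

/-- Sequential composition. -/
def block : List Cmd → Cmd
  | [] => .skip
  | c :: cs => .seq c (block cs)

/-- `if b then c` (without an else branch). -/
def ifThen (b : Test) (c : Cmd) : Cmd := .ite b c .skip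

/-- `for v = 0, 1, …, hi - 1 do c`. -/
def forLoop (v : Reg) (hi : Expr) (c : Cmd) : Cmd :=
  block [v ←ᵉ .lit 0, .loop (v <ᵉ hi) (block [c, v ←ᵉ v +ᵉ .lit 1])]

/-! ### The algorithm -/

open Reg Arr

/-- All distances of the current graph, by breadth-first search from every vertex `s`; the value
`n` stands for an infinite distance. -/
def computeDist : Cmd :=
  forLoop s n <| block [
    forLoop x n (.put dist s x n),
    .put dist s s (.lit 0),
    forLoop l n <| forLoop x n <| ifThen (.get dist s x =ᵉ l) <|
      forLoop y n <| ifThen (.get adj x y =ᵉ .lit 1 ∧ᵉ .get dist s y =ᵉ n) <|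
        .put dist s y (l +ᵉ .lit 1)]

/-- The odd-girth `g` of the current graph (`0` for a bipartite graph): the least value of
`2 d(s,x) + 1` over all vertices `s` and edges `xy` with `d(s,x) = d(s,y)` finite. -/
def computeOddGirth : Cmd :=
  block [
    computeDist,
    g ←ᵉ .lit 0,
    forLoop s n <| forLoop x n <| forLoop y n <|
      ifThen (.get adj x y =ᵉ .lit 1 ∧ᵉ .get dist s x =ᵉ .get dist s y ∧ᵉ .get dist s x <ᵉ n ∧ᵉ
          (g =ᵉ .lit 0 ∨ᵉ .lit 2 *ᵉ .get dist s x +ᵉ .lit 1 <ᵉ g)) <|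
        g ←ᵉ .lit 2 *ᵉ .get dist s x +ᵉ .lit 1]

/-- The partial distance graph whose edges are all pairs at distance between `1` and `k`. -/
def computeWeights : Cmd :=
  forLoop x n <| forLoop y n <|
    .ite (.lit 1 ≤ᵉ .get dist x y ∧ᵉ .get dist x y <ᵉ n ∧ᵉ .get dist x y ≤ᵉ k)
      (.put wt x y (.get dist x y))
      (.put wt x y (.lit 0))

/-- The list `tri` of all `k`-good triples (ordered, with entries between `1` and `k`), `cnt` being
its length: `{p, q, r}` is `k`-good if `p + q + r` is odd and at least `2k + 1`, or if `p + q + r`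
is even and the triangular inequalities hold. -/
def computeTriples : Cmd :=
  block [
    cnt ←ᵉ .lit 0,
    forLoop p (k +ᵉ .lit 1) <| forLoop q (k +ᵉ .lit 1) <| forLoop r (k +ᵉ .lit 1) <|
      ifThen (.lit 1 ≤ᵉ p ∧ᵉ .lit 1 ≤ᵉ q ∧ᵉ .lit 1 ≤ᵉ r ∧ᵉ
          ((((p +ᵉ q +ᵉ r) %ᵉ .lit 2 =ᵉ .lit 1) ∧ᵉ
              (.lit 2 *ᵉ k +ᵉ .lit 1 ≤ᵉ p +ᵉ q +ᵉ r)) ∨ᵉ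
            (((p +ᵉ q +ᵉ r) %ᵉ .lit 2 =ᵉ .lit 0) ∧ᵉ
              (p ≤ᵉ q +ᵉ r ∧ᵉ q ≤ᵉ p +ᵉ r ∧ᵉ r ≤ᵉ p +ᵉ q)))) <|
        block [
          .put tri cnt (.lit 0) p,
          .put tri cnt (.lit 1) q,
          .put tri cnt (.lit 2) r,
          cnt ←ᵉ cnt +ᵉ .lit 1]]

/-- Is the triple `{p, q, r}` realized on the edge `xy` (of weight `p`) of the weighted graph `wt`?
If not, then `xy` is recorded as a failing edge `(ex, ey)`. -/
def checkTriple : Cmd :=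
  block [
    fwd ←ᵉ .lit 0,
    bwd ←ᵉ .lit 0,
    forLoop z n <| block [
      ifThen (.get wt x z =ᵉ q ∧ᵉ .get wt y z =ᵉ r) (fwd ←ᵉ .lit 1),
      ifThen (.get wt x z =ᵉ r ∧ᵉ .get wt y z =ᵉ q) (bwd ←ᵉ .lit 1)],
    ifThen (fwd =ᵉ .lit 0 ∨ᵉ bwd =ᵉ .lit 0) <| block [
      fail ←ᵉ .lit 1,
      ex ←ᵉ x,
      ey ←ᵉ y]]

/-- One pass of the loop over the edges `xy` of the weighted graph `wt` and the good triples
containing the weight `p` of `xy`; after the first failure the rest of the pass is skipped. -/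
def scanEdges : Cmd :=
  block [
    fail ←ᵉ .lit 0,
    forLoop x n <| forLoop y x <| ifThen (fail =ᵉ .lit 0 ∧ᵉ .lit 1 ≤ᵉ .get wt x y) <| block [
      p ←ᵉ .get wt x y,
      forLoop i cnt <| ifThen (fail =ᵉ .lit 0 ∧ᵉ .get tri i (.lit 0) =ᵉ p) <| block [
        q ←ᵉ .get tri i (.lit 1),
        r ←ᵉ .get tri i (.lit 2),
        checkTriple]]]

/-- The loop over the edges of the partial distance graph.  If no edge fails, the answer is YES.
If an edge of weight at least `2` fails, it is deleted from the partial distance graph and the loop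
is restarted.  If an edge of weight `1` fails, it is deleted from the current graph and the loop is
left without an answer. -/
def pruneLoop : Cmd :=
  block [
    restart ←ᵉ .lit 1,
    .loop (restart =ᵉ .lit 1) <| block [
      restart ←ᵉ .lit 0,
      scanEdges,
      .ite (fail =ᵉ .lit 0)
        (block [ans ←ᵉ .lit 1, halt ←ᵉ .lit 1])
        (.ite (.lit 2 ≤ᵉ .get wt ex ey)
          (block [
            .put wt ex ey (.lit 0),
            .put wt ey ex (.lit 0),
            restart ←ᵉ .lit 1])
          (block [
            .put adj ex ey (.lit 0),
            .put adj ey ex (.lit 0)]))]]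

/-- One call of the algorithm on the current graph: it either answers (`halt = 1`, and `ans` is `1`
for YES and `0` for NO) or deletes one edge of the current graph. -/
def callBody : Cmd :=
  block [
    computeOddGirth,
    .ite (g =ᵉ .lit 2 *ᵉ k +ᵉ .lit 1)
      (block [computeDist, computeWeights, computeTriples, pruneLoop])
      (block [ans ←ᵉ .lit 0, halt ←ᵉ .lit 1])]

/-- The whole algorithm.  The recursive call, being the last action of a call, is an iteration of
the outer loop. -/
def algorithm : Cmd :=
  block [
    ans ←ᵉ .lit 0,
    halt ←ᵉ .lit 0,
    .loop (halt =ᵉ .lit 0) callBody]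

open Classical in
/-- The input: `n`, `k` and the adjacency matrix of `B`; everything else is `0`. -/
noncomputable def input {N : ℕ} (K : ℕ) (B : SimpleGraph (Fin N)) : State where
  reg v := if v = Reg.n then N else if v = Reg.k then K else 0
  mem A i j :=
    if A = Arr.adj ∧ ∃ (hi : i < N) (hj : j < N), B.Adj ⟨i, hi⟩ ⟨j, hj⟩ then 1 else 0

end SPBound

namespace SPBound

open SimpleGraph

/-! ### Odd closed walks and odd-girth -/

/-! The bridge between homomorphism bounds and weighted graphs is the class of good 2-trees
(`GoodTree`). A weighted graph `D` is `Universal` if every good 2-tree maps to it preserving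
weights. If `B` has odd-girth at least 2k+1 and bounds the class, its partial distance graph is
universal (`universal_distWeight`). Conversely, `B` bounds the class as soon as some universal `D`
has all its weight-one edges in `B` (`bounds_of_universal`).

For the first direction, a good 2-tree is enlarged until each edge of weight p is joined by unit
walks of lengths p and 2k+1-p. The unit graph of the enlarged tree lies in the class, its odd-girth
being controlled by a map to the projective cube. A homomorphism to `B` then forces the two ends to
distance exactly p. For the second, distances cut off at k make every triple of vertices of a graph
in the class good. Removing vertices of degree at most two one by one then maps the graph to a good
2-tree.

Universality is exactly what pruning preserves. If a good triple is not realized on xy, every good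
2-tree can be enlarged so that each edge of that weight carries this triple in both orientations. A
map of the enlarged tree cannot use xy, so xy may be erased (`universal_erase`). If the erased edge
has weight one, the second direction shows that the smaller graph still bounds the class. If no
check fails, a good 2-tree can be mapped triangle by triangle (`universal_of_realized`), and the
answer YES is correct. The answer NO is correct because a bound must contain a closed walk of length
2k+1 (`exists_odd_walk_of_bounds`).

As for time, a scan examines O(n²) pairs, O(k³) triples and n apices. Each restart erases an edge of
the weighted graph, so a call makes O(n²) scans and costs O(n⁵k³); each further call has one edge of
the graph fewer. A program logic for total correctness with exact costs (`wp`) carries these bounds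
through the code. -/

theorem exists_closed_subwalk_of_not_isPath {V : Type*} {G : SimpleGraph V} {u v : V}
    (p : G.Walk u v) (hp : ¬ p.IsPath) :
    ∃ (x : V) (p₁ : G.Walk u x) (c : G.Walk x x) (p₂ : G.Walk x v),
      p.length = p₁.length + c.length + p₂.length ∧ 0 < c.length := by
  classical
  induction p with
  | nil => simp at hp
  | @cons a b d h q ih =>
    by_cases hq : q.IsPath
    · have ha : a ∈ q.support := by
        by_contra ha
        exact hp (hq.cons ha)
      refine ⟨a, .nil, .cons h (q.takeUntil a ha), q.dropUntil a ha, ?_, by simp⟩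
      have := congrArg Walk.length (q.take_spec ha)
      rw [Walk.length_append] at this
      simp only [Walk.length_cons, Walk.length_nil]
      omega
    · obtain ⟨x, p₁, c, p₂, hl, hc⟩ := ih hq
      refine ⟨x, .cons h p₁, c, p₂, ?_, hc⟩
      simp only [Walk.length_cons]
      omega

/-- If the walk after its first edge is a path, the first edge closes a cycle, since otherwise the
length would be two. If not, a closed subwalk splits off; either it or what remains is odd and
shorter. -/
theorem exists_odd_cycle_of_odd_closed_walk {V : Type*} {G : SimpleGraph V} (N : ℕ) :
    ∀ {a : V} (w : G.Walk a a), w.length = N → Odd w.length →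
    ∃ (b : V) (c : G.Walk b b), c.IsCycle ∧ Odd c.length ∧ c.length ≤ w.length := by
  induction N using Nat.strong_induction_on with
  | _ N ih =>
    intro a w hN hodd
    cases w with
    | nil => simp at hodd
    | @cons _ b _ h p =>
      by_cases hp : p.IsPath
      · by_cases he : s(a, b) ∈ p.edges
        · exfalso
          cases p with
          | nil => exact h.ne rfl
          | @cons _ c _ h' q =>
            rw [Walk.cons_isPath_iff] at hp
            rw [Walk.edges_cons, List.mem_cons] at he
            rcases he with he | he
            · have hc : c = a := by
                rcases Sym2.eq_iff.1 he with ⟨h1, h2⟩ | ⟨h1, _⟩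
                · exact absurd h1 h.ne
                · exact h1.symm
              subst hc
              have := Walk.length_eq_zero_iff.2 (Walk.isPath_iff_nil.1 hp.1)
              simp [Nat.odd_iff, this] at hodd
            · exact hp.2 (q.snd_mem_support_of_mem_edges he)
        · exact ⟨a, .cons h p, (Walk.cons_isCycle_iff p h).2 ⟨hp, he⟩, hodd, le_rfl⟩
      · obtain ⟨x, p₁, c, p₂, hl, hc⟩ := exists_closed_subwalk_of_not_isPath p hp
        rw [Walk.length_cons] at hN hodd
        by_cases hco : Odd c.length
        · obtain ⟨b', c', h1, h2, h3⟩ := ih c.length (by omega) c rfl hco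
          exact ⟨b', c', h1, h2, by rw [Walk.length_cons]; omega⟩
        · have hlen : (Walk.cons h (p₁.append p₂)).length = p₁.length + p₂.length + 1 := by
            simp
          obtain ⟨b', c', h1, h2, h3⟩ := ih _ (by omega) (Walk.cons h (p₁.append p₂)) rfl (by
            rw [hlen]
            rw [Nat.odd_iff] at *
            omega)
          exact ⟨b', c', h1, h2, by rw [Walk.length_cons]; omega⟩

/-- Closed walks, unlike cycles, can be concatenated and pushed through homomorphisms, so all later
arguments use this form. -/
theorem le_oddGirth_iff {V : Type*} (G : SimpleGraph V) (g : ℕ) :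
    (g : ℕ∞) ≤ oddGirth G ↔ ∀ (a : V) (w : G.Walk a a), Odd w.length → g ≤ w.length := by
  constructor
  · intro h a w hw
    obtain ⟨b, c, h1, h2, h3⟩ := exists_odd_cycle_of_odd_closed_walk _ w rfl hw
    refine le_trans ?_ h3
    exact_mod_cast h.trans (iInf_le_of_le b (iInf_le_of_le c (iInf_le_of_le ⟨h1, h2⟩ le_rfl)))
  · intro h
    refine le_iInf fun a => le_iInf fun w => le_iInf fun hw => ?_
    exact_mod_cast h a w hw.2

theorem exists_walk_of_oddGirth_eq {V : Type*} {G : SimpleGraph V} {g : ℕ}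
    (h : oddGirth G = g) : ∃ (a : V) (w : G.Walk a a), w.IsCycle ∧ Odd w.length ∧ w.length = g := by
  by_contra! hc
  have : ((g + 1 : ℕ) : ℕ∞) ≤ oddGirth G := by
    refine le_iInf fun a => le_iInf fun w => le_iInf fun hw => ?_
    have h1 := (le_oddGirth_iff G g).1 h.ge a w hw.2
    have h2 := hc a w hw.1 hw.2
    exact_mod_cast (by omega : g + 1 ≤ w.length)
  rw [h] at this
  have : g + 1 ≤ g := by exact_mod_cast this
  omega

/-! ### Minors -/

/-- Connectivity as a closure property: it passes between a graph and its contractions without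
transporting walks. -/
theorem induce_connected_iff {V : Type*} (G : SimpleGraph V) (S : Set V) :
    (G.induce S).Connected ↔ S.Nonempty ∧ ∀ P : Set V, (∃ x ∈ S, x ∈ P) →
      (∀ x ∈ S, x ∈ P → ∀ y ∈ S, G.Adj x y → y ∈ P) → S ⊆ P := by
  constructor
  · intro h
    refine ⟨Set.nonempty_coe_sort.1 h.nonempty, ?_⟩
    rintro P ⟨x, hx, hxP⟩ hP y hy
    obtain ⟨w⟩ := h.preconnected ⟨x, hx⟩ ⟨y, hy⟩
    have key : ∀ (a b : S), (G.induce S).Walk a b → (a : V) ∈ P → (b : V) ∈ P := by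
      intro a b w
      induction w with
      | nil => exact id
      | @cons a b c h _ ih => exact fun ha => ih (hP a a.2 ha b b.2 h)
    exact key _ _ w hxP
  · rintro ⟨⟨x, hx⟩, h⟩
    have : Nonempty S := ⟨⟨x, hx⟩⟩
    refine ⟨fun a b => ?_⟩
    have := h {y | ∃ hy : y ∈ S, (G.induce S).Reachable a ⟨y, hy⟩} ⟨a, a.2, a.2, Reachable.refl _⟩ (by
      rintro x hx ⟨_, hr⟩ y hy hxy
      exact ⟨hy, hr.trans (Adj.reachable (by simpa using hxy))⟩) b.2
    exact this.2

theorem IsMinor.mono {W V : Type*} {H : SimpleGraph W} {G G' : SimpleGraph V} (h : IsMinor H G)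
    (hG : G ≤ G') : IsMinor H G' := by
  obtain ⟨S, h1, h2, h3⟩ := h
  refine ⟨S, fun u => (h1 u).mono (fun a b hab => hG hab), h2, fun u v huv => ?_⟩
  obtain ⟨x, hx, y, hy, hxy⟩ := h3 u v huv
  exact ⟨x, hx, y, hy, hG hxy⟩

/-! ### Contraction and elimination of a vertex -/

/-- The contraction of `v` into `a`. -/
def contr {V : Type*} (G : SimpleGraph V) (v a : V) : SimpleGraph {x // x ≠ v} where
  Adj x y := x ≠ y ∧ (G.Adj x y ∨ (x.1 = a ∧ G.Adj v y) ∨ (y.1 = a ∧ G.Adj x v))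
  symm := ⟨by
    rintro x y ⟨h, h'⟩
    refine ⟨h.symm, ?_⟩
    simp only [G.adj_comm y x, G.adj_comm v x, G.adj_comm y v]
    tauto⟩
  loopless := ⟨fun x h => h.1 rfl⟩

/-- The branch set containing `a`, if there is one, absorbs `v`, and an edge created at `a` is
recovered through `v`. Allowing an isolated `v` makes the lemma cover plain deletion as well. -/
theorem IsMinor.of_contr {W V : Type*} {H : SimpleGraph W} {G : SimpleGraph V} {v a : V}
    (hva : G.Adj v a ∨ ∀ x, ¬ G.Adj v x) (h : IsMinor H (contr G v a)) : IsMinor H G := by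
  classical
  obtain ⟨S, h1, h2, h3⟩ := h
  simp only [induce_connected_iff] at h1
  set S' : W → Set V := fun u => {x | (∃ hx : x ≠ v, ⟨x, hx⟩ ∈ S u) ∨
    (x = v ∧ G.Adj v a ∧ ∃ ha : a ≠ v, ⟨a, ha⟩ ∈ S u)} with hS'
  refine ⟨S', fun u => (induce_connected_iff _ _).2 ⟨?_, ?_⟩, ?_, ?_⟩
  · obtain ⟨x, hx⟩ := (h1 u).1
    exact ⟨x, Or.inl ⟨x.2, hx⟩⟩
  · intro P hP hcl
    have hsub : S u ⊆ Subtype.val ⁻¹' P := by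
      refine (h1 u).2 _ ?_ ?_
      · obtain ⟨x, hx | hx, hxP⟩ := hP
        · exact ⟨⟨x, hx.1⟩, hx.2, hxP⟩
        · obtain ⟨rfl, hadj, ha, haS⟩ := hx
          exact ⟨⟨a, ha⟩, haS, hcl x (Or.inr ⟨rfl, hadj, ha, haS⟩) hxP a (Or.inl ⟨ha, haS⟩) hadj⟩
      · rintro ⟨x, hx⟩ hxS hxP ⟨y, hy⟩ hyS ⟨hne, hadj⟩
        have hxS' : x ∈ S' u := Or.inl ⟨hx, hxS⟩
        have hyS' : y ∈ S' u := Or.inl ⟨hy, hyS⟩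
        simp only at hadj
        rcases hadj with hadj | ⟨rfl, hadj⟩ | ⟨rfl, hadj⟩
        · exact hcl x hxS' hxP y hyS' hadj
        · have hvx := hva.resolve_right (fun h => h _ hadj)
          have hvS : v ∈ S' u := Or.inr ⟨rfl, hvx, hx, hxS⟩
          exact hcl v hvS (hcl x hxS' hxP v hvS hvx.symm) y hyS' hadj
        · have hvy := hva.resolve_right (fun h => h _ hadj.symm)
          have hvS : v ∈ S' u := Or.inr ⟨rfl, hvy, hy, hyS⟩
          exact hcl v hvS (hcl x hxS' hxP v hvS hadj) y hyS' hvy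
    rintro x (⟨hx, hxS⟩ | ⟨rfl, hadj, ha, haS⟩)
    · exact hsub hxS
    · exact hcl a (Or.inl ⟨ha, haS⟩) (hsub haS) x (Or.inr ⟨rfl, hadj, ha, haS⟩) hadj.symm
  · intro u w huw
    rw [Set.disjoint_left]
    have hd := Set.disjoint_left.1 (h2 u w huw)
    rintro x (⟨hx, hxS⟩ | ⟨rfl, hadj, ha, haS⟩) (⟨hx', hxS'⟩ | ⟨hx', hadj', ha', haS'⟩)
    · exact hd hxS hxS'
    · exact hx hx'
    · exact hx' rfl
    · exact hd haS haS'
  · intro u w huw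
    obtain ⟨⟨x, hx⟩, hxS, ⟨y, hy⟩, hyS, hne, hadj⟩ := h3 u w huw
    simp only at hadj
    rcases hadj with hadj | ⟨rfl, hadj⟩ | ⟨rfl, hadj⟩
    · exact ⟨x, Or.inl ⟨hx, hxS⟩, y, Or.inl ⟨hy, hyS⟩, hadj⟩
    · have hvx := hva.resolve_right (fun h => h _ hadj)
      exact ⟨v, Or.inr ⟨rfl, hvx, hx, hxS⟩, y, Or.inl ⟨hy, hyS⟩, hadj⟩
    · have hvy := hva.resolve_right (fun h => h _ hadj.symm)
      exact ⟨x, Or.inl ⟨hx, hxS⟩, v, Or.inr ⟨rfl, hvy, hy, hyS⟩, hadj⟩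

/-- Removing a vertex all of whose neighbours are among two adjacent vertices does not destroy a
`K₄`-minor. -/
theorem IsMinor.of_elimination {V : Type*} {T : SimpleGraph V} {T' : SimpleGraph (Option V)}
    {u v : V} (hsome : ∀ x y, T'.Adj (some x) (some y) → T.Adj x y)
    (hnone : ∀ x, T'.Adj none (some x) → x = u ∨ x = v) (huv : T.Adj u v)
    (h : IsMinor (⊤ : SimpleGraph (Fin 4)) T') : IsMinor (⊤ : SimpleGraph (Fin 4)) T := by
  obtain ⟨S, h1, h2, h3⟩ := h
  simp only [induce_connected_iff] at h1
  have hd : ∀ i j x, x ∈ S i → x ∈ S j → i = j := by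
    intro i j x hi hj
    by_contra hij
    exact Set.disjoint_left.1 (h2 i j hij) hi hj
  have hnb : ∀ i, none ∈ S i → (∃ x, some x ∈ S i) →
      ∃ x, some x ∈ S i ∧ T'.Adj none (some x) := by
    rintro i hi ⟨x, hx⟩
    by_contra! hcon
    have := (h1 i).2 {none} ⟨none, hi, rfl⟩ (by
      rintro _ _ rfl y hy hadj
      cases y with
      | none => rfl
      | some y => exact absurd hadj (hcon y hy)) hx
    simp at this
  -- A branch set reduced to `none` would be adjacent to three disjoint branch sets, each containing
  -- `u` or `v`: too many for two vertices.
  have hne : ∀ i, ∃ x, some x ∈ S i := by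
    intro i
    by_contra! hcon
    have hi : none ∈ S i := by
      obtain ⟨x, hx⟩ := (h1 i).1
      cases x with
      | none => exact hx
      | some x => exact absurd hx (hcon x)
    have hj : ∀ j, j ≠ i → some u ∈ S j ∨ some v ∈ S j := by
      intro j hj
      obtain ⟨x, hx, y, hy, hxy⟩ := h3 i j (by simpa using hj.symm)
      cases x with
      | some x => exact absurd hx (hcon x)
      | none =>
        cases y with
        | none => exact absurd hxy (T'.loopless.irrefl _)
        | some y =>
          rcases hnone y hxy with rfl | rfl
          · exact Or.inl hy
          · exact Or.inr hy
    have : ∃ a b c : Fin 4, a ≠ i ∧ b ≠ i ∧ c ≠ i ∧ a ≠ b ∧ a ≠ c ∧ b ≠ c := by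
      clear hcon hi hj
      revert i; decide
    obtain ⟨a, b, c, ha, hb, hc, hab, hac, hbc⟩ := this
    rcases hj a ha with h | h <;> rcases hj b hb with h' | h' <;> rcases hj c hc with h'' | h'' <;>
      first
        | exact hab (hd _ _ _ h h')
        | exact hac (hd _ _ _ h h'')
        | exact hbc (hd _ _ _ h' h'')
  refine ⟨fun i => {x | some x ∈ S i}, fun i => (induce_connected_iff _ _).2 ⟨hne i, ?_⟩, ?_, ?_⟩
  · rintro P ⟨x, hx, hxP⟩ hcl
    -- `none` joins `P` exactly when `P` contains `u` or `v` inside the branch set; a passage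
    -- through `none` from one to the other is replaced by the edge `uv`.
    have hsub := (h1 i).2 {y | (∃ x ∈ P, y = some x) ∨
        (y = none ∧ ((u ∈ P ∧ some u ∈ S i) ∨ (v ∈ P ∧ some v ∈ S i)))}
      ⟨some x, hx, Or.inl ⟨x, hxP, rfl⟩⟩ (by
        rintro x hx hxP y hy hadj
        rcases hxP with ⟨x, hxP, rfl⟩ | ⟨rfl, hxP⟩
        · cases y with
          | none =>
            refine Or.inr ⟨rfl, ?_⟩
            rcases hnone x hadj.symm with rfl | rfl
            · exact Or.inl ⟨hxP, hx⟩
            · exact Or.inr ⟨hxP, hx⟩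
          | some y => exact Or.inl ⟨y, hcl x hx hxP y hy (hsome x y hadj), rfl⟩
        · cases y with
          | none => exact absurd hadj (T'.loopless.irrefl _)
          | some y =>
            refine Or.inl ⟨y, ?_, rfl⟩
            rcases hnone y hadj with rfl | rfl <;> rcases hxP with ⟨h, h'⟩ | ⟨h, h'⟩
            · exact h
            · exact hcl _ h' h y hy huv.symm
            · exact hcl _ h' h y hy huv
            · exact h)
    intro y hy
    rcases hsub hy with ⟨y', hy', h⟩ | ⟨h, _⟩
    · rw [Option.some.injEq] at h; exact h ▸ hy'
    · cases h
  · intro i j hij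
    rw [Set.disjoint_left]
    exact fun x hx hx' => hij (hd _ _ _ hx hx')
  · have key : ∀ i j, i ≠ j → none ∈ S i → ∀ y, some y ∈ S j → T'.Adj none (some y) →
        ∃ x, some x ∈ S i ∧ T.Adj x y := by
      intro i j hij hi y hy hadj
      obtain ⟨x, hx, hxadj⟩ := hnb i hi (hne i)
      refine ⟨x, hx, ?_⟩
      have hxy : x ≠ y := by
        rintro rfl
        exact hij (hd _ _ _ hx hy)
      rcases hnone x hxadj with rfl | rfl <;> rcases hnone y hadj with rfl | rfl
      · exact absurd rfl hxy
      · exact huv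
      · exact huv.symm
      · exact absurd rfl hxy
    intro i j hij
    have hij' : i ≠ j := by simpa using hij
    obtain ⟨x, hx, y, hy, hxy⟩ := h3 i j hij
    cases x with
    | none =>
      cases y with
      | none => exact absurd hxy (T'.loopless.irrefl _)
      | some y =>
        obtain ⟨x, hx', h⟩ := key i j hij' hx y hy hxy
        exact ⟨x, hx', y, hy, h⟩
    | some x =>
      cases y with
      | none =>
        obtain ⟨y, hy', h⟩ := key j i hij'.symm hy x hx hxy.symm
        exact ⟨x, hx, y, hy', h.symm⟩
      | some y => exact ⟨x, hx, y, hy, hsome x y hxy⟩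


/-! ### Graphs of minimum degree three -/

theorem isMinor_top_four_of_adj {V : Type*} {G : SimpleGraph V} {a b c d : V} (hab : G.Adj a b)
    (hac : G.Adj a c) (had : G.Adj a d) (hbc : G.Adj b c) (hbd : G.Adj b d) (hcd : G.Adj c d) :
    IsMinor (⊤ : SimpleGraph (Fin 4)) G := by
  have hadj : ∀ i j : Fin 4, i ≠ j → G.Adj (![a, b, c, d] i) (![a, b, c, d] j) := by
    intro i j hij
    fin_cases i <;> fin_cases j <;>
      simp [hab, hac, had, hbc, hbd, hcd, hab.symm, hac.symm, had.symm, hbc.symm, hbd.symm,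
        hcd.symm] at hij ⊢
  refine ⟨fun i => {![a, b, c, d] i}, fun i => (induce_connected_iff _ _).2 ⟨⟨_, rfl⟩, ?_⟩, ?_, ?_⟩
  · rintro P ⟨x, rfl, hx⟩ -
    exact Set.singleton_subset_iff.2 hx
  · intro i j hij
    exact Set.disjoint_singleton.2 (hadj i j hij).ne
  · intro i j hij
    exact ⟨_, rfl, _, rfl, hadj i j (by simpa using hij)⟩

theorem exists_contr_adj_imp {V : Type*} {G : SimpleGraph V} {t a : V}
    (h : ∃ z p q, ∀ x, (contr G t a).Adj z x → x = p ∨ x = q) :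
    ∃ z p q, z ≠ t ∧ p ≠ t ∧ q ≠ t ∧ ∀ x, x ≠ t → x ≠ z →
      (G.Adj z x ∨ (z = a ∧ G.Adj t x) ∨ (x = a ∧ G.Adj z t)) → x = p ∨ x = q := by
  obtain ⟨⟨z, hz⟩, ⟨p, hp⟩, ⟨q, hq⟩, h⟩ := h
  refine ⟨z, p, q, hz, hp, hq, fun x hxt hxz hx => ?_⟩
  simpa using h ⟨x, hxt⟩ ⟨by simpa using hxz.symm, hx⟩

/-- A finite nonempty `K₄`-minor-free graph has a vertex of degree at most two. -/
theorem exists_degree_le_two (n : ℕ) : ∀ (V : Type) [Finite V] [Nonempty V] (G : SimpleGraph V),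
    Nat.card V = n → ¬ IsMinor (⊤ : SimpleGraph (Fin 4)) G →
    ∃ z p q, ∀ x, G.Adj z x → x = p ∨ x = q := by
  induction n using Nat.strong_induction_on with
  | _ n ih =>
  intro V _ _ G hcard hK
  by_contra! hdeg
  have hlt : ∀ t : V, Nat.card {x // x ≠ t} < n := by
    intro t
    rw [← hcard]
    exact Finite.card_subtype_lt (p := fun x => x ≠ t) (x := t) (by simp)
  have hcontr : ∀ t a, G.Adj t a →
      ∃ z p q, z ≠ t ∧ p ≠ t ∧ q ≠ t ∧ ∀ x, x ≠ t → x ≠ z →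
        (G.Adj z x ∨ (z = a ∧ G.Adj t x) ∨ (x = a ∧ G.Adj z t)) → x = p ∨ x = q := by
    intro t a hta
    have : Nonempty {x // x ≠ t} := ⟨⟨a, hta.ne'⟩⟩
    exact exists_contr_adj_imp (ih _ (hlt t) _ (contr G t a) rfl
      (fun h => hK (h.of_contr (Or.inl hta))))
  -- every edge lies in a triangle, and there is a vertex of degree three near it
  have hedge : ∀ v a, G.Adj v a → ∃ z, G.Adj v z ∧ G.Adj a z ∧
      ∃ t x y w, ∀ u, G.Adj t u → u = x ∨ u = y ∨ u = w := by
    intro v a hva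
    obtain ⟨z, p, q, hz, -, -, h⟩ := hcontr v a hva
    -- All degrees were at least three. After contraction a smaller degree occurs only at the merged
    -- vertex, whose two halves then share their other neighbours, or at a common neighbour of `v`
    -- and `a`, whose degree was three.
    by_cases hza : z = a
    · subst hza
      have hv : ∀ u, G.Adj v u → u = z ∨ u = p ∨ u = q := fun u hu => by
        by_cases huz : u = z
        · exact Or.inl huz
        · exact Or.inr (h u hu.ne' huz (Or.inr (Or.inl ⟨rfl, hu⟩)))
      have ha : ∀ u, G.Adj z u → u = v ∨ u = p ∨ u = q := fun u hu => by
        by_cases huz : u = v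
        · exact Or.inl huz
        · exact Or.inr (h u huz hu.ne' (Or.inl hu))
      obtain ⟨x, hx, hxz, hxq⟩ := hdeg v z q
      obtain rfl : x = p := by have := hv x hx; tauto
      obtain ⟨y, hy, hyz, hyq⟩ := hdeg z v q
      obtain rfl : y = x := by have := ha y hy; tauto
      exact ⟨y, hx, hy, v, _, _, _, hv⟩
    · have hzv : G.Adj z v := by
        by_contra hzv
        obtain ⟨x, hx, hxp, hxq⟩ := hdeg z p q
        have := h x (by rintro rfl; exact hzv hx) hx.ne' (Or.inl hx)
        tauto
      have hN : ∀ u, G.Adj z u → u = v ∨ u = p ∨ u = q := fun u hu => by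
        by_cases huv : u = v
        · exact Or.inl huv
        · exact Or.inr (h u huv hu.ne' (Or.inl hu))
      have hapq := h a hva.ne' (Ne.symm hza) (Or.inr (Or.inr ⟨rfl, hzv⟩))
      refine ⟨z, hzv.symm, ?_, z, _, _, _, hN⟩
      rcases hapq with rfl | rfl
      · obtain ⟨x, hx, hxv, hxq⟩ := hdeg z v q
        have := hN x hx
        obtain rfl : x = a := by tauto
        exact hx.symm
      · obtain ⟨x, hx, hxv, hxq⟩ := hdeg z v p
        have := hN x hx
        obtain rfl : x = a := by tauto
        exact hx.symm
  -- a vertex of degree three together with a path in its neighbourhood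
  obtain ⟨t, a, b, c, hab, hac, hbc, hta, htb, htc, hN, hadjab, hadjbc⟩ : ∃ t a b c, a ≠ b ∧
      a ≠ c ∧ b ≠ c ∧ G.Adj t a ∧ G.Adj t b ∧ G.Adj t c ∧
      (∀ u, G.Adj t u → u = a ∨ u = b ∨ u = c) ∧ G.Adj a b ∧ G.Adj b c := by
    obtain ⟨v⟩ := ‹Nonempty V›
    obtain ⟨w, hw, -⟩ := hdeg v v v
    obtain ⟨-, -, -, t, x, y, z, hN⟩ := hedge v w hw
    obtain ⟨x', hx, hxy, hxz⟩ := hdeg t y z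
    obtain rfl : x' = x := by have := hN x' hx; tauto
    obtain ⟨y', hy, hyx, hyz⟩ := hdeg t x' z
    obtain rfl : y' = y := by have := hN y' hy; tauto
    obtain ⟨z', hz, hzx, hzy⟩ := hdeg t x' y'
    obtain rfl : z' = z := by have := hN z' hz; tauto
    -- The triangles on the three edges at `t` give each neighbour of `t` an adjacent neighbour of
    -- `t`; so two of the three possible edges are present, and they form a path.
    have hX : G.Adj x' y' ∨ G.Adj x' z' := by
      obtain ⟨u, hu, hu', -⟩ := hedge t x' hx
      rcases hN u hu with rfl | rfl | rfl
      · exact absurd hu' (G.loopless.irrefl _)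
      · exact Or.inl hu'
      · exact Or.inr hu'
    have hY : G.Adj x' y' ∨ G.Adj y' z' := by
      obtain ⟨u, hu, hu', -⟩ := hedge t y' hy
      rcases hN u hu with rfl | rfl | rfl
      · exact Or.inl hu'.symm
      · exact absurd hu' (G.loopless.irrefl _)
      · exact Or.inr hu'
    have hZ : G.Adj x' z' ∨ G.Adj y' z' := by
      obtain ⟨u, hu, hu', -⟩ := hedge t z' hz
      rcases hN u hu with rfl | rfl | rfl
      · exact Or.inl hu'.symm
      · exact Or.inr hu'.symm
      · exact absurd hu' (G.loopless.irrefl _)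
    by_cases h1 : G.Adj x' y'
    · by_cases h2 : G.Adj y' z'
      · exact ⟨t, x', y', z', hxy, hxz, hyz, hx, hy, hz, hN, h1, h2⟩
      · exact ⟨t, y', x', z', hyx, hyz, hxz, hy, hx, hz, fun u hu => by have := hN u hu; tauto,
          h1.symm, hZ.resolve_right h2⟩
    · exact ⟨t, x', z', y', hxz, hxy, hzy, hx, hz, hy, fun u hu => by have := hN u hu; tauto,
        hX.resolve_left h1, (hY.resolve_left h1).symm⟩
  have hnac : ¬ G.Adj a c := fun h =>
    hK (isMinor_top_four_of_adj hta htb htc hadjab h hadjbc)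
  -- contracting `ta` shows that `b` has degree three
  have hNb : ∀ u, G.Adj b u → u = t ∨ u = a ∨ u = c := by
    obtain ⟨z, p, q, hz, -, -, h⟩ := hcontr t a hta
    by_cases hza : z = a
    · subst hza
      obtain ⟨y, hy, hyt, hyb⟩ := hdeg z t b
      have h1 := h b htb.ne' hab.symm (Or.inl hadjab)
      have h2 := h c htc.ne' hac.symm (Or.inr (Or.inl ⟨rfl, htc⟩))
      have h3 := h y hyt hy.ne' (Or.inl hy)
      have h4 : y ≠ c := by rintro rfl; exact hnac hy
      grind
    by_cases hzc : z = c
    · subst hzc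
      obtain ⟨y, hy, hyt, hyb⟩ := hdeg z t b
      have h1 := h b htb.ne' hbc (Or.inl hadjbc.symm)
      have h2 := h a hta.ne' hac (Or.inr (Or.inr ⟨rfl, htc.symm⟩))
      have h3 := h y hyt hy.ne' (Or.inl hy)
      have h4 : y ≠ a := by rintro rfl; exact hnac hy.symm
      grind
    by_cases hzb : z = b
    · subst hzb
      have h1 := h a hta.ne' hab (Or.inl hadjab.symm)
      have h2 := h c htc.ne' hbc.symm (Or.inl hadjbc)
      intro u hu
      by_cases hut : u = t
      · exact Or.inl hut
      have h3 := h u hut hu.ne' (Or.inl hu)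
      grind
    · exfalso
      obtain ⟨x, hx, hxp, hxq⟩ := hdeg z p q
      have hzt : ¬ G.Adj t z := fun hzt => by have := hN z hzt; tauto
      have := h x (by rintro rfl; exact hzt hx.symm) hx.ne' (Or.inl hx)
      tauto
  -- contracting both `t` and `b` into `a`
  have hba : (contr G t a).Adj ⟨b, htb.ne'⟩ ⟨a, hta.ne'⟩ :=
    ⟨by simpa using hab.symm, Or.inl hadjab.symm⟩
  have : Nonempty {x : {x // x ≠ t} // x ≠ ⟨b, htb.ne'⟩} :=
    ⟨⟨⟨a, hta.ne'⟩, by simpa using hab⟩⟩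
  have hlt2 : Nat.card {x : {x // x ≠ t} // x ≠ ⟨b, htb.ne'⟩} < n :=
    (Finite.card_subtype_lt (p := fun x : {x // x ≠ t} => x ≠ ⟨b, htb.ne'⟩)
      (x := ⟨b, htb.ne'⟩) (by simp)).trans (hlt t)
  obtain ⟨⟨z, hzt⟩, ⟨p, hpt⟩, ⟨q, hqt⟩, hzb, -, -, h⟩ := exists_contr_adj_imp
    (ih _ hlt2 _ (contr (contr G t a) ⟨b, htb.ne'⟩ ⟨a, hta.ne'⟩) rfl
      (fun h => hK ((h.of_contr (Or.inl hba)).of_contr (Or.inl hta))))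
  simp only [contr, ne_eq, Subtype.forall, Subtype.mk.injEq] at h hzb
  -- If the low vertex is `a` or `c`, the contraction makes the other of these one of its two
  -- neighbours. So it has only one neighbour `y` besides `t` and `b`. The triangle on the edge to
  -- `y` would then need `t` or `b` adjacent to `y`.
  have hright : ∀ e f, (e = a ∧ f = c) ∨ (e = c ∧ f = a) → z = e → False := by
    rintro e f hef rfl
    have htz : G.Adj t z := by rcases hef with ⟨rfl, -⟩ | ⟨rfl, -⟩ <;> assumption
    have hbz : G.Adj b z := by
      rcases hef with ⟨rfl, -⟩ | ⟨rfl, -⟩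
      · exact hadjab.symm
      · exact hadjbc
    have hzf : ¬ G.Adj z f := by
      rcases hef with ⟨rfl, rfl⟩ | ⟨rfl, rfl⟩
      · exact hnac
      · exact fun h => hnac h.symm
    have hf : f = p ∨ f = q := by
      rcases hef with ⟨rfl, rfl⟩ | ⟨rfl, rfl⟩
      · exact h f htc.ne' hbc.symm hac.symm (Or.inl ⟨hac, Or.inr (Or.inl ⟨rfl, htc⟩)⟩)
      · exact h f hta.ne' hab hac (Or.inl ⟨hac.symm, Or.inr (Or.inr ⟨rfl, htc.symm⟩)⟩)
    obtain ⟨y, hy, hyt, hyb⟩ := hdeg z t b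
    have hyz := h y hyt hyb hy.ne' (Or.inl ⟨hy.ne, Or.inl hy⟩)
    have hyf : y ≠ f := by rintro rfl; exact hzf hy
    have hNz : ∀ u, G.Adj z u → u = t ∨ u = b ∨ u = y := by
      intro u hu
      by_cases hut : u = t
      · exact Or.inl hut
      by_cases hub : u = b
      · exact Or.inr (Or.inl hub)
      have := h u hut hub hu.ne' (Or.inl ⟨hu.ne, Or.inl hu⟩)
      have huf : u ≠ f := by rintro rfl; exact hzf hu
      grind
    obtain ⟨w, hw, hyw, -⟩ := hedge z y hy
    have hyne := hy.ne
    rcases hNz w hw with rfl | rfl | rfl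
    · have := hN y hyw.symm
      grind
    · have := hNb y hyw.symm
      grind
    · exact G.loopless.irrefl _ hyw
  by_cases hza : z = a
  · exact hright a c (Or.inl ⟨rfl, rfl⟩) hza
  by_cases hzc : z = c
  · exact hright c a (Or.inr ⟨rfl, rfl⟩) hzc
  -- Any other vertex is adjacent to neither `t` nor `b`, so both contractions leave its degree at
  -- three or more.
  obtain ⟨x, hx, hxp, hxq⟩ := hdeg z p q
  have hx1 : x ≠ t := by rintro rfl; have := hN z hx.symm; tauto
  have hx2 : x ≠ b := by rintro rfl; have := hNb z hx.symm; tauto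
  have := h x hx1 hx2 hx.ne' (Or.inl ⟨hx.ne, Or.inl hx⟩)
  tauto


/-! ### Good triples and weighted 2-trees -/

/-- The ordered triple `(p, q, r)` is `k`-good. -/
def Good (k p q r : ℕ) : Prop :=
  1 ≤ p ∧ p ≤ k ∧ 1 ≤ q ∧ q ≤ k ∧ 1 ≤ r ∧ r ≤ k ∧
    (((p + q + r) % 2 = 1 ∧ 2 * k + 1 ≤ p + q + r) ∨
      ((p + q + r) % 2 = 0 ∧ p ≤ q + r ∧ q ≤ p + r ∧ r ≤ p + q))

theorem exists_good {k p q : ℕ} (hp : 1 ≤ p) (hpk : p ≤ k) (hq : 1 ≤ q) (hqk : q ≤ k) :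
    ∃ r, Good k p q r := by
  rcases lt_trichotomy p q with h | h | h
  · exact ⟨q - p, by unfold Good; omega⟩
  -- For p = q the difference 0 is not a weight; the even triple {p, p, 2} serves, or the odd triple
  -- {1, 1, 1} when k = 1.
  · by_cases hk : 2 ≤ k
    · exact ⟨2, by unfold Good; omega⟩
    · exact ⟨1, by unfold Good; omega⟩
  · exact ⟨p - q, by unfold Good; omega⟩

open Classical in
/-- The weighted graph obtained by gluing a triangle on `uv`, its new sides at `u` and `v` having
weights `q` and `r`. -/
noncomputable def glue {V : Type} (w : V → V → ℕ) (u v : V) (q r : ℕ) : Option V → Option V → ℕ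
  | some a, some b => w a b
  | some a, none => if a = u then q else if a = v then r else 0
  | none, some a => if a = u then q else if a = v then r else 0
  | none, none => 0

/-- Weighted 2-trees, weight `0` standing for a non-edge, all of whose triangles are `k`-good. -/
inductive GoodTree (k : ℕ) : (V : Type) → (V → V → ℕ) → Prop
  | edge (p : ℕ) (hp : 1 ≤ p) (hpk : p ≤ k) : GoodTree k Bool (fun a b => if a = b then 0 else p)
  | glue {V : Type} {w : V → V → ℕ} {u v : V} {q r : ℕ} (h : GoodTree k V w)
      (hg : Good k (w u v) q r) : GoodTree k (Option V) (glue w u v q r)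

/-- Weight-preserving maps of weighted graphs. -/
def WHom {V W : Type*} (w : V → V → ℕ) (D : W → W → ℕ) (f : V → W) : Prop :=
  ∀ a b, w a b ≠ 0 → D (f a) (f b) = w a b

theorem WHom.comp {V W X : Type*} {w : V → V → ℕ} {D : W → W → ℕ} {E : X → X → ℕ} {g : W → X}
    {f : V → W} (hg : WHom D E g) (hf : WHom w D f) : WHom w E (g ∘ f) := by
  intro a b hab
  have := hf a b hab
  rw [Function.comp, Function.comp, hg _ _ (by rwa [this]), this]

theorem WHom.id {V : Type*} {w : V → V → ℕ} : WHom w w id := fun _ _ _ => rfl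

theorem whom_some {V : Type} {w : V → V → ℕ} {u v : V} {q r : ℕ} :
    WHom w (SPBound.glue w u v q r) some := fun _ _ _ => rfl

theorem glue_none_left {V : Type} (w : V → V → ℕ) (u v : V) (q r : ℕ) :
    SPBound.glue w u v q r none (some u) = q := by simp [SPBound.glue]

theorem glue_left_none {V : Type} (w : V → V → ℕ) (u v : V) (q r : ℕ) :
    SPBound.glue w u v q r (some u) none = q := by simp [SPBound.glue]

theorem glue_none_right {V : Type} (w : V → V → ℕ) {u v : V} (h : u ≠ v) (q r : ℕ) :
    SPBound.glue w u v q r none (some v) = r := by simp [SPBound.glue, h.symm]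

theorem glue_right_none {V : Type} (w : V → V → ℕ) {u v : V} (h : u ≠ v) (q r : ℕ) :
    SPBound.glue w u v q r (some v) none = r := by simp [SPBound.glue, h.symm]

namespace GoodTree

variable {k : ℕ} {V : Type} {w : V → V → ℕ}

theorem symm (h : GoodTree k V w) (a b : V) : w a b = w b a := by
  induction h with
  | edge p => simp [eq_comm]
  | glue h hg ih => cases a <;> cases b <;> simp [SPBound.glue, ih]

theorem self (h : GoodTree k V w) (a : V) : w a a = 0 := by
  induction h with
  | edge p => simp
  | glue h hg ih => cases a <;> simp [SPBound.glue, ih]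

theorem ne (h : GoodTree k V w) {a b : V} (hab : w a b ≠ 0) : a ≠ b := by
  rintro rfl
  exact hab (h.self a)

theorem le (h : GoodTree k V w) (a b : V) : w a b ≤ k := by
  induction h with
  | edge p hp hpk =>
    simp only
    split_ifs <;> omega
  | glue h hg ih =>
    cases a <;> cases b <;> simp only [SPBound.glue] <;> unfold Good at hg
    · omega
    · split_ifs <;> omega
    · split_ifs <;> omega
    · exact ih _ _

theorem finite (h : GoodTree k V w) : Finite V := by
  induction h with
  | edge p => infer_instance
  | glue h hg ih => infer_instance

theorem nonempty (h : GoodTree k V w) : Nonempty V := by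
  induction h with
  | edge p => infer_instance
  | glue h hg ih => infer_instance

theorem exists_ne_zero (h : GoodTree k V w) (a : V) : ∃ b, w a b ≠ 0 := by
  induction h with
  | edge p hp hpk =>
    refine ⟨!a, ?_⟩
    cases a <;> simp <;> omega
  | @glue V w u v q r h hg ih =>
    cases a with
    | none => exact ⟨some u, by rw [glue_none_left]; unfold Good at hg; omega⟩
    | some a =>
      obtain ⟨b, hb⟩ := ih a
      exact ⟨some b, hb⟩

/-- If every edge can be given a property, stable under weight-preserving maps, in some good tree
extending the given one, then all edges can be given this property simultaneously. -/
theorem exists_extension (Q : ∀ {V : Type}, (V → V → ℕ) → V → V → Prop)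
    (hmono : ∀ {V V' : Type} {w : V → V → ℕ} {w' : V' → V' → ℕ} {f : V → V'},
      GoodTree k V' w' → WHom w w' f → ∀ a b, Q w a b → Q w' (f a) (f b))
    (hext : ∀ {V : Type} {w : V → V → ℕ}, GoodTree k V w → ∀ a b, w a b ≠ 0 →
      ∃ (V' : Type) (w' : V' → V' → ℕ) (f : V → V'), GoodTree k V' w' ∧ WHom w w' f ∧
        Q w' (f a) (f b))
    (h : GoodTree k V w) :
    ∃ (V' : Type) (w' : V' → V' → ℕ) (f : V → V'), GoodTree k V' w' ∧ WHom w w' f ∧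
      ∀ a b, w a b ≠ 0 → Q w' (f a) (f b) := by
  classical
  have := h.finite
  have := Fintype.ofFinite V
  -- Pairs are treated one at a time; `hmono` carries those already treated through the later
  -- extensions.
  suffices H : ∀ S : Finset (V × V), ∃ (V' : Type) (w' : V' → V' → ℕ) (f : V → V'),
      GoodTree k V' w' ∧ WHom w w' f ∧ ∀ e ∈ S, w e.1 e.2 ≠ 0 → Q w' (f e.1) (f e.2) by
    obtain ⟨V', w', f, h1, h2, h3⟩ := H Finset.univ
    exact ⟨V', w', f, h1, h2, fun a b => h3 (a, b) (Finset.mem_univ _)⟩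
  intro S
  induction S using Finset.induction_on with
  | empty => exact ⟨V, w, _root_.id, h, WHom.id, by simp⟩
  | insert e S _ ih =>
    obtain ⟨V', w', f, h1, h2, h3⟩ := ih
    by_cases he : w e.1 e.2 = 0
    · refine ⟨V', w', f, h1, h2, fun e' he' hw => ?_⟩
      rcases Finset.mem_insert.1 he' with rfl | he'
      · exact absurd he hw
      · exact h3 e' he' hw
    · obtain ⟨V'', w'', g, h4, h5, h6⟩ := hext h1 (f e.1) (f e.2) (by rwa [h2 _ _ he])
      refine ⟨V'', w'', g ∘ f, h4, h5.comp h2, fun e' he' hw => ?_⟩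
      rcases Finset.mem_insert.1 he' with rfl | he'
      · exact h6
      · exact hmono h4 h5 _ _ (h3 e' he' hw)

end GoodTree

/-! ### Universal weighted graphs -/

/-- Every good weighted 2-tree has a weight-preserving map to `D`. -/
def Universal {W : Type*} (k : ℕ) (D : W → W → ℕ) : Prop :=
  ∀ (V : Type) (w : V → V → ℕ), GoodTree k V w → ∃ f : V → W, WHom w D f

/-- A tree is mapped in the order of its construction, each new apex going to the vertex that
realizes its triple. The initial edge of arbitrary weight p comes from an edge of weight one by
realizing some good triple {1, p, r}. -/
theorem universal_of_realized {W : Type*} {k : ℕ} {D : W → W → ℕ} (hk : 1 ≤ k)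
    (hsymm : ∀ x y, D x y = D y x) (hone : ∃ x y, D x y = 1)
    (hreal : ∀ x y q r, Good k (D x y) q r → ∃ z, D x z = q ∧ D y z = r) : Universal k D := by
  intro V w h
  induction h with
  | edge p hp hpk =>
    obtain ⟨x, y, hxy⟩ := hone
    have : ∃ r, Good k 1 p r := exists_good le_rfl hk hp hpk
    obtain ⟨r, hr⟩ := this
    obtain ⟨z, hz, -⟩ := hreal x y p r (by rwa [hxy])
    refine ⟨fun a => if a then x else z, ?_⟩
    intro a b hab
    cases a <;> cases b <;> simp [hz, hsymm z x] at hab ⊢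
  | @glue V w u v q r h hg ih =>
    obtain ⟨f, hf⟩ := ih
    have hfuv := hf u v (by unfold Good at hg; omega)
    obtain ⟨z, hzq, hzr⟩ := hreal (f u) (f v) q r (by rwa [hfuv])
    refine ⟨fun a => a.elim z f, ?_⟩
    have key : ∀ a, SPBound.glue w u v q r none (some a) ≠ 0 →
        D z (f a) = SPBound.glue w u v q r none (some a) := by
      intro a ha
      simp only [SPBound.glue] at ha ⊢
      split_ifs at ha ⊢ with h1 h2
      · subst h1; rw [hsymm, hzq]
      · subst h2; rw [hsymm, hzr]
      · exact absurd rfl ha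
    intro a b hab
    cases a with
    | none =>
      cases b with
      | none => simp [SPBound.glue] at hab
      | some b => exact key b hab
    | some a =>
      cases b with
      | none =>
        rw [(h.glue hg).symm] at hab ⊢
        exact (hsymm _ _).trans (key a hab)
      | some b => exact hf a b hab

/-- In an extension of the tree every edge of weight `D x y`, read in either direction, carries a
triangle with sides `q` and `r`. If a map to `D` sent such an edge to `xy`, the images of the two
apices would realize the triple both ways. Hence its restriction to the original tree avoids `xy`.
-/
theorem universal_erase {W : Type*} {k : ℕ} {D D' : W → W → ℕ} (hD : Universal k D)
    {x y : W} {q r : ℕ} (hg : Good k (D x y) q r) (hsymm : D x y = D y x)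
    (hfail : (¬ ∃ z, D x z = q ∧ D y z = r) ∨ ¬ ∃ z, D x z = r ∧ D y z = q)
    (hD' : ∀ a b, ¬ (a = x ∧ b = y) → ¬ (a = y ∧ b = x) → D' a b = D a b) :
    Universal k D' := by
  intro V w h
  have hg' : 1 ≤ D x y ∧ 1 ≤ q ∧ 1 ≤ r := by unfold Good at hg; omega
  obtain ⟨V', w', ι, h', hι, hQ⟩ := h.exists_extension
    (fun w a b => w a b ≠ 0 ∧ (w a b = D x y → ∃ z, w a z = q ∧ w b z = r))
    (by
      rintro V V' w w' f h' hf a b ⟨hab, hz⟩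
      rw [hf a b hab]
      refine ⟨hab, fun h => ?_⟩
      obtain ⟨z, hz1, hz2⟩ := hz h
      exact ⟨f z, by rw [hf a z (by omega), hz1], by rw [hf b z (by omega), hz2]⟩)
    (by
      intro V w h a b hab
      by_cases hp : w a b = D x y
      · refine ⟨_, _, some, h.glue (u := a) (v := b) (q := q) (r := r) (by rwa [hp]), whom_some,
          hab, fun _ => ⟨none, glue_left_none _ _ _ _ _, glue_right_none _ (h.ne hab) _ _⟩⟩
      · exact ⟨V, w, _root_.id, h, WHom.id, hab, fun h => absurd h hp⟩)
  obtain ⟨f, hf⟩ := hD V' w' h'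
  refine ⟨f ∘ ι, fun a b hab => ?_⟩
  have key : ∀ a b, w a b ≠ 0 → ¬ (f (ι a) = x ∧ f (ι b) = y) := by
    rintro a b hab ⟨rfl, rfl⟩
    have hDw : ∀ a b, w a b ≠ 0 → D (f (ι a)) (f (ι b)) = w' (ι a) (ι b) := fun a b hab =>
      hf _ _ (by rwa [hι a b hab])
    rcases hfail with hfail | hfail
    · obtain ⟨-, hz⟩ := hQ a b hab
      obtain ⟨z, hz1, hz2⟩ := hz (hDw a b hab).symm
      exact hfail ⟨f z, by rw [hf _ _ (by omega), hz1], by rw [hf _ _ (by omega), hz2]⟩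
    · have hba : w b a ≠ 0 := by rwa [h.symm]
      obtain ⟨-, hz⟩ := hQ b a hba
      obtain ⟨z, hz1, hz2⟩ := hz ((hDw b a hba).symm.trans hsymm.symm)
      exact hfail ⟨f z, by rw [hf _ _ (by omega), hz2], by rw [hf _ _ (by omega), hz1]⟩
  have hba : w b a ≠ 0 := by rwa [h.symm]
  have h1 : w' (ι a) (ι b) = w a b := hι a b hab
  rw [Function.comp, Function.comp, hD' _ _ (key a b hab) (fun h => key b a hba h.symm),
    hf _ _ (by rwa [h1]), h1]

/-! ### The projective cube -/

/-- The distance function of the projective cube of dimension `2k`, lifted to the hypercube. -/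
def cubeWeight (k : ℕ) (x y : Finset (Fin (2 * k + 1))) : ℕ :=
  min (symmDiff x y).card (2 * k + 1 - (symmDiff x y).card)

theorem exists_card_inter_sdiff {α : Type*} [Fintype α] [DecidableEq α] (A : Finset α) {i j : ℕ}
    (hi : i ≤ A.card) (hj : j ≤ Fintype.card α - A.card) :
    ∃ B : Finset α, B.card = i + j ∧ (symmDiff A B).card = A.card - i + j := by
  obtain ⟨I, hI, rfl⟩ := Finset.exists_subset_card_eq hi
  rw [← Finset.card_compl] at hj
  obtain ⟨J, hJ, rfl⟩ := Finset.exists_subset_card_eq hj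
  have hAJ : Disjoint A J := Finset.disjoint_left.2 fun a ha hb => by
    simpa [ha] using hJ hb
  refine ⟨I ∪ J, Finset.card_union_of_disjoint (Finset.disjoint_of_subset_left hI hAJ), ?_⟩
  have : symmDiff A (I ∪ J) = (A \ I) ∪ J := by
    ext a
    have h1 := @hI a
    have h2 : a ∈ A → a ∉ J := fun h => Finset.disjoint_left.1 hAJ h
    simp only [Finset.mem_symmDiff, Finset.mem_union, Finset.mem_sdiff]
    tauto
  rw [this, Finset.card_union_of_disjoint
    (Finset.disjoint_of_subset_left Finset.sdiff_subset hAJ), Finset.card_sdiff_of_subset hI]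

/-- The third vertex is the translate of `x` by a set `B`; only the numbers i and j of elements of
`B` inside and outside the difference of `x` and `y` matter. -/
theorem universal_cubeWeight {k : ℕ} (hk : 1 ≤ k) : Universal k (cubeWeight k) := by
  refine universal_of_realized hk (fun x y => by rw [cubeWeight, symmDiff_comm]; rfl) ?_ ?_
  · refine ⟨∅, {0}, ?_⟩
    have : symmDiff (∅ : Finset (Fin (2 * k + 1))) {0} = {0} := bot_symmDiff _
    rw [cubeWeight, this, Finset.card_singleton]
    omega
  · intro x y q r hg
    have hz : ∀ B, symmDiff x (symmDiff x B) = B ∧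
        symmDiff y (symmDiff x B) = symmDiff (symmDiff x y) B := fun B => by
      refine ⟨symmDiff_symmDiff_cancel_left x B, ?_⟩
      rw [← symmDiff_assoc, symmDiff_comm y x]
    suffices H : ∃ i j, i ≤ (symmDiff x y).card ∧
        j ≤ Fintype.card (Fin (2 * k + 1)) - (symmDiff x y).card ∧
        min (i + j) (2 * k + 1 - (i + j)) = q ∧
        min ((symmDiff x y).card - i + j) (2 * k + 1 - ((symmDiff x y).card - i + j)) = r by
      obtain ⟨i, j, hi, hj, h1, h2⟩ := H
      obtain ⟨B, hB, hAB⟩ := exists_card_inter_sdiff (symmDiff x y) hi hj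
      refine ⟨symmDiff x B, ?_, ?_⟩
      · rw [cubeWeight, (hz B).1, hB, h1]
      · rw [cubeWeight, (hz B).2, hAB, h2]
    have hc := Finset.card_le_univ (symmDiff x y)
    rw [cubeWeight] at hg
    rw [Fintype.card_fin] at *
    generalize (symmDiff x y).card = s at *
    unfold Good at hg
    -- In all cases i + j = q, and s - i + j is r or 2k+1-r, whichever has the parity of s + q.
    -- Goodness is what makes the resulting i and j admissible.
    by_cases hs : s ≤ k
    · by_cases hpar : (s + q + r) % 2 = 0
      · exact ⟨(s + q - r) / 2, (q + r - s) / 2, by omega⟩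
      · exact ⟨(s + q + r - (2 * k + 1)) / 2, (q + (2 * k + 1) - s - r) / 2, by omega⟩
    · by_cases hpar : (2 * k + 1 - s + q + r) % 2 = 0
      · exact ⟨(q + r - (2 * k + 1 - s)) / 2, (2 * k + 1 - s + q - r) / 2, by omega⟩
      · exact ⟨(q + (2 * k + 1) - (2 * k + 1 - s) - r) / 2,
          (2 * k + 1 - s + q + r - (2 * k + 1)) / 2, by omega⟩

/-! ### The graph of the edges of weight one -/

/-- The graph formed by the edges of weight one. -/
def unitGraph {V : Type*} (w : V → V → ℕ) : SimpleGraph V := .fromRel fun a b => w a b = 1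

theorem GoodTree.unitGraph_adj {k : ℕ} {V : Type} {w : V → V → ℕ} (h : GoodTree k V w) {a b : V} :
    (unitGraph w).Adj a b ↔ w a b = 1 := by
  rw [unitGraph, fromRel_adj, h.symm b a, or_self]
  refine ⟨fun h => h.2, fun hab => ⟨h.ne (by omega), hab⟩⟩

/-- A single edge has too few vertices, and each glued apex sees only two adjacent vertices, so
`IsMinor.of_elimination` removes it. -/
theorem GoodTree.not_isMinor {k : ℕ} {V : Type} {w : V → V → ℕ} (h : GoodTree k V w) :
    ¬ IsMinor (⊤ : SimpleGraph (Fin 4)) (.fromRel fun a b => w a b ≠ 0) := by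
  induction h with
  | edge p =>
    rintro ⟨S, h1, h2, -⟩
    have hne : ∀ i, ∃ x, x ∈ S i := fun i => ((induce_connected_iff _ _).1 (h1 i)).1
    choose f hf using hne
    have hinj : Function.Injective f := fun i j hij => by
      by_contra hne
      exact Set.disjoint_left.1 (h2 i j hne) (hf i) (hij ▸ hf j)
    simpa using Fintype.card_le_of_injective f hinj
  | @glue V w u v q r h hg ih =>
    intro hm
    refine ih (hm.of_elimination (u := u) (v := v) ?_ ?_ ?_)
    · intro x y hxy
      simpa [SPBound.glue, fromRel_adj] using hxy
    · intro x hx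
      simp only [SPBound.glue, fromRel_adj, ne_eq, or_self] at hx
      by_contra! hcon
      simp [hcon] at hx
    · have : w u v ≠ 0 := by unfold Good at hg; omega
      rw [fromRel_adj]
      exact ⟨h.ne this, Or.inl this⟩

/-- The unit graph is a subgraph of a 2-tree, and the weight-preserving map to the projective cube
excludes short odd closed walks. -/
theorem GoodTree.unitGraph_SP {k : ℕ} {V : Type} {w : V → V → ℕ} (hk : 1 ≤ k)
    (h : GoodTree k V w) : SP (2 * k + 1) (unitGraph w) := by
  refine ⟨fun hm => h.not_isMinor (hm.mono ?_), ?_⟩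
  · intro a b hab
    have h1 := h.unitGraph_adj.1 hab
    rw [fromRel_adj]
    exact ⟨hab.ne, Or.inl (by omega)⟩
  · rw [le_oddGirth_iff]
    obtain ⟨f, hf⟩ := universal_cubeWeight hk V w h
    -- A unit step changes the lifted set by 1 or 2k coordinates. Of the size s of the total
    -- difference and 2k+1-s, the one with the parity of the walk is at most its length; for a
    -- closed odd walk s = 0, which gives 2k+1.
    have key : ∀ a b (W : (unitGraph w).Walk a b),
        ((symmDiff (f a) (f b)).card % 2 = W.length % 2 → (symmDiff (f a) (f b)).card ≤ W.length) ∧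
        ((symmDiff (f a) (f b)).card % 2 ≠ W.length % 2 →
          2 * k + 1 ≤ (symmDiff (f a) (f b)).card + W.length) := by
      intro a b W
      induction W with
      | nil => simp
      | @cons a b c hab W ih =>
        have h1 := h.unitGraph_adj.1 hab
        have h2 := hf a b (by omega)
        rw [h1, cubeWeight] at h2
        have h3 : (symmDiff (f a) (f c)).card + 2 * (symmDiff (f a) (f b) ∩
            symmDiff (f b) (f c)).card =
            (symmDiff (f a) (f b)).card + (symmDiff (f b) (f c)).card := by
          have := symmDiff_assoc (f a) (f b) (symmDiff (f b) (f c))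
          rw [symmDiff_symmDiff_cancel_left] at this
          rw [← this]
          generalize symmDiff (f a) (f b) = A
          generalize symmDiff (f b) (f c) = B
          have e1 : (symmDiff A B).card = (A \ B).card + (B \ A).card := by
            rw [symmDiff, Finset.sup_eq_union]
            exact Finset.card_union_of_disjoint disjoint_sdiff_sdiff
          have e2 := Finset.card_sdiff_add_card_inter A B
          have e3 := Finset.card_sdiff_add_card_inter B A
          rw [Finset.inter_comm] at e3
          omega
        have h4 := Finset.card_le_card
          (Finset.inter_subset_left (s₁ := symmDiff (f a) (f b)) (s₂ := symmDiff (f b) (f c)))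
        have h5 := Finset.card_le_card
          (Finset.inter_subset_right (s₁ := symmDiff (f a) (f b)) (s₂ := symmDiff (f b) (f c)))
        have h6 := Finset.card_union_add_card_inter (symmDiff (f a) (f b)) (symmDiff (f b) (f c))
        have h7 := Finset.card_le_univ (symmDiff (f a) (f b) ∪ symmDiff (f b) (f c))
        have h8 := Finset.card_le_univ (symmDiff (f a) (f b))
        have h9 := Finset.card_le_univ (symmDiff (f b) (f c))
        rw [Fintype.card_fin] at h7 h8 h9
        rw [Walk.length_cons]
        omega
    intro a W hodd
    have := key a a W
    rw [symmDiff_self, Finset.bot_eq_empty, Finset.card_empty] at this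
    rw [Nat.odd_iff] at hodd
    omega

/-! ### Rigid refinements -/

theorem WHom.exists_walk {V V' : Type*} {w : V → V → ℕ} {w' : V' → V' → ℕ} {f : V → V'}
    (hf : WHom w w' f) (hself : ∀ x, w' x x = 0) {a b : V} (W : (unitGraph w).Walk a b) :
    ∃ W' : (unitGraph w').Walk (f a) (f b), W'.length = W.length := by
  let φ : unitGraph w →g unitGraph w' := ⟨f, by
    intro x y hxy
    rw [unitGraph, fromRel_adj] at hxy ⊢
    have h' : w' (f x) (f y) = 1 ∨ w' (f y) (f x) = 1 :=
      hxy.2.imp (fun h => by rw [hf _ _ (by omega), h]) (fun h => by rw [hf _ _ (by omega), h])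
    refine ⟨fun heq => ?_, h'⟩
    rw [heq, hself] at h'
    omega⟩
  exact ⟨W.map φ, Walk.length_map _ _⟩

/-- The even triple {p+2, 1, p+1} is good, so a unit step can be split off and the rest treated by
induction. -/
theorem GoodTree.exists_walk_extension {k : ℕ} (p : ℕ) : ∀ {V : Type} {w : V → V → ℕ},
    GoodTree k V w → ∀ a b, w a b = p + 1 →
    ∃ (V' : Type) (w' : V' → V' → ℕ) (f : V → V'), GoodTree k V' w' ∧ WHom w w' f ∧
      ∃ W : (unitGraph w').Walk (f a) (f b), W.length = p + 1 := by
  induction p with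
  | zero =>
    intro V w h a b hab
    exact ⟨V, w, _root_.id, h, WHom.id, .cons (h.unitGraph_adj.2 hab) .nil, rfl⟩
  | succ p ih =>
    intro V w h a b hab
    have hle := h.le a b
    have h' : GoodTree k _ _ := h.glue (u := a) (v := b) (q := 1) (r := p + 1)
      (by unfold Good; omega)
    obtain ⟨V', w', f, h1, h2, W, hW⟩ := ih h' none (some b)
      (glue_none_right w (h.ne (by omega)) _ _)
    have hadj : (unitGraph w').Adj (f (some a)) (f none) := by
      have := glue_left_none w a b 1 (p + 1)
      rw [h1.unitGraph_adj, h2 _ _ (by omega), this]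
    exact ⟨V', w', f ∘ some, h1, h2.comp whom_some, .cons hadj W, by rw [Walk.length_cons, hW]⟩

/-- For an edge of weight p the triple {p, k, k+1-p} is good, with sum exactly 2k+1. Developing its
three sides into unit walks puts the edge on a closed walk of length 2k+1, leaving no freedom for
the distance of its ends in a graph of that odd-girth. -/
theorem GoodTree.exists_rigid_extension {k : ℕ} {V : Type} {w : V → V → ℕ}
    (h : GoodTree k V w) : ∃ (V' : Type) (w' : V' → V' → ℕ) (f : V → V'), GoodTree k V' w' ∧
      WHom w w' f ∧ ∀ a b, w a b ≠ 0 → w' (f a) (f b) ≠ 0 ∧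
        (∃ W : (unitGraph w').Walk (f a) (f b), W.length = w' (f a) (f b)) ∧
        ∃ W : (unitGraph w').Walk (f a) (f b), W.length = 2 * k + 1 - w' (f a) (f b) := by
  refine h.exists_extension (fun w a b => w a b ≠ 0 ∧
      (∃ W : (unitGraph w).Walk a b, W.length = w a b) ∧
      ∃ W : (unitGraph w).Walk a b, W.length = 2 * k + 1 - w a b) ?_ ?_
  · rintro V V' w w' f h' hf a b ⟨h0, ⟨W, hW⟩, ⟨W', hW'⟩⟩
    obtain ⟨X, hX⟩ := hf.exists_walk h'.self W
    obtain ⟨X', hX'⟩ := hf.exists_walk h'.self W'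
    rw [hf _ _ h0]
    exact ⟨h0, ⟨X, hX.trans hW⟩, ⟨X', hX'.trans hW'⟩⟩
  · intro V w h a b hab
    have hle := h.le a b
    have hne := h.ne hab
    have hg := h.glue (u := a) (v := b) (q := k) (r := k + 1 - w a b) (by unfold Good; omega)
    have e1 : SPBound.glue w a b k (k + 1 - w a b) (some a) (some b) = w a b := rfl
    have e2 := glue_left_none w a b k (k + 1 - w a b)
    have e3 := glue_none_right w hne k (k + 1 - w a b)
    obtain ⟨V1, w1, f1, h1, hf1, W1, hW1⟩ := hg.exists_walk_extension (w a b - 1)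
      (some a) (some b) (by rw [e1]; omega)
    obtain ⟨V2, w2, f2, h2, hf2, W2, hW2⟩ := h1.exists_walk_extension (k - 1)
      (f1 (some a)) (f1 none) (by rw [hf1 _ _ (by omega), e2]; omega)
    have hf21 := hf2.comp hf1
    obtain ⟨V3, w3, f3, h3, hf3, W3, hW3⟩ := h2.exists_walk_extension (k - w a b)
      (f2 (f1 none)) (f2 (f1 (some b))) (by
        have := hf21 none (some b) (by omega)
        rw [Function.comp, Function.comp] at this
        rw [this, e3]; omega)
    obtain ⟨X1, hX1⟩ := (hf3.comp hf2).exists_walk h3.self W1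
    obtain ⟨X2, hX2⟩ := hf3.exists_walk h3.self W2
    have hF : WHom w w3 (((f3 ∘ f2) ∘ f1) ∘ some) := ((hf3.comp hf2).comp hf1).comp whom_some
    refine ⟨V3, w3, _, h3, hF, ?_⟩
    rw [hF _ _ hab]
    refine ⟨hab, ⟨X1, by omega⟩, ⟨X2.append W3, ?_⟩⟩
    rw [Walk.length_append]
    omega


/-! ### Bounds and universal weighted graphs -/

/-- The partial distance graph on all pairs at distance at most `k`. -/
noncomputable def distWeight {W : Type*} (k : ℕ) (B : SimpleGraph W) (x y : W) : ℕ :=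
  if B.dist x y ≤ k then B.dist x y else 0

/-- A shortest walk closes an odd walk with `P` or with `Q`, hence is at least as long as the other
one, and so as `P`. -/
theorem dist_eq_of_walks {W : Type*} {B : SimpleGraph W} {g : ℕ}
    (hB : ∀ (a : W) (w : B.Walk a a), Odd w.length → g ≤ w.length) {x y : W} (P Q : B.Walk x y)
    (hPQ : P.length + Q.length = g) (hodd : Odd g) (hle : P.length ≤ Q.length) :
    B.dist x y = P.length := by
  obtain ⟨R, hR⟩ := P.reachable.exists_walk_length_eq_dist
  have h1 := dist_le P
  rcases Nat.even_or_odd (R.length + Q.length) with h | h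
  · have h3 := hB x (R.append P.reverse)
    rw [Walk.length_append, Walk.length_reverse] at h3
    rw [Nat.even_iff] at h
    rw [Nat.odd_iff] at *
    omega
  · have h3 := hB x (R.append Q.reverse)
    rw [Walk.length_append, Walk.length_reverse] at h3
    have := h3 h
    omega

/-- A homomorphism from the unit graph of a rigid extension already preserves the weights of the
original tree, because the images of the two walks determine the distance. -/
theorem universal_distWeight {W : Type*} {k : ℕ} {B : SimpleGraph W} (hk : 1 ≤ k)
    (hB : ∀ (a : W) (w : B.Walk a a), Odd w.length → 2 * k + 1 ≤ w.length)
    (h : Bounds B (SP (2 * k + 1))) : Universal k (distWeight k B) := by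
  intro V w hw
  obtain ⟨V', w', ι, h', hι, hrig⟩ := hw.exists_rigid_extension
  have := h'.finite
  obtain ⟨φ⟩ := h V' _ (h'.unitGraph_SP hk)
  refine ⟨φ ∘ ι, fun a b hab => ?_⟩
  obtain ⟨-, ⟨P, hP⟩, ⟨Q, hQ⟩⟩ := hrig a b hab
  have hle := h'.le (ι a) (ι b)
  have hd := dist_eq_of_walks hB (P.map φ) (Q.map φ)
    (by rw [Walk.length_map, Walk.length_map]; omega) (by simp)
    (by rw [Walk.length_map, Walk.length_map]; omega)
  rw [Walk.length_map, hP, hι a b hab] at hd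
  rw [hι a b hab] at hle
  simp only [Function.comp, distWeight]
  rw [hd, if_pos hle]

/-- This justifies the answer NO after the odd-girth test: the rigid extension of a single edge
contains a closed walk of length 2k+1. -/
theorem exists_odd_walk_of_bounds {W : Type*} {k : ℕ} {B : SimpleGraph W} (hk : 1 ≤ k)
    (h : Bounds B (SP (2 * k + 1))) : ∃ (a : W) (w : B.Walk a a), w.length = 2 * k + 1 := by
  obtain ⟨V', w', ι, h', hι, hrig⟩ := (GoodTree.edge (k := k) 1 le_rfl hk).exists_rigid_extension
  have := h'.finite
  obtain ⟨φ⟩ := h V' _ (h'.unitGraph_SP hk)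
  obtain ⟨hne, ⟨P, hP⟩, ⟨Q, hQ⟩⟩ := hrig false true (by simp)
  have hle := h'.le (ι false) (ι true)
  refine ⟨_, (P.append Q.reverse).map φ, ?_⟩
  rw [Walk.length_map, Walk.length_append, Walk.length_reverse]
  omega

/-- A `K₄`-minor-free graph with weights on all pairs, all of whose triples are good, maps to a
good weighted 2-tree. -/
theorem exists_goodTree_hom {k : ℕ} (hk : 1 ≤ k) (n : ℕ) : ∀ (V : Type) [Finite V]
    (H : SimpleGraph V) (w : V → V → ℕ), Nat.card V = n →
    ¬ IsMinor (⊤ : SimpleGraph (Fin 4)) H → (∀ x y, w x y = w y x) →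
    (∀ x y, x ≠ y → 1 ≤ w x y ∧ w x y ≤ k) →
    (∀ x y z, x ≠ y → x ≠ z → y ≠ z → Good k (w x y) (w x z) (w y z)) →
    ∃ (T : Type) (wT : T → T → ℕ) (f : V → T), GoodTree k T wT ∧
      ∀ x y, H.Adj x y → wT (f x) (f y) = w x y := by
  classical
  induction n with
  | zero =>
    intro V _ H w hcard hK hsymm hw hgood
    have : IsEmpty V := by
      rcases Nat.card_eq_zero.1 hcard with h | h
      · exact h
      · exact absurd ‹Finite V› (not_finite_iff_infinite.2 h)
    exact ⟨_, _, isEmptyElim, .edge 1 le_rfl hk, fun x => isEmptyElim x⟩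
  | succ n ih =>
    intro V _ H w hcard hK hsymm hw hgood
    have : Nonempty V := (Nat.card_pos_iff.1 (by omega)).1
    have hlow : ∃ v a b, (∀ x, H.Adj v x → x = a ∨ x = b) ∧ (H.Adj v a ∨ ∀ x, ¬ H.Adj v x) := by
      obtain ⟨v, a, b, h⟩ := exists_degree_le_two _ V H rfl hK
      by_cases ha : H.Adj v a
      · exact ⟨v, a, b, h, Or.inl ha⟩
      by_cases hb : H.Adj v b
      · exact ⟨v, b, a, fun x hx => (h x hx).symm, Or.inl hb⟩
      · refine ⟨v, a, b, h, Or.inr fun x hx => ?_⟩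
        rcases h x hx with rfl | rfl
        · exact ha hx
        · exact hb hx
    obtain ⟨v, a, b, hN, hva⟩ := hlow
    have hcard' : Nat.card {x // x ≠ v} = n := by
      have := Fintype.ofFinite V
      rw [Nat.card_eq_fintype_card] at hcard ⊢
      rw [Fintype.card_subtype_compl, Fintype.card_subtype_eq]
      omega
    -- Contracting `v` into its neighbour `a`, instead of deleting it, makes `a` and `b` adjacent.
    -- The inductive map then preserves the weight of `ab` too, as needed to glue the image of `v`
    -- on it.
    obtain ⟨T, wT, f, hT, hf⟩ := ih {x // x ≠ v} (contr H v a) (fun x y => w x y) hcard'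
      (fun h => hK (h.of_contr hva)) (fun x y => hsymm x y)
      (fun x y hxy => hw x y (by simpa using Subtype.coe_ne_coe.2 hxy))
      (fun x y z h1 h2 h3 => hgood x y z (Subtype.coe_ne_coe.2 h1) (Subtype.coe_ne_coe.2 h2)
        (Subtype.coe_ne_coe.2 h3))
    have hfH : ∀ x y (hx : x ≠ v) (hy : y ≠ v), H.Adj x y →
        wT (f ⟨x, hx⟩) (f ⟨y, hy⟩) = w x y := fun x y hx hy hxy =>
      hf ⟨x, hx⟩ ⟨y, hy⟩ ⟨by simpa using hxy.ne, Or.inl hxy⟩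
    suffices hS : ∃ (T' : Type) (wT' : T' → T' → ℕ) (ι : T → T') (t : T'), GoodTree k T' wT' ∧
        WHom wT wT' ι ∧ ∀ x (hx : x ≠ v), H.Adj v x → wT' t (ι (f ⟨x, hx⟩)) = w v x by
      obtain ⟨T', wT', ι, t, hT', hι, ht⟩ := hS
      refine ⟨T', wT', fun x => if hx : x = v then t else ι (f ⟨x, hx⟩), hT', ?_⟩
      intro x y hxy
      by_cases hx : x = v
      · subst hx
        simp only [dif_pos, dif_neg hxy.ne']
        exact ht y _ hxy
      · by_cases hy : y = v
        · subst hy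
          simp only [dif_pos, dif_neg hx]
          rw [hT'.symm, hsymm]
          exact ht x _ hxy.symm
        · simp only [dif_neg hx, dif_neg hy]
          rw [hι _ _, hfH x y hx hy hxy]
          rw [hfH x y hx hy hxy]
          have := hw x y hxy.ne
          omega
    rcases hva with hva | hva
    · have hav : a ≠ v := hva.ne'
      by_cases hvb : H.Adj v b ∧ a ≠ b
      · obtain ⟨hvb, hab⟩ := hvb
        have hbv : b ≠ v := hvb.ne'
        have hfab : wT (f ⟨a, hav⟩) (f ⟨b, hbv⟩) = w a b :=
          hf ⟨a, hav⟩ ⟨b, hbv⟩ ⟨by simpa using hab, Or.inr (Or.inl ⟨rfl, hvb⟩)⟩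
        have hne := hT.ne (a := f ⟨a, hav⟩) (b := f ⟨b, hbv⟩) (by
          have := hw a b hab
          omega)
        refine ⟨_, _, some, none, hT.glue (u := f ⟨a, hav⟩) (v := f ⟨b, hbv⟩) (q := w a v)
          (r := w b v) (by rw [hfab]; exact hgood a b v hab hav hbv), whom_some, ?_⟩
        intro x hx hvx
        rcases hN x hvx with rfl | rfl
        · rw [glue_none_left, hsymm]
        · rw [glue_none_right _ hne, hsymm]
      -- With `a` as the only neighbour of `v`, any tree edge at the image of `a` can carry the new
      -- triangle; its third side is free.
      · obtain ⟨c, hc⟩ := hT.exists_ne_zero (f ⟨a, hav⟩)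
        have hwav := hw a v hav
        obtain ⟨r, hr⟩ := exists_good (k := k) (p := wT (f ⟨a, hav⟩) c) (q := w a v) (by omega)
          (hT.le _ _) hwav.1 hwav.2
        refine ⟨_, _, some, none, hT.glue hr, whom_some, ?_⟩
        intro x hx hvx
        have hxa : x = a := by
          by_contra hxa
          rcases hN x hvx with rfl | rfl
          · exact hxa rfl
          · exact hvb ⟨hvx, Ne.symm hxa⟩
        subst hxa
        rw [glue_none_left, hsymm]
    · obtain ⟨t⟩ := hT.nonempty
      exact ⟨T, wT, id, t, hT, WHom.id, fun x hx hvx => absurd hvx (hva x)⟩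

/-! ### Distances cut off at k as good weights -/

open Classical in
/-- The distance function cut off at `k`. -/
noncomputable def cutDist {V : Type*} (k : ℕ) (G : SimpleGraph V) (x y : V) : ℕ :=
  if G.Reachable x y then min (G.dist x y) k else k

theorem cutDist_le {V : Type*} (k : ℕ) (G : SimpleGraph V) (x y : V) : cutDist k G x y ≤ k := by
  unfold cutDist
  split_ifs <;> omega

theorem cutDist_le_length {V : Type*} (k : ℕ) {G : SimpleGraph V} {x y : V} (P : G.Walk x y) :
    cutDist k G x y ≤ P.length := by
  have := dist_le P
  rw [cutDist, if_pos P.reachable]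
  omega

theorem exists_walk_length_eq_cutDist {V : Type*} {k : ℕ} {G : SimpleGraph V} {x y : V}
    (h : cutDist k G x y < k) : ∃ P : G.Walk x y, P.length = cutDist k G x y := by
  unfold cutDist at *
  split_ifs at * with hr
  · obtain ⟨P, hP⟩ := hr.exists_walk_length_eq_dist
    exact ⟨P, by omega⟩
  · omega

theorem cutDist_comm {V : Type*} (k : ℕ) (G : SimpleGraph V) (x y : V) :
    cutDist k G x y = cutDist k G y x := by
  rw [cutDist, cutDist, dist_comm, reachable_comm]

theorem one_le_cutDist {V : Type*} {k : ℕ} (hk : 1 ≤ k) {G : SimpleGraph V} {x y : V}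
    (h : x ≠ y) : 1 ≤ cutDist k G x y := by
  unfold cutDist
  split_ifs with hr
  · have := hr.pos_dist_of_ne h
    omega
  · exact hk

/-- If all three values are below k, shortest walks give the triangle inequalities, and an odd sum
is the length of an odd closed walk. If some value is k, the sum is at least 2k by the triangle
inequality, and parity settles both cases. -/
theorem good_cutDist {V : Type*} {k : ℕ} (hk : 1 ≤ k) {G : SimpleGraph V}
    (hG : ∀ (a : V) (w : G.Walk a a), Odd w.length → 2 * k + 1 ≤ w.length) {x y z : V}
    (hxy : x ≠ y) (hxz : x ≠ z) (hyz : y ≠ z) :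
    Good k (cutDist k G x y) (cutDist k G x z) (cutDist k G y z) := by
  have triangle : ∀ a b c, cutDist k G a b < k → cutDist k G b c < k →
      cutDist k G a c ≤ cutDist k G a b + cutDist k G b c := by
    intro a b c h1 h2
    obtain ⟨P, hP⟩ := exists_walk_length_eq_cutDist h1
    obtain ⟨Q, hQ⟩ := exists_walk_length_eq_cutDist h2
    have := cutDist_le_length k (P.append Q)
    rw [Walk.length_append] at this
    omega
  have hodd : cutDist k G x y < k → cutDist k G y z < k → cutDist k G x z < k →
      (cutDist k G x y + cutDist k G x z + cutDist k G y z) % 2 = 1 →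
      2 * k + 1 ≤ cutDist k G x y + cutDist k G x z + cutDist k G y z := by
    intro h1 h2 h3 h4
    obtain ⟨P, hP⟩ := exists_walk_length_eq_cutDist h1
    obtain ⟨Q, hQ⟩ := exists_walk_length_eq_cutDist h2
    obtain ⟨R, hR⟩ := exists_walk_length_eq_cutDist h3
    have := hG x ((P.append Q).append R.reverse)
    rw [Walk.length_append, Walk.length_append, Walk.length_reverse, Nat.odd_iff] at this
    omega
  have t1 := triangle x y z
  have t2 := triangle x z y
  have t3 := triangle y x z
  rw [cutDist_comm k G z y] at t2
  rw [cutDist_comm k G y x] at t3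
  have l1 := cutDist_le k G x y
  have l2 := cutDist_le k G x z
  have l3 := cutDist_le k G y z
  have o1 := one_le_cutDist hk (G := G) hxy
  have o2 := one_le_cutDist hk (G := G) hxz
  have o3 := one_le_cutDist hk (G := G) hyz
  unfold Good
  omega

/-- Edges of a graph in the class have cut-off distance one, so the composite through a good 2-tree
sends them to pairs of weight one. Other weights of `D` need not be distances in `B`; hence the
result applies after any amount of pruning. -/
theorem bounds_of_universal {W : Type*} {k : ℕ} {B : SimpleGraph W} {D : W → W → ℕ} (hk : 1 ≤ k)
    (hD : Universal k D) (hDB : ∀ x y, D x y = 1 → B.Adj x y) : Bounds B (SP (2 * k + 1)) := by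
  rintro V _ G ⟨hK, hG⟩
  rw [le_oddGirth_iff] at hG
  obtain ⟨T, wT, f, hT, hf⟩ := exists_goodTree_hom hk _ V G (cutDist k G) rfl hK (cutDist_comm k G)
    (fun x y hxy => ⟨one_le_cutDist hk hxy, cutDist_le _ _ _ _⟩)
    (fun x y z hxy hxz hyz => good_cutDist hk hG hxy hxz hyz)
  obtain ⟨φ, hφ⟩ := hD T wT hT
  refine ⟨⟨φ ∘ f, fun {x y} hxy => hDB _ _ ?_⟩⟩
  have h1 : cutDist k G x y ≤ 1 := cutDist_le_length k (Walk.cons hxy .nil)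
  have h2 := one_le_cutDist hk (G := G) hxy.ne
  have h3 := hf x y hxy
  rw [Function.comp, Function.comp, hφ _ _ (by omega)]
  omega

theorem Bounds.mono {W : Type*} {B B' : SimpleGraph W} {C : ∀ {V : Type}, SimpleGraph V → Prop}
    (h : Bounds B C) (hB : B ≤ B') : Bounds B' C := fun V _ G hG => by
  obtain ⟨φ⟩ := h V G hG
  exact ⟨(Hom.ofLE hB).comp φ⟩

end SPBound

namespace SPBound

open Reg Arr

/-! ### A program logic -/

/-- The program `c`, started in `s`, halts, and `Q` holds of its running time and final state. -/
def wp (c : Cmd) (s : State) (Q : ℕ → State → Prop) : Prop :=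
  ∃ s' t, Exec c s s' t ∧ Q t s'

/-- Does the program assign to the register `v`? -/
def Cmd.writesReg (v : Reg) : Cmd → Bool
  | .skip => false
  | .assign v' _ => decide (v = v')
  | .put _ _ _ _ => false
  | .seq c d => c.writesReg v || d.writesReg v
  | .ite _ c d => c.writesReg v || d.writesReg v
  | .loop _ c => c.writesReg v

/-- Does the program write to the array `A`? -/
def Cmd.writesArr (A : Arr) : Cmd → Bool
  | .skip => false
  | .assign _ _ => false
  | .put A' _ _ _ => decide (A = A')
  | .seq c d => c.writesArr A || d.writesArr A
  | .ite _ c d => c.writesArr A || d.writesArr A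
  | .loop _ c => c.writesArr A

/-- The states `s` and `s'` agree on everything that `c` does not write to. -/
def Frame (c : Cmd) (s s' : State) : Prop :=
  (∀ v, c.writesReg v = false → s'.reg v = s.reg v) ∧
    ∀ A, c.writesArr A = false → s'.mem A = s.mem A

theorem Frame.refl (c : Cmd) (s : State) : Frame c s s := ⟨fun _ _ => rfl, fun _ _ => rfl⟩

theorem Frame.trans {c : Cmd} {s s' s'' : State} (h : Frame c s s') (h' : Frame c s' s'') :
    Frame c s s'' :=
  ⟨fun v hv => (h'.1 v hv).trans (h.1 v hv), fun A hA => (h'.2 A hA).trans (h.2 A hA)⟩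

theorem Frame.mono {c d : Cmd} {s s' : State} (h : Frame c s s')
    (hr : ∀ v, d.writesReg v = false → c.writesReg v = false)
    (ha : ∀ A, d.writesArr A = false → c.writesArr A = false) : Frame d s s' :=
  ⟨fun v hv => h.1 v (hr v hv), fun A hA => h.2 A (ha A hA)⟩

theorem Exec.frame {c : Cmd} {s s' : State} {t : ℕ} (h : Exec c s s' t) : Frame c s s' := by
  induction h with
  | skip s => exact Frame.refl _ _
  | assign v e s =>
    refine ⟨fun v' hv => ?_, fun _ _ => rfl⟩
    simp only [Cmd.writesReg, decide_eq_false_iff_not] at hv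
    simp [State.setReg, hv]
  | put A i j e s =>
    refine ⟨fun _ _ => rfl, fun A' hA => ?_⟩
    simp only [Cmd.writesArr, decide_eq_false_iff_not] at hA
    simp [State.setMem, hA]
  | seq h h' ih ih' =>
    refine (ih.mono ?_ ?_).trans (ih'.mono ?_ ?_) <;> simp +contextual [Cmd.writesReg, Cmd.writesArr]
  | iteTrue hb h ih => refine ih.mono ?_ ?_ <;> simp +contextual [Cmd.writesReg, Cmd.writesArr]
  | iteFalse hb h ih => refine ih.mono ?_ ?_ <;> simp +contextual [Cmd.writesReg, Cmd.writesArr]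
  | loopTrue hb h h' ih ih' => exact (ih.mono (fun _ h => h) (fun _ h => h)).trans ih'
  | loopFalse hb => exact Frame.refl _ _

/-- The new postcondition may use the frame, so specifications and invariants need only mention what
the program writes. -/
theorem wp.mono {c : Cmd} {s : State} {Q Q' : ℕ → State → Prop} (h : wp c s Q)
    (hQ : ∀ t s', Frame c s s' → Q t s' → Q' t s') : wp c s Q' := by
  obtain ⟨s', t, h1, h2⟩ := h
  exact ⟨s', t, h1, hQ t s' h1.frame h2⟩

theorem wp_skip (s : State) (Q : ℕ → State → Prop) : wp .skip s Q ↔ Q 1 s := by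
  constructor
  · rintro ⟨s', t, h, hQ⟩
    cases h
    exact hQ
  · exact fun h => ⟨_, _, .skip s, h⟩

theorem wp_assign (v : Reg) (e : Expr) (s : State) (Q : ℕ → State → Prop) :
    wp (.assign v e) s Q ↔ Q (e.cost + 1) (s.setReg v (e.eval s)) := by
  constructor
  · rintro ⟨s', t, h, hQ⟩
    cases h
    exact hQ
  · exact fun h => ⟨_, _, .assign v e s, h⟩

theorem wp_put (A : Arr) (i j e : Expr) (s : State) (Q : ℕ → State → Prop) :
    wp (.put A i j e) s Q ↔
      Q (i.cost + j.cost + e.cost + 1) (s.setMem A (i.eval s) (j.eval s) (e.eval s)) := by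
  constructor
  · rintro ⟨s', t, h, hQ⟩
    cases h
    exact hQ
  · exact fun h => ⟨_, _, .put A i j e s, h⟩

theorem wp_seq (c d : Cmd) (s : State) (Q : ℕ → State → Prop) :
    wp (.seq c d) s Q ↔ wp c s fun t s' => wp d s' fun t' s'' => Q (t + t') s'' := by
  constructor
  · rintro ⟨s', t, h, hQ⟩
    cases h with
    | seq h h' => exact ⟨_, _, h, _, _, h', hQ⟩
  · rintro ⟨s', t, h, s'', t', h', hQ⟩
    exact ⟨_, _, .seq h h', hQ⟩

theorem wp_ite (b : Test) (c d : Cmd) (s : State) (Q : ℕ → State → Prop) :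
    wp (.ite b c d) s Q ↔
      (b.eval s = true → wp c s fun t s' => Q (b.cost + 1 + t) s') ∧
      (¬ b.eval s = true → wp d s fun t s' => Q (b.cost + 1 + t) s') := by
  rw [Bool.not_eq_true]
  constructor
  · rintro ⟨s', t, h, hQ⟩
    cases h with
    | iteTrue hb h => exact ⟨fun _ => ⟨_, _, h, hQ⟩, fun hb' => by simp [hb] at hb'⟩
    | iteFalse hb h => exact ⟨fun hb' => by simp [hb] at hb', fun _ => ⟨_, _, h, hQ⟩⟩
  · rintro ⟨h1, h2⟩
    cases hb : b.eval s with
    | true =>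
      obtain ⟨s', t, h, hQ⟩ := h1 hb
      exact ⟨_, _, .iteTrue hb h, hQ⟩
    | false =>
      obtain ⟨s', t, h, hQ⟩ := h2 hb
      exact ⟨_, _, .iteFalse hb h, hQ⟩

theorem wp_ifThen (b : Test) (c : Cmd) (s : State) (Q : ℕ → State → Prop) :
    wp (ifThen b c) s Q ↔
      (b.eval s = true → wp c s fun t s' => Q (b.cost + 1 + t) s') ∧
      (¬ b.eval s = true → Q (b.cost + 1 + 1) s) := by
  rw [ifThen, wp_ite, wp_skip]

theorem wp_block_nil (s : State) (Q : ℕ → State → Prop) : wp (block []) s Q ↔ Q 1 s :=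
  wp_skip s Q

theorem wp_block_cons (c : Cmd) (cs : List Cmd) (s : State) (Q : ℕ → State → Prop) :
    wp (block (c :: cs)) s Q ↔ wp c s fun t s' => wp (block cs) s' fun t' s'' => Q (t + t') s'' :=
  wp_seq c (block cs) s Q

/-- The rule for loops, with a decreasing measure. -/
theorem wp_loop {b : Test} {c : Cmd} {T : ℕ} (I : ℕ → State → Prop)
    (hstep : ∀ m s, I m s → b.eval s = true →
      wp c s fun t s' => t ≤ T ∧ ∃ m', m' < m ∧ I m' s') (m : ℕ) :
    ∀ s, I m s → wp (.loop b c) s fun t s' =>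
      t ≤ m * (T + (b.cost + 1)) + (b.cost + 1) ∧ b.eval s' = false ∧ ∃ m', I m' s' := by
  induction m using Nat.strong_induction_on with
  | _ m ih =>
    intro s hI
    cases hb : b.eval s with
    | false => exact ⟨s, _, .loopFalse hb, by omega, hb, m, hI⟩
    | true =>
      obtain ⟨s', t, h, ht, m', hm', hI'⟩ := hstep m s hI hb
      obtain ⟨s'', t', h', ht', hQ⟩ := ih m' hm' s' hI'
      refine ⟨s'', _, .loopTrue hb h h', ?_, hQ⟩
      have : (m' + 1) * (T + (b.cost + 1)) ≤ m * (T + (b.cost + 1)) := Nat.mul_le_mul_right _ hm'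
      rw [Nat.add_mul] at this
      omega

/-- The rule for counting loops. -/
theorem wp_forLoop {v : Reg} {hi : Expr} {c : Cmd} {s : State} {N M T : ℕ}
    (I : ℕ → State → Prop) (hcost : hi.cost ≤ 3) (hv : c.writesReg v = false)
    (hN : ∀ s', Frame (forLoop v hi c) s s' → hi.eval s' = N) (hM : N ≤ M) (hM' : 1 ≤ M)
    (h0 : I 0 (s.setReg v 0))
    (hstep : ∀ i s', i < N → s'.reg v = i → Frame (forLoop v hi c) s s' → I i s' →
      wp c s' fun t s'' => t ≤ T ∧ I (i + 1) (s''.setReg v (i + 1))) :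
    wp (forLoop v hi c) s fun t s' => t ≤ M * (T + 26) ∧ I N s' := by
  have hfv : (forLoop v hi c).writesReg v = true := by
    simp [forLoop, block, Cmd.writesReg]
  have hset : ∀ s' a, Frame (forLoop v hi c) s s' → Frame (forLoop v hi c) s (s'.setReg v a) := by
    intro s' a h
    refine ⟨fun v' hv' => ?_, h.2⟩
    have : v' ≠ v := by
      rintro rfl
      simp [hfv] at hv'
    simpa [State.setReg, this] using h.1 v' hv'
  have hloop := wp_loop (b := .lt v hi) (c := block [c, .assign v (.add v (.lit 1))]) (T := T + 5)
    (fun m s' => ∃ i, m + i = N ∧ s'.reg v = i ∧ Frame (forLoop v hi c) s s' ∧ I i s') (by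
      rintro m s' ⟨i, hmi, hvi, hfr, hI⟩ hb
      have hlt : i < N := by
        simpa [Test.eval, Expr.eval, hvi, hN s' hfr] using hb
      rw [wp_block_cons]
      refine (hstep i s' hlt hvi hfr hI).mono ?_
      rintro t s'' hfr' ⟨ht, hI'⟩
      rw [wp_block_cons, wp_assign, wp_block_nil]
      have hvi' : s''.reg v = i := (hfr'.1 v hv).trans hvi
      simp only [Expr.eval, hvi', Expr.cost]
      refine ⟨by omega, N - (i + 1), by omega, i + 1, by omega, by simp [State.setReg],
        hset _ _ (hfr.trans (hfr'.mono ?_ ?_)), hI'⟩ <;>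
      simp +contextual [forLoop, block, Cmd.writesReg, Cmd.writesArr]) N (s.setReg v 0)
      ⟨0, by omega, by simp [State.setReg], hset _ _ (Frame.refl _ _), h0⟩
  rw [forLoop, wp_block_cons, wp_assign, wp_block_cons]
  refine hloop.mono ?_
  rintro t s' - ⟨ht, hb, m, i, hmi, hvi, hfr, hI⟩
  rw [wp_block_nil]
  simp only [Test.cost, Expr.cost] at ht ⊢
  have : i = N := by
    simp only [Test.eval, Expr.eval, hvi, hN s' hfr, decide_eq_false_iff_not] at hb
    omega
  subst this
  refine ⟨?_, hI⟩
  -- A pass costs at most 11 beyond its body. The remaining 15 of the 26, available at least once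
  -- since `1 ≤ M`, pay for the initialization, the last test and the closing `skip`.
  have h1 : i * (T + 5 + (1 + hi.cost + 1 + 1)) ≤ M * (T + 11) := Nat.mul_le_mul hM (by omega)
  have h2 : M * (T + 26) = M * (T + 11) + M * 15 := by ring
  generalize i * (T + 5 + (1 + hi.cost + 1 + 1)) = X at *
  generalize M * (T + 11) = Y at *
  omega

theorem setReg_reg (s : State) (v v' : Reg) (a : ℕ) :
    (s.setReg v a).reg v' = if v' = v then a else s.reg v' := rfl

theorem setReg_mem (s : State) (v : Reg) (a : ℕ) : (s.setReg v a).mem = s.mem := rfl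

theorem setMem_reg (s : State) (A : Arr) (i j a : ℕ) : (s.setMem A i j a).reg = s.reg := rfl

theorem setMem_mem (s : State) (A A' : Arr) (i j a i' j' : ℕ) :
    (s.setMem A i j a).mem A' i' j' = if A' = A ∧ i' = i ∧ j' = j then a else s.mem A' i' j' := rfl

theorem eval_eq_true (a b : Expr) (s : State) :
    (Test.eq a b).eval s = true ↔ a.eval s = b.eval s := decide_eq_true_iff

theorem eval_le_true (a b : Expr) (s : State) :
    (Test.le a b).eval s = true ↔ a.eval s ≤ b.eval s := decide_eq_true_iff

theorem eval_lt_true (a b : Expr) (s : State) :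
    (Test.lt a b).eval s = true ↔ a.eval s < b.eval s := decide_eq_true_iff

theorem eval_and_true (a b : Test) (s : State) :
    (Test.and a b).eval s = true ↔ a.eval s = true ∧ b.eval s = true := by
  rw [Test.eval, Bool.and_eq_true]

theorem eval_or_true (a b : Test) (s : State) :
    (Test.or a b).eval s = true ↔ a.eval s = true ∨ b.eval s = true := by
  rw [Test.eval, Bool.or_eq_true]


/-! ### Breadth-first search -/

/-- `f` is the distance function of a vertex `a` with respect to the adjacency relation `A` on
`{0, …, n - 1}`, the value `n` standing for an infinite distance. -/
structure IsDist (n : ℕ) (A : ℕ → ℕ → Prop) (a : ℕ) (f : ℕ → ℕ) : Prop where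
  zero : ∀ y < n, f y = 0 ↔ y = a
  le : ∀ y < n, f y ≤ n
  step : ∀ x < n, ∀ y < n, A x y → f x < n → f y ≤ f x + 1
  pred : ∀ y < n, ∀ l, f y = l + 1 → f y < n → ∃ x < n, A x y ∧ f x = l

/-- Breadth-first search from the vertex `s`. -/
def bfs : Cmd :=
  block [
    forLoop x n (.put dist s x n),
    .put dist s s (.lit 0),
    forLoop l n <| forLoop x n <| ifThen (.get dist s x =ᵉ l) <|
      forLoop y n <| ifThen (.get adj x y =ᵉ .lit 1 ∧ᵉ .get dist s y =ᵉ n) <|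
        .put dist s y (l +ᵉ .lit 1)]

theorem computeDist_eq : computeDist = forLoop s n bfs := rfl

/-- While level `L` is expanded, the entries up to `L` are final, and the value `L + 1` has been
given exactly to the next-level vertices with a level-`L` neighbour already processed. -/
theorem wp_bfs_inner {N a L i : ℕ} {f : ℕ → ℕ} {s : State} (hn : s.reg n = N) (hL : L < N)
    (hl : s.reg l = L) (ha : s.reg Reg.s = a) (hi : i < N) (hx : s.reg x = i)
    (hf : IsDist N (fun x y => s.mem adj x y = 1) a f)
    (hdist : ∀ y < N, s.mem dist a y = if f y ≤ L then f y else
      if f y = L + 1 ∧ ∃ x < i, s.mem adj x y = 1 ∧ f x = L then L + 1 else N) :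
    wp (ifThen (.get dist Reg.s x =ᵉ l) <|
      forLoop y n <| ifThen (.get adj x y =ᵉ .lit 1 ∧ᵉ .get dist Reg.s y =ᵉ n) <|
        .put dist Reg.s y (l +ᵉ .lit 1)) s fun t s' => t ≤ 60 * N ∧
      (∀ y < N, s'.mem dist a y = if f y ≤ L then f y else
        if f y = L + 1 ∧ ∃ x < i + 1, s.mem adj x y = 1 ∧ f x = L then L + 1 else N) ∧
      ∀ b, b ≠ a → s'.mem dist b = s.mem dist b := by
  rw [wp_ifThen]
  simp only [eval_eq_true, Expr.eval, ha, hx, hl,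
    Test.cost, Expr.cost]
  have hfi : s.mem dist a i = L ↔ f i = L := by
    rw [hdist i hi]
    split_ifs <;> omega
  rw [hfi]
  constructor
  · intro hfL
    refine wp.mono (wp_forLoop (N := N) (M := N) (T := 20) (fun j s' =>
      (∀ y < N, s'.mem dist a y = if f y ≤ L then f y else
        if f y = L + 1 ∧ ((∃ x < i, s.mem adj x y = 1 ∧ f x = L) ∨ (y < j ∧ s.mem adj i y = 1))
          then L + 1 else N) ∧
      ∀ b, b ≠ a → s'.mem dist b = s.mem dist b) (by simp [Expr.cost]) rfl ?_ le_rfl (by omega)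
      ?_ ?_) ?_
    · intro s' hs'
      exact (hs'.1 n rfl).trans hn
    · simpa [setReg_mem] using hdist
    · rintro j s' hj hyj hfr ⟨hI, hother⟩
      rw [wp_ifThen, wp_put]
      have e1 : s'.reg x = i := (hfr.1 x rfl).trans hx
      have e2 : s'.reg Reg.s = a := (hfr.1 Reg.s rfl).trans ha
      have e3 : s'.reg n = N := (hfr.1 n rfl).trans hn
      have e4 : s'.reg l = L := (hfr.1 l rfl).trans hl
      have e5 : s'.mem adj = s.mem adj := hfr.2 adj rfl
      simp only [eval_eq_true, eval_and_true, Expr.eval, Test.cost, Expr.cost, e1, e2, e3, e4, e5,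
        hyj, setReg_mem]
      have hstep := hf.step i hi j hj
      have hle := hf.le j hj
      constructor
      · rintro ⟨hadj, hdj⟩
        have hj1 := hstep hadj (by omega)
        have hIj := hI j hj
        refine ⟨by omega, fun y hy => ?_, fun b hb => ?_⟩
        · rw [setMem_mem]
          by_cases hyj : y = j
          · subst hyj
            simp only [true_and, if_true]
            rw [hdj] at hIj
            split_ifs at hIj ⊢ <;> omega
          · simp only [hyj, and_false, if_false]
            rw [hI y hy]
            have : y < j + 1 ↔ y < j := by omega
            simp only [this]
        · funext y
          rw [setMem_mem, ← hother b hb]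
          simp [hb]
      · intro hcon
        have hIj := hI j hj
        refine ⟨by omega, fun y hy => ?_, hother⟩
        rw [hI y hy]
        by_cases hyj : y = j
        · subst hyj
          by_cases h1 : f y ≤ L
          · rw [if_pos h1, if_pos h1]
          · rw [if_neg h1, if_neg h1]
            rw [if_neg h1] at hIj
            by_cases h2 : s.mem adj i y = 1
            · have h3 : s'.mem dist a y ≠ N := by tauto
              have h4 : f y = L + 1 ∧ ((∃ x < i, s.mem adj x y = 1 ∧ f x = L) ∨
                  (y < y ∧ s.mem adj i y = 1)) := by
                by_contra h4
                rw [if_neg h4] at hIj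
                exact h3 hIj
              rw [if_pos h4, if_pos ⟨h4.1, Or.inr ⟨by omega, h2⟩⟩]
            · simp [h2]
        · have : y < j + 1 ↔ y < j := by omega
          simp only [this]
    · rintro t s' - ⟨ht, hI, hother⟩
      refine ⟨by omega, fun y hy => ?_, hother⟩
      rw [hI y hy]
      congr 1
      have : ((∃ x < i, s.mem adj x y = 1 ∧ f x = L) ∨ (y < N ∧ s.mem adj i y = 1)) ↔
          ∃ x < i + 1, s.mem adj x y = 1 ∧ f x = L := by
        constructor
        · rintro (⟨x, h1, h2⟩ | h)
          · exact ⟨x, by omega, h2⟩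
          · exact ⟨i, by omega, h.2, hfL⟩
        · rintro ⟨x, h1, h2⟩
          by_cases h : x = i
          · subst h
            exact Or.inr ⟨hy, h2.1⟩
          · exact Or.inl ⟨x, by omega, h2⟩
      simp only [this]
  · intro hfL
    refine ⟨by omega, fun y hy => ?_, by simp⟩
    rw [hdist y hy]
    congr 1
    have : (∃ x < i, s.mem adj x y = 1 ∧ f x = L) ↔
        ∃ x < i + 1, s.mem adj x y = 1 ∧ f x = L := by
      constructor
      · rintro ⟨x, h1, h2⟩
        exact ⟨x, by omega, h2⟩
      · rintro ⟨x, h1, h2⟩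
        by_cases h : x = i
        · subst h
          exact absurd h2.2 hfL
        · exact ⟨x, by omega, h2⟩
    simp only [this]

/-- Every level rescans all vertices, so the bound is cubic; this stays below the cost of pruning.
-/
theorem wp_bfs {N a : ℕ} {f : ℕ → ℕ} {s : State} (hn : s.reg n = N) (ha : s.reg Reg.s = a)
    (haN : a < N) (hf : IsDist N (fun x y => s.mem adj x y = 1) a f) :
    wp bfs s fun t s' => t ≤ 200 * N ^ 3 ∧ (∀ y < N, s'.mem dist a y = f y) ∧
      ∀ b, b ≠ a → s'.mem dist b = s.mem dist b := by
  have hN1 : 1 ≤ N := by omega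
  rw [bfs, wp_block_cons]
  refine wp.mono (wp_forLoop (N := N) (M := N) (T := 4) (fun i s' => (∀ y < i, s'.mem dist a y = N) ∧
      ∀ b, b ≠ a → s'.mem dist b = s.mem dist b) (by simp [Expr.cost]) rfl
      (fun s' hs' => (hs'.1 n rfl).trans hn) le_rfl hN1 (by simp [setReg_mem]) ?_) ?_
  · rintro i s' hi hxi hfr ⟨hI, hother⟩
    rw [wp_put]
    have e2 : s'.reg Reg.s = a := (hfr.1 Reg.s rfl).trans ha
    have e3 : s'.reg n = N := (hfr.1 n rfl).trans hn
    simp only [Expr.eval, Expr.cost, e2, e3, hxi, setReg_mem, setMem_mem]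
    refine ⟨le_rfl, fun y hy => ?_, fun b hb => ?_⟩
    · split_ifs with h
      · rfl
      · exact hI y (by simp at h; omega)
    · funext y
      rw [setMem_mem, ← hother b hb]
      simp [hb]
  rintro t1 s1 hfr1 ⟨ht1, hI1, hother1⟩
  have e2 : s1.reg Reg.s = a := (hfr1.1 Reg.s rfl).trans ha
  have e3 : s1.reg n = N := (hfr1.1 n rfl).trans hn
  have e5 : s1.mem adj = s.mem adj := hfr1.2 adj rfl
  rw [wp_block_cons, wp_put, wp_block_cons]
  simp only [Expr.eval, Expr.cost, e2]
  set s2 := s1.setMem dist a a 0 with hs2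
  have hs2m : ∀ y, s2.mem dist a y = if y = a then 0 else s1.mem dist a y := by
    intro y
    rw [hs2, setMem_mem]
    simp
  refine wp.mono (wp_forLoop (N := N) (M := N) (T := 86 * N ^ 2) (fun L s' =>
      (∀ y < N, s'.mem dist a y = if f y ≤ L then f y else N) ∧
      ∀ b, b ≠ a → s'.mem dist b = s.mem dist b) (by simp [Expr.cost]) rfl
      (fun s' hs' => (hs'.1 n rfl).trans e3) le_rfl hN1 ?_ ?_) ?_
  · refine ⟨fun y hy => ?_, fun b hb => ?_⟩
    · rw [setReg_mem, hs2m]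
      have := hf.zero y hy
      by_cases hya : y = a
      · rw [if_pos hya, this.2 hya]
        rfl
      · rw [if_neg hya, hI1 y hy, if_neg]
        omega
    · rw [setReg_mem, ← hother1 b hb]
      funext y
      rw [hs2, setMem_mem]
      simp [hb]
  · rintro L s3 hL hlL hfr3 ⟨hI3, hother3⟩
    have e2 : s3.reg Reg.s = a := (hfr3.1 Reg.s rfl).trans e2
    have e3 : s3.reg n = N := (hfr3.1 n rfl).trans e3
    have e5 : s3.mem adj = s.mem adj := (hfr3.2 adj rfl).trans e5
    refine wp.mono (wp_forLoop (N := N) (M := N) (T := 60 * N) (fun i s' =>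
      (∀ y < N, s'.mem dist a y = if f y ≤ L then f y else
        if f y = L + 1 ∧ ∃ x < i, s.mem adj x y = 1 ∧ f x = L then L + 1 else N) ∧
      ∀ b, b ≠ a → s'.mem dist b = s.mem dist b) (by simp [Expr.cost]) rfl
      (fun s' hs' => (hs'.1 n rfl).trans e3) le_rfl hN1 ?_ ?_) ?_
    · simpa [setReg_mem] using ⟨hI3, hother3⟩
    · rintro i s4 hi hxi hfr4 ⟨hI4, hother4⟩
      have e5' : s4.mem adj = s.mem adj := (hfr4.2 adj rfl).trans e5
      refine wp.mono (wp_bfs_inner (N := N) (a := a) (L := L) (i := i) (f := f)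
        ((hfr4.1 n rfl).trans e3) hL ((hfr4.1 l rfl).trans hlL) ((hfr4.1 Reg.s rfl).trans e2)
        hi hxi (by rw [e5']; exact hf) (by rw [e5']; exact hI4)) ?_
      rintro t s5 - ⟨ht, h1, h2⟩
      rw [e5'] at h1
      exact ⟨ht, h1, fun b hb => (h2 b hb).trans (hother4 b hb)⟩
    · rintro t s4 - ⟨ht, h1, h2⟩
      refine ⟨ht.trans (by nlinarith), fun y hy => ?_, h2⟩
      rw [setReg_mem, h1 y hy]
      by_cases hle : f y ≤ L
      · rw [if_pos hle, if_pos (by omega)]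
      · rw [if_neg hle]
        by_cases heq : f y = L + 1
        · rw [if_pos (by omega : f y ≤ L + 1), heq]
          by_cases hlt : L + 1 < N
          · rw [if_pos]
            exact ⟨rfl, hf.pred y hy L heq (by omega)⟩
          -- In the last round `L + 1` coincides with the marker of an infinite distance, so both
          -- branches store the same value.
          · have : L + 1 = N := by omega
            rw [this, ite_self]
        · rw [if_neg (by tauto), if_neg (by omega)]
  · rintro t s3 - ⟨ht, h1, h2⟩
    rw [wp_block_nil]
    refine ⟨?_, fun y hy => by rw [h1 y hy, if_pos (hf.le y hy)], h2⟩
    have h3 : N * (86 * N ^ 2 + 26) = 86 * N ^ 3 + 26 * N := by ring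
    have h4 : N ≤ N ^ 3 := Nat.le_self_pow (by omega) N
    omega

theorem wp_computeDist {N : ℕ} {F : ℕ → ℕ → ℕ} {s : State} (hn : s.reg n = N) (hN1 : 1 ≤ N)
    (hf : ∀ a < N, IsDist N (fun x y => s.mem adj x y = 1) a (F a)) :
    wp computeDist s fun t s' => t ≤ 226 * N ^ 4 ∧
      ∀ a < N, ∀ y < N, s'.mem dist a y = F a y := by
  rw [computeDist_eq]
  refine wp.mono (wp_forLoop (N := N) (M := N) (T := 200 * N ^ 3)
    (fun i s' => ∀ a < i, ∀ y < N, s'.mem dist a y = F a y) (by simp [Expr.cost]) rfl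
    (fun s' hs' => (hs'.1 n rfl).trans hn) le_rfl hN1 (by simp) ?_) ?_
  · rintro i s1 hi hsi hfr hI
    have e5 : s1.mem adj = s.mem adj := hfr.2 adj rfl
    refine wp.mono (wp_bfs (f := F i) ((hfr.1 n rfl).trans hn) hsi hi (by rw [e5]; exact hf i hi)) ?_
    rintro t s2 - ⟨ht, h1, h2⟩
    refine ⟨ht, fun a ha y hy => ?_⟩
    rw [setReg_mem]
    by_cases hai : a = i
    · subst hai
      exact h1 y hy
    · rw [h2 a hai]
      exact hI a (by omega) y hy
  · rintro t s1 - ⟨ht, h1⟩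
    refine ⟨ht.trans ?_, h1⟩
    have h3 : N * (200 * N ^ 3 + 26) = 200 * N ^ 4 + 26 * N := by ring
    have h4 : N ≤ N ^ 4 := Nat.le_self_pow (by omega) N
    omega


/-! ### Distances and odd-girth of graphs on `{0, …, N - 1}` -/

/-- Adjacency as a relation on natural numbers. -/
def adjNat {N : ℕ} (G : SimpleGraph (Fin N)) (i j : ℕ) : Prop :=
  ∃ (hi : i < N) (hj : j < N), G.Adj ⟨i, hi⟩ ⟨j, hj⟩

open Classical in
/-- The distance function as a function of natural numbers, `N` standing for an infinite
distance. -/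
noncomputable def distNat {N : ℕ} (G : SimpleGraph (Fin N)) (i j : ℕ) : ℕ :=
  if h : ∃ (hi : i < N) (hj : j < N), G.Reachable ⟨i, hi⟩ ⟨j, hj⟩ then
    G.dist ⟨i, h.1⟩ ⟨j, h.2.1⟩ else N

theorem dist_lt_of_reachable {N : ℕ} {G : SimpleGraph (Fin N)} {a b : Fin N}
    (h : G.Reachable a b) : G.dist a b < N := by
  obtain ⟨p, hp, hl⟩ := h.exists_path_of_dist
  rw [← hl]
  simpa using hp.length_lt

theorem distNat_lt_iff {N : ℕ} {G : SimpleGraph (Fin N)} {a b : Fin N} :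
    distNat G a b < N ↔ G.Reachable a b := by
  unfold distNat
  split_ifs with h
  · simpa [dist_lt_of_reachable h.2.2] using h.2.2
  · simpa using h

theorem distNat_of_reachable {N : ℕ} {G : SimpleGraph (Fin N)} {a b : Fin N}
    (h : G.Reachable a b) : distNat G a b = G.dist a b := by
  rw [distNat, dif_pos ⟨a.2, b.2, h⟩]

theorem distNat_of_not_reachable {N : ℕ} {G : SimpleGraph (Fin N)} {a b : Fin N}
    (h : ¬ G.Reachable a b) : distNat G a b = N := by
  rw [distNat, dif_neg]
  rintro ⟨_, _, h'⟩
  exact h h'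

theorem isDist_distNat {N : ℕ} (G : SimpleGraph (Fin N)) {a : ℕ} (ha : a < N) :
    IsDist N (adjNat G) a (distNat G a) where
  zero y hy := by
    by_cases h : G.Reachable ⟨a, ha⟩ ⟨y, hy⟩
    · rw [distNat_of_reachable h, h.dist_eq_zero_iff, Fin.mk.injEq, eq_comm]
    · rw [distNat_of_not_reachable h]
      refine ⟨fun h => by omega, ?_⟩
      rintro rfl
      exact absurd (SimpleGraph.Reachable.refl _) h
  le y hy := by
    by_cases h : G.Reachable ⟨a, ha⟩ ⟨y, hy⟩
    · exact (distNat_lt_iff.2 h).le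
    · exact (distNat_of_not_reachable h).le
  step x hx y hy := by
    rintro ⟨_, _, hxy⟩ hlt
    have h := (distNat_lt_iff (a := ⟨a, ha⟩) (b := ⟨x, hx⟩)).1 hlt
    have h' := h.trans hxy.reachable
    rw [distNat_of_reachable (a := ⟨a, ha⟩) (b := ⟨x, hx⟩) h,
      distNat_of_reachable (a := ⟨a, ha⟩) (b := ⟨y, hy⟩) h']
    obtain ⟨W, hW⟩ := h.exists_walk_length_eq_dist
    have := SimpleGraph.dist_le (W.append (.cons hxy .nil))
    rwa [SimpleGraph.Walk.length_append, hW] at this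
  pred y hy L hL hlt := by
    have h := (distNat_lt_iff (a := ⟨a, ha⟩) (b := ⟨y, hy⟩)).1 hlt
    rw [distNat_of_reachable (a := ⟨a, ha⟩) (b := ⟨y, hy⟩) h] at hL
    obtain ⟨W, hW⟩ := h.symm.exists_walk_length_eq_dist
    rw [SimpleGraph.dist_comm, hL] at hW
    cases W with
    | nil => simp at hW
    | @cons _ x _ hyx W =>
      rw [SimpleGraph.Walk.length_cons, Nat.add_right_cancel_iff] at hW
      refine ⟨x, x.2, ⟨x.2, hy, hyx.symm⟩, ?_⟩
      have hr : G.Reachable ⟨a, ha⟩ x := W.reachable.symm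
      rw [distNat_of_reachable (a := ⟨a, ha⟩) hr]
      have h1 := SimpleGraph.dist_le W.reverse
      rw [SimpleGraph.Walk.length_reverse] at h1
      obtain ⟨W', hW'⟩ := hr.exists_walk_length_eq_dist
      have h2 := SimpleGraph.dist_le (W'.append (.cons hyx.symm .nil))
      rw [SimpleGraph.Walk.length_append, hW', hL, SimpleGraph.Walk.length_cons,
        SimpleGraph.Walk.length_nil] at h2
      omega

/-- `g` is the least value of `2 F(a, x) + 1` over the edges `xy` with `F(a, x) = F(a, y)` finite
and `(a, x, y)` in `S`, or `0` if there are none. -/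
def OddGirthInv (N : ℕ) (A : ℕ → ℕ → Prop) (F : ℕ → ℕ → ℕ) (S : ℕ → ℕ → ℕ → Prop) (g : ℕ) : Prop :=
  (∀ a < N, ∀ x < N, ∀ y < N, S a x y → A x y → F a x = F a y → F a x < N →
    g ≠ 0 ∧ g ≤ 2 * F a x + 1) ∧
  (g ≠ 0 → ∃ a < N, ∃ x < N, ∃ y < N, A x y ∧ F a x = F a y ∧ F a x < N ∧ g = 2 * F a x + 1)

theorem OddGirthInv.mono {N : ℕ} {A : ℕ → ℕ → Prop} {F : ℕ → ℕ → ℕ} {S S' : ℕ → ℕ → ℕ → Prop}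
    {g : ℕ} (h : OddGirthInv N A F S g)
    (hS : ∀ a < N, ∀ x < N, ∀ y < N, S' a x y → S a x y) : OddGirthInv N A F S' g :=
  ⟨fun a ha x hx y hy h' => h.1 a ha x hx y hy (hS a ha x hx y hy h'), h.2⟩

theorem wp_computeOddGirth {N : ℕ} {F : ℕ → ℕ → ℕ} {s : State} (hn : s.reg n = N) (hN1 : 1 ≤ N)
    (hf : ∀ a < N, IsDist N (fun x y => s.mem adj x y = 1) a (F a)) :
    wp computeOddGirth s fun t s' => t ≤ 500 * N ^ 4 ∧
      OddGirthInv N (fun x y => s.mem adj x y = 1) F (fun _ _ _ => True) (s'.reg g) := by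
  rw [computeOddGirth, wp_block_cons]
  refine wp.mono (wp_computeDist hn hN1 hf) ?_
  rintro t1 s1 hfr1 ⟨ht1, hF⟩
  have e3 : s1.reg n = N := (hfr1.1 n rfl).trans hn
  have e5 : s1.mem adj = s.mem adj := hfr1.2 adj rfl
  rw [← e5]
  rw [wp_block_cons, wp_assign, wp_block_cons]
  refine wp.mono (wp_forLoop (N := N) (M := N) (T := 131 * N ^ 2) (fun a s' =>
      OddGirthInv N (fun x y => s1.mem adj x y = 1) F (fun a' _ _ => a' < a) (s'.reg g))
      (by simp [Expr.cost]) rfl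
      (fun s' hs' => (hs'.1 n rfl).trans e3) le_rfl hN1
      (by simp [OddGirthInv, setReg_reg, Expr.eval]) ?_) ?_
  · rintro a s2 ha hsa hfr2 hI2
    have e3 : s2.reg n = N := (hfr2.1 n rfl).trans e3
    have e5 : s2.mem = s1.mem := by
      funext A
      exact hfr2.2 A rfl
    refine wp.mono (wp_forLoop (N := N) (M := N) (T := 105 * N) (fun i s' =>
      OddGirthInv N (fun x y => s1.mem adj x y = 1) F
        (fun a' x' _ => a' < a ∨ (a' = a ∧ x' < i)) (s'.reg g))
      (by simp [Expr.cost]) rfl (fun s' hs' => (hs'.1 n rfl).trans e3) le_rfl hN1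
      (hI2.mono (by omega)) ?_) ?_
    · rintro i s3 hi hxi hfr3 hI3
      have e3 : s3.reg n = N := (hfr3.1 n rfl).trans e3
      have hsa : s3.reg Reg.s = a := (hfr3.1 Reg.s rfl).trans hsa
      have e5 : s3.mem = s1.mem := by
        rw [← e5]
        funext A
        exact hfr3.2 A rfl
      refine wp.mono (wp_forLoop (N := N) (M := N) (T := 79) (fun j s' =>
        OddGirthInv N (fun x y => s1.mem adj x y = 1) F
          (fun a' x' y' => a' < a ∨ (a' = a ∧ (x' < i ∨ (x' = i ∧ y' < j)))) (s'.reg g))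
        (by simp [Expr.cost]) rfl (fun s' hs' => (hs'.1 n rfl).trans e3) le_rfl hN1
        (hI3.mono (by omega)) ?_) ?_
      · rintro j s4 hj hyj hfr4 hI4
        have e3 : s4.reg n = N := (hfr4.1 n rfl).trans e3
        have hsa : s4.reg Reg.s = a := (hfr4.1 Reg.s rfl).trans hsa
        have hxi : s4.reg x = i := (hfr4.1 x rfl).trans hxi
        have e5 : s4.mem = s1.mem := by
          rw [← e5]
          funext A
          exact hfr4.2 A rfl
        rw [wp_ifThen, wp_assign]
        simp only [eval_eq_true, eval_lt_true, eval_and_true, eval_or_true, Expr.eval, Test.cost,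
          Expr.cost, e3, e5, hsa, hxi, hyj, hF a ha i hi, hF a ha j hj, setReg_reg,
          reduceCtorEq, if_true, if_false]
        obtain ⟨h1, h2⟩ := hI4
        constructor
        · rintro ⟨hadj, heq, hlt, hg⟩
          refine ⟨by omega, fun a' ha' x' hx' y' hy' hS hadj' heq' hlt' => ⟨by omega, ?_⟩,
            fun _ => ⟨a, ha, i, hi, j, hj, hadj, heq, hlt, rfl⟩⟩
          by_cases hnew : a' = a ∧ x' = i ∧ y' = j
          · obtain ⟨rfl, rfl, rfl⟩ := hnew
            exact le_rfl
          · have := h1 a' ha' x' hx' y' hy' (by omega) hadj' heq' hlt'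
            omega
        · intro hcon
          refine ⟨by omega, fun a' ha' x' hx' y' hy' hS hadj' heq' hlt' => ?_, h2⟩
          by_cases hnew : a' = a ∧ x' = i ∧ y' = j
          · obtain ⟨rfl, rfl, rfl⟩ := hnew
            have := mt (fun h => (⟨hadj', heq', hlt', h⟩ : _ ∧ _ ∧ _ ∧ _)) hcon
            omega
          · exact h1 a' ha' x' hx' y' hy' (by omega) hadj' heq' hlt'
      · rintro t s4 - ⟨ht, hI⟩
        exact ⟨by omega, hI.mono (by omega)⟩
    · rintro t s3 - ⟨ht, hI⟩
      exact ⟨by nlinarith, hI.mono (by omega)⟩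
  · rintro t s2 - ⟨ht, hI⟩
    rw [wp_block_nil]
    refine ⟨?_, hI.mono (by omega)⟩
    have h3 : N * (131 * N ^ 2 + 26) = 131 * N ^ 3 + 26 * N := by ring
    have h4 : N ≤ N ^ 4 := Nat.le_self_pow (by omega) N
    have h5 : N ^ 3 ≤ N ^ 4 := Nat.pow_le_pow_right hN1 (by omega)
    simp only [Expr.cost]
    omega

open SimpleGraph in
/-- In an odd closed walk from `a` some edge has both ends at the same distance from `a`. -/
theorem exists_adj_dist_eq {V : Type*} {G : SimpleGraph V} {a : V} {u v : V} (Q : G.Walk u v)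
    (P : G.Walk a u) (hpar : (P.length + G.dist a u) % 2 = 0)
    (hodd : (P.length + Q.length + G.dist a v) % 2 = 1) :
    ∃ x y, G.Adj x y ∧ G.Reachable a x ∧ G.dist a x = G.dist a y ∧
      G.dist a x + G.dist v y + 1 ≤ P.length + Q.length := by
  induction Q with
  | nil =>
    rw [Walk.length_nil] at hodd
    omega
  | @cons u x v h Q ih =>
    rw [Walk.length_cons] at *
    have h1 := dist_le P
    by_cases heq : G.dist a u = G.dist a x
    · refine ⟨u, x, h, P.reachable, heq, ?_⟩
      have := dist_le Q
      rw [dist_comm] at this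
      omega
    -- As long as the two ends of each edge differ in distance, that distance keeps the parity of
    -- the length walked; an odd total length rules this out to the end.
    · have hlen : (P.append (.cons h .nil)).length = P.length + 1 := by
        rw [Walk.length_append]
        rfl
      obtain ⟨x', y', r1, r2, r3, r4⟩ := ih (P.append (.cons h .nil)) (by
        rw [hlen]
        have := h.diff_dist_adj (u := a)
        omega) (by rw [hlen]; omega)
      exact ⟨x', y', r1, r2, r3, by omega⟩

open SimpleGraph in
-- A nonzero recorded value is the length of an odd closed walk, hence at least 2k+1. Conversely, a
-- closed walk of length 2k+1 contains an edge with equidistant ends, whose recorded value is at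
-- most 2k+1.
theorem oddGirthInv_eq_iff {N k : ℕ} {G : SimpleGraph (Fin N)} {g : ℕ}
    (hG : ∀ (a : Fin N) (w : G.Walk a a), Odd w.length → 2 * k + 1 ≤ w.length)
    (h : OddGirthInv N (adjNat G) (distNat G) (fun _ _ _ => True) g) :
    g = 2 * k + 1 ↔ ∃ (a : Fin N) (w : G.Walk a a), w.length = 2 * k + 1 := by
  obtain ⟨h1, h2⟩ := h
  have hclosed : g ≠ 0 → ∃ (a : Fin N) (w : G.Walk a a), w.length = g := by
    intro hg
    obtain ⟨a, ha, x, hx, y, hy, ⟨_, _, hadj⟩, heq, hlt, hgeq⟩ := h2 hg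
    have hx' := (distNat_lt_iff (a := ⟨a, ha⟩) (b := ⟨x, hx⟩)).1 hlt
    have hy' := (distNat_lt_iff (a := ⟨a, ha⟩) (b := ⟨y, hy⟩)).1 (heq ▸ hlt)
    obtain ⟨P, hP⟩ := hx'.exists_walk_length_eq_dist
    obtain ⟨Q, hQ⟩ := hy'.exists_walk_length_eq_dist
    rw [← distNat_of_reachable hx'] at hP
    rw [← distNat_of_reachable hy'] at hQ
    refine ⟨_, (P.append (.cons hadj .nil)).append Q.reverse, ?_⟩
    rw [Walk.length_append, Walk.length_append, Walk.length_reverse, Walk.length_cons,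
      Walk.length_nil]
    simp only at hP hQ
    omega
  constructor
  · rintro rfl
    exact hclosed (by omega)
  · rintro ⟨a, w, hw⟩
    obtain ⟨x, y, hadj, hr, heq, hle⟩ := exists_adj_dist_eq w .nil (by simp)
      (by rw [Walk.length_nil, dist_self]; omega)
    rw [Walk.length_nil] at hle
    have hy := hr.trans hadj.reachable
    have := h1 a a.2 x x.2 y y.2 trivial ⟨x.2, y.2, hadj⟩
      (by rw [distNat_of_reachable hr, distNat_of_reachable hy, heq]) (distNat_lt_iff.2 hr)
    rw [distNat_of_reachable hr] at this
    obtain ⟨a', w', hw'⟩ := hclosed this.1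
    have h3 : Odd w'.length := by
      rw [hw']
      obtain ⟨_, _, _, _, _, _, _, _, _, hgeq⟩ := h2 this.1
      exact ⟨_, hgeq⟩
    have := hG a' w' h3
    omega


/-! ### Weights and triples -/

/-- The weight of a pair at distance `d`. -/
def weightOf (N K d : ℕ) : ℕ := if 1 ≤ d ∧ d < N ∧ d ≤ K then d else 0

theorem wp_computeWeights {N K : ℕ} {F : ℕ → ℕ → ℕ} {s : State} (hn : s.reg n = N)
    (hk : s.reg k = K) (hN1 : 1 ≤ N) (hF : ∀ a < N, ∀ y < N, s.mem dist a y = F a y) :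
    wp computeWeights s fun t s' => t ≤ 100 * N ^ 2 ∧
      ∀ a < N, ∀ y < N, s'.mem wt a y = weightOf N K (F a y) := by
  refine wp.mono (wp_forLoop (N := N) (M := N) (T := 56 * N) (fun i s' =>
    ∀ a < i, ∀ y < N, s'.mem wt a y = weightOf N K (F a y)) (by simp [Expr.cost]) rfl
    (fun s' hs' => (hs'.1 n rfl).trans hn) le_rfl hN1 (by simp) ?_) ?_
  · rintro i s1 hi hxi hfr hI
    have hn1 : s1.reg n = N := (hfr.1 n rfl).trans hn
    have hk1 : s1.reg k = K := (hfr.1 k rfl).trans hk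
    have hd1 : s1.mem dist = s.mem dist := hfr.2 dist rfl
    refine wp.mono (wp_forLoop (N := N) (M := N) (T := 30) (fun j s' =>
      (∀ a < i, ∀ y < N, s'.mem wt a y = weightOf N K (F a y)) ∧
      ∀ y < j, s'.mem wt i y = weightOf N K (F i y)) (by simp [Expr.cost]) rfl
      (fun s' hs' => (hs'.1 n rfl).trans hn1) le_rfl hN1 ⟨hI, by simp⟩ ?_) ?_
    · rintro j s2 hj hyj hfr2 ⟨hI1, hI2⟩
      have hn2 : s2.reg n = N := (hfr2.1 n rfl).trans hn1
      have hk2 : s2.reg k = K := (hfr2.1 k rfl).trans hk1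
      have hd2 : s2.mem dist = s.mem dist := (hfr2.2 dist rfl).trans hd1
      have hx2 : s2.reg x = i := (hfr2.1 x rfl).trans hxi
      rw [wp_ite, wp_put, wp_put]
      simp only [eval_le_true, eval_lt_true, eval_and_true, Expr.eval, Test.cost, Expr.cost, hn2,
        hk2, hd2, hx2, hyj, hF i hi j hj]
      have key : ∀ c, c = weightOf N K (F i j) →
          (∀ a < i, ∀ y < N, ((s2.setMem wt i j c).setReg Reg.y (j + 1)).mem wt a y =
            weightOf N K (F a y)) ∧
          ∀ y' < j + 1, ((s2.setMem wt i j c).setReg Reg.y (j + 1)).mem wt i y' =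
            weightOf N K (F i y') := by
        rintro c rfl
        refine ⟨fun a ha y hy => ?_, fun y hy => ?_⟩
        · rw [setReg_mem, setMem_mem, if_neg (by omega)]
          exact hI1 a ha y hy
        · rw [setReg_mem, setMem_mem]
          by_cases hyj : y = j
          · rw [if_pos ⟨rfl, rfl, hyj⟩, hyj]
          · rw [if_neg (by tauto)]
            exact hI2 y (by omega)
      exact ⟨fun h => ⟨by omega, key _ (if_pos h).symm⟩, fun h => ⟨by omega, key _ (if_neg h).symm⟩⟩
    · rintro t s2 - ⟨ht, h1, h2⟩
      refine ⟨by omega, fun a ha y hy => ?_⟩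
      by_cases hai : a = i
      · subst hai
        exact h2 y hy
      · exact h1 a (by omega) y hy
  · rintro t s1 - ⟨ht, h⟩
    exact ⟨by nlinarith, h⟩

/-- The first `c` rows of `t` are good triples, and all good triples in `S` are among them. -/
def TriplesInv (K : ℕ) (t : ℕ → ℕ → ℕ) (c : ℕ) (S : ℕ → ℕ → ℕ → Prop) : Prop :=
  (∀ i < c, Good K (t i 0) (t i 1) (t i 2)) ∧
  ∀ p q r, S p q r → Good K p q r → ∃ i < c, t i 0 = p ∧ t i 1 = q ∧ t i 2 = r

theorem TriplesInv.mono {K : ℕ} {t : ℕ → ℕ → ℕ} {c : ℕ} {S S' : ℕ → ℕ → ℕ → Prop}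
    (h : TriplesInv K t c S) (hS : ∀ p q r, Good K p q r → S' p q r → S p q r) :
    TriplesInv K t c S' :=
  ⟨h.1, fun p q r h1 h2 => h.2 p q r (hS p q r h2 h1) h2⟩

theorem wp_computeTriples {K : ℕ} {s : State} (hk : s.reg k = K) :
    wp computeTriples s fun t s' => t ≤ 300 * (K + 1) ^ 3 ∧ s'.reg cnt ≤ (K + 1) ^ 3 ∧
      TriplesInv K (s'.mem tri) (s'.reg cnt) fun _ _ _ => True := by
  rw [computeTriples, wp_block_cons, wp_assign, wp_block_cons]
  set s0 := s.setReg cnt 0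
  have hk0 : s0.reg k = K := hk
  refine wp.mono (wp_forLoop (N := K + 1) (M := K + 1) (T := 202 * (K + 1) ^ 2) (fun i s' =>
    s'.reg cnt ≤ i * (K + 1) ^ 2 ∧ TriplesInv K (s'.mem tri) (s'.reg cnt) fun p _ _ => p < i)
    (by simp [Expr.cost]) rfl
    (fun s' hs' => congrArg (· + 1) ((hs'.1 k rfl).trans hk0)) le_rfl (by omega)
    (by simp [TriplesInv, Expr.eval, setReg_reg]) ?_) ?_
  · rintro a s1 ha hpa hfr1 ⟨hc1, hI1⟩
    have hk1 : s1.reg k = K := (hfr1.1 k rfl).trans hk0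
    refine wp.mono (wp_forLoop (N := K + 1) (M := K + 1) (T := 176 * (K + 1)) (fun i s' =>
      s'.reg cnt ≤ a * (K + 1) ^ 2 + i * (K + 1) ∧ TriplesInv K (s'.mem tri) (s'.reg cnt)
        fun p q _ => p < a ∨ (p = a ∧ q < i))
      (by simp [Expr.cost]) rfl
      (fun s' hs' => congrArg (· + 1) ((hs'.1 k rfl).trans hk1)) le_rfl (by omega)
      ⟨by simpa [setReg_reg] using hc1, hI1.mono (by omega)⟩ ?_) ?_
    · rintro b s2 hb hqb hfr2 ⟨hc2, hI2⟩
      have hk2 : s2.reg k = K := (hfr2.1 k rfl).trans hk1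
      have hp2 : s2.reg p = a := (hfr2.1 p rfl).trans hpa
      refine wp.mono (wp_forLoop (N := K + 1) (M := K + 1) (T := 150) (fun i s' =>
        s'.reg cnt ≤ a * (K + 1) ^ 2 + b * (K + 1) + i ∧ TriplesInv K (s'.mem tri) (s'.reg cnt)
          fun p q r => p < a ∨ (p = a ∧ (q < b ∨ (q = b ∧ r < i))))
        (by simp [Expr.cost]) rfl
        (fun s' hs' => congrArg (· + 1) ((hs'.1 k rfl).trans hk2)) le_rfl (by omega)
        ⟨by simpa [setReg_reg] using hc2, hI2.mono (by omega)⟩ ?_) ?_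
      · rintro c s3 hc hrc hfr3 ⟨hc3, hI3⟩
        have hk3 : s3.reg k = K := (hfr3.1 k rfl).trans hk2
        have hp3 : s3.reg p = a := (hfr3.1 p rfl).trans hp2
        have hq3 : s3.reg q = b := (hfr3.1 q rfl).trans hqb
        rw [wp_ifThen]
        simp only [eval_le_true, eval_eq_true, eval_and_true, eval_or_true, wp_block_cons,
          wp_block_nil, wp_put, wp_assign, Expr.eval, Test.cost, Expr.cost, hk3, hp3, hq3, hrc,
          setMem_reg]
        constructor
        · intro hg
          have hg' : Good K a b c := by unfold Good; omega
          refine ⟨by omega, ?_, ?_⟩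
          · simp only [setReg_reg, reduceCtorEq, if_true, if_false]
            omega
          · simp only [setReg_reg, setReg_mem, reduceCtorEq, if_true, if_false]
            set t' := (((s3.setMem tri (s3.reg cnt) 0 a).setMem tri (s3.reg cnt) 1 b).setMem tri
              (s3.reg cnt) 2 c).mem tri with ht'
            have hold : ∀ i < s3.reg cnt, ∀ j, t' i j = s3.mem tri i j := by
              intro i hi j
              rw [ht', setMem_mem, if_neg (by omega), setMem_mem, if_neg (by omega), setMem_mem,
                if_neg (by omega)]
            have hnew : t' (s3.reg cnt) 0 = a ∧ t' (s3.reg cnt) 1 = b ∧ t' (s3.reg cnt) 2 = c := by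
              rw [ht']
              simp [setMem_mem]
            obtain ⟨h1, h2⟩ := hI3
            refine ⟨fun i hi => ?_, fun p q r hS hgood => ?_⟩
            · by_cases hic : i = s3.reg cnt
              · subst hic
                rw [hnew.1, hnew.2.1, hnew.2.2]
                exact hg'
              · have hic' : i < s3.reg cnt := by omega
                rw [hold i hic', hold i hic', hold i hic']
                exact h1 i hic'
            · by_cases hpqr : p = a ∧ q = b ∧ r = c
              · obtain ⟨rfl, rfl, rfl⟩ := hpqr
                exact ⟨s3.reg cnt, by omega, hnew⟩
              · obtain ⟨i, hi, h3⟩ := h2 p q r (by omega) hgood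
                exact ⟨i, by omega, by rwa [hold i hi, hold i hi, hold i hi]⟩
        · intro hg
          refine ⟨by omega, ?_, hI3.mono ?_⟩
          · simp only [setReg_reg, reduceCtorEq, if_false]
            omega
          · intro p q r hgood hS
            have : ¬ (p = a ∧ q = b ∧ r = c) := by
              rintro ⟨rfl, rfl, rfl⟩
              unfold Good at hgood
              omega
            omega
      · rintro t s3 - ⟨ht, hc3, hI3⟩
        refine ⟨by omega, ?_, hI3.mono ?_⟩
        · simp only [setReg_reg, reduceCtorEq, if_false]
          rw [Nat.add_mul]
          omega
        · unfold Good
          omega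
    · rintro t s2 - ⟨ht, hc2, hI2⟩
      refine ⟨by nlinarith, ?_, hI2.mono ?_⟩
      · simp only [setReg_reg, reduceCtorEq, if_false]
        rw [Nat.add_mul]
        nlinarith
      · unfold Good
        omega
  · rintro t s1 - ⟨ht, hc1, hI1⟩
    rw [wp_block_nil]
    refine ⟨?_, by rwa [← Nat.pow_succ'] at hc1, hI1.mono ?_⟩
    · have h3 : (K + 1) * (202 * (K + 1) ^ 2 + 26) = 202 * (K + 1) ^ 3 + 26 * (K + 1) := by ring
      have h4 : K + 1 ≤ (K + 1) ^ 3 := Nat.le_self_pow (by omega) _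
      simp only [Expr.cost]
      omega
    · unfold Good
      omega

/-! ### Checking triples -/

/-- The triple `{w x y, q, r}` is realized on `xy`. -/
def Realized (w : ℕ → ℕ → ℕ) (N q r x y : ℕ) : Prop :=
  (∃ z < N, w x z = q ∧ w y z = r) ∧ ∃ z < N, w x z = r ∧ w y z = q

theorem wp_checkTriple {N Q R X Y : ℕ} {s : State} (hn : s.reg n = N) (hN1 : 1 ≤ N)
    (hx : s.reg x = X) (hy : s.reg y = Y) (hq : s.reg q = Q) (hr : s.reg r = R) :
    wp checkTriple s fun t s' => t ≤ 100 * N ∧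
      (Realized (s.mem wt) N Q R X Y →
        s'.reg fail = s.reg fail ∧ s'.reg ex = s.reg ex ∧ s'.reg ey = s.reg ey) ∧
      (¬ Realized (s.mem wt) N Q R X Y → s'.reg fail = 1 ∧ s'.reg ex = X ∧ s'.reg ey = Y) := by
  rw [checkTriple]
  simp only [wp_block_cons, wp_assign]
  set s0 := (s.setReg fwd (Expr.eval s (.lit 0))).setReg bwd
    (Expr.eval (s.setReg fwd (Expr.eval s (.lit 0))) (.lit 0)) with hs0
  refine wp.mono (wp_forLoop (N := N) (M := N) (T := 40) (fun i s' =>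
    (s'.reg fwd = 0 ↔ ∀ z < i, ¬ (s.mem wt X z = Q ∧ s.mem wt Y z = R)) ∧
    (s'.reg bwd = 0 ↔ ∀ z < i, ¬ (s.mem wt X z = R ∧ s.mem wt Y z = Q)))
    (by simp [Expr.cost]) rfl
    (fun s' hs' => (hs'.1 n rfl).trans hn) le_rfl hN1
    (by simp [hs0, Expr.eval, setReg_reg]) ?_) ?_
  · rintro i s1 hi hzi hfr ⟨hI1, hI2⟩
    have hx1 : s1.reg x = X := (hfr.1 x rfl).trans hx
    have hy1 : s1.reg y = Y := (hfr.1 y rfl).trans hy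
    have hq1 : s1.reg q = Q := (hfr.1 q rfl).trans hq
    have hr1 : s1.reg r = R := (hfr.1 r rfl).trans hr
    have hm1 : s1.mem wt = s.mem wt := hfr.2 wt rfl
    simp only [wp_block_cons, wp_block_nil, wp_ifThen, wp_assign, eval_eq_true, eval_and_true,
      Expr.eval, Test.cost, Expr.cost, hx1, hy1, hq1, hr1, hzi, hm1, setReg_reg, setReg_mem,
      reduceCtorEq, if_true, if_false, Nat.forall_lt_succ_right, ← hI1, ← hI2]
    generalize (s.mem wt X i = Q ∧ s.mem wt Y i = R) = A
    generalize (s.mem wt X i = R ∧ s.mem wt Y i = Q) = A'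
    refine ⟨fun h1 => ⟨fun h2 => ⟨by omega, ?_⟩, fun h2 => ⟨by omega, ?_⟩⟩,
      fun h1 => ⟨fun h2 => ⟨by omega, ?_⟩, fun h2 => ⟨by omega, ?_⟩⟩⟩ <;> simp [h1, h2]
  · rintro t s1 hfr ⟨ht, hI1, hI2⟩
    have hx1 : s1.reg x = X := (hfr.1 x rfl).trans hx
    have hy1 : s1.reg y = Y := (hfr.1 y rfl).trans hy
    have hfail : s1.reg fail = s.reg fail := hfr.1 fail rfl
    have hex : s1.reg ex = s.reg ex := hfr.1 ex rfl
    have hey : s1.reg ey = s.reg ey := hfr.1 ey rfl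
    have hR : (s1.reg fwd = 0 ∨ s1.reg bwd = 0) ↔ ¬ Realized (s.mem wt) N Q R X Y := by
      rw [hI1, hI2, Realized, not_and_or]
      simp only [not_exists, not_and]
    simp only [wp_block_cons, wp_block_nil, wp_ifThen, wp_assign, eval_eq_true, eval_or_true,
      Expr.eval, Test.cost, Expr.cost, hx1, hy1, setReg_reg, reduceCtorEq, if_true, if_false, hR]
    refine ⟨fun h => ⟨by omega, fun h' => absurd h' h, fun _ => by simp⟩,
      fun h => ⟨by omega, fun _ => ⟨hfail, hex, hey⟩, fun h' => absurd h' h⟩⟩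

/-- Either no check in `S` has failed, or `(e, f)` is a failing edge. -/
def ScanInv (N C : ℕ) (w t : ℕ → ℕ → ℕ) (S : ℕ → ℕ → ℕ → Prop) (fl e f : ℕ) : Prop :=
  (fl = 0 ∧ ∀ x < N, ∀ y < x, ∀ i < C, S x y i → 1 ≤ w x y → t i 0 = w x y →
    Realized w N (t i 1) (t i 2) x y) ∨
  (fl = 1 ∧ e < N ∧ f < e ∧ 1 ≤ w e f ∧
    ∃ i < C, t i 0 = w e f ∧ ¬ Realized w N (t i 1) (t i 2) e f)

theorem ScanInv.mono {N C : ℕ} {w t : ℕ → ℕ → ℕ} {S S' : ℕ → ℕ → ℕ → Prop} {fl e f : ℕ}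
    (h : ScanInv N C w t S fl e f)
    (hS : ∀ x < N, ∀ y < x, ∀ i < C, S' x y i → 1 ≤ w x y → S x y i) :
    ScanInv N C w t S' fl e f :=
  h.imp (fun h => ⟨h.1, fun x hx y hy i hi h1 h2 => h.2 x hx y hy i hi (hS x hx y hy i hi h1 h2) h2⟩)
    id

theorem ScanInv.of_ne_zero {N C : ℕ} {w t : ℕ → ℕ → ℕ} {S S' : ℕ → ℕ → ℕ → Prop} {fl e f : ℕ}
    (h : ScanInv N C w t S fl e f) (hfl : fl ≠ 0) : ScanInv N C w t S' fl e f :=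
  Or.inr (h.resolve_left (fun h => hfl h.1))

/-- Once `fail` is set the guards skip every further check, so `(ex, ey)` remains the failing edge.
The cost counts N² pairs, the triples and N apices; `K` here bounds the number of triples. -/
theorem wp_scanEdges {N C K : ℕ} {s : State} (hn : s.reg n = N) (hN1 : 1 ≤ N)
    (hC : s.reg cnt = C) (hCK : C ≤ K) (hK1 : 1 ≤ K) :
    wp scanEdges s fun t s' => t ≤ 300 * (K * N ^ 3) ∧
      ScanInv N C (s.mem wt) (s.mem tri) (fun _ _ _ => True) (s'.reg fail) (s'.reg ex)
        (s'.reg ey) := by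
  have hKN : K ≤ K * N := Nat.le_mul_of_pos_right _ hN1
  have hKN2 : K * N ≤ K * N ^ 2 := Nat.mul_le_mul_left _ (Nat.le_self_pow (by omega) _)
  have hKN3 : K * N ^ 2 ≤ K * N ^ 3 := Nat.mul_le_mul_left _ (Nat.pow_le_pow_right hN1 (by omega))
  have hNK : N ≤ K * N := Nat.le_mul_of_pos_left _ hK1
  have hNK1 : 1 ≤ K * N := Nat.mul_pos hK1 hN1
  rw [scanEdges, wp_block_cons, wp_assign, wp_block_cons]
  refine wp.mono (wp_forLoop (N := N) (M := N) (T := 252 * (K * N ^ 2)) (fun a s' =>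
    ScanInv N C (s.mem wt) (s.mem tri) (fun x _ _ => x < a) (s'.reg fail) (s'.reg ex) (s'.reg ey))
    (by simp [Expr.cost]) rfl
    (fun s' hs' => (hs'.1 n rfl).trans hn) le_rfl hN1
    (Or.inl (by simp [Expr.eval, setReg_reg])) ?_) ?_
  · rintro a s1 ha hxa hfr1 hI1
    have hn1 : s1.reg n = N := (hfr1.1 n rfl).trans hn
    have hC1 : s1.reg cnt = C := (hfr1.1 cnt rfl).trans hC
    have hw1 : s1.mem wt = s.mem wt := hfr1.2 wt rfl
    have ht1 : s1.mem tri = s.mem tri := hfr1.2 tri rfl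
    refine wp.mono (wp_forLoop (N := a) (M := N) (T := 220 * (K * N)) (fun b s' =>
      ScanInv N C (s.mem wt) (s.mem tri) (fun x y _ => x < a ∨ (x = a ∧ y < b)) (s'.reg fail)
        (s'.reg ex) (s'.reg ey)) (by simp [Expr.cost]) rfl
      (fun s' hs' => (hs'.1 x rfl).trans hxa) (by omega) hN1 (hI1.mono (by omega)) ?_) ?_
    · rintro b s2 hb hyb hfr2 hI2
      have hn2 : s2.reg n = N := (hfr2.1 n rfl).trans hn1
      have hC2 : s2.reg cnt = C := (hfr2.1 cnt rfl).trans hC1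
      have hw2 : s2.mem wt = s.mem wt := (hfr2.2 wt rfl).trans hw1
      have ht2 : s2.mem tri = s.mem tri := (hfr2.2 tri rfl).trans ht1
      have hx2 : s2.reg x = a := (hfr2.1 x rfl).trans hxa
      rw [wp_ifThen]
      simp only [wp_block_cons, wp_assign, eval_eq_true, eval_le_true, eval_and_true, Expr.eval,
        Test.cost, Expr.cost, hw2, hx2, hyb]
      constructor
      · rintro ⟨hfl, hwab⟩
        set s3 := s2.setReg p (s.mem wt a b) with hs3
        refine wp.mono (wp_forLoop (N := C) (M := K) (T := 150 * N) (fun i s' =>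
          ScanInv N C (s.mem wt) (s.mem tri)
            (fun x y i' => x < a ∨ (x = a ∧ (y < b ∨ (y = b ∧ i' < i)))) (s'.reg fail)
            (s'.reg ex) (s'.reg ey)) (by simp [Expr.cost]) rfl
          (fun s' hs' => (hs'.1 cnt rfl).trans hC2) hCK hK1 (hI2.mono (by omega)) ?_) ?_
        · rintro i s4 hi hii hfr4 hI4
          have hn4 : s4.reg n = N := (hfr4.1 n rfl).trans hn2
          have hw4 : s4.mem wt = s.mem wt := (hfr4.2 wt rfl).trans hw2
          have ht4 : s4.mem tri = s.mem tri := (hfr4.2 tri rfl).trans ht2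
          have hx4 : s4.reg x = a := (hfr4.1 x rfl).trans hx2
          have hy4 : s4.reg y = b := (hfr4.1 y rfl).trans hyb
          have hp4 : s4.reg p = s.mem wt a b := hfr4.1 p rfl
          rw [wp_ifThen]
          simp only [wp_block_cons, wp_block_nil, wp_assign, eval_eq_true, eval_and_true,
            Expr.eval, Test.cost, Expr.cost, ht4, hii, hp4, setReg_reg, setReg_mem, reduceCtorEq,
            if_false]
          constructor
          · rintro ⟨hfl4, hti⟩
            refine wp.mono (wp_checkTriple (N := N) (X := a) (Y := b) (Q := s.mem tri i 1)
              (R := s.mem tri i 2) hn4 hN1 hx4 hy4 (by simp [setReg_reg])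
              (by simp [setReg_reg])) ?_
            rintro t s5 - ⟨ht5, hreal, hnreal⟩
            simp only [setReg_mem, setReg_reg, reduceCtorEq, if_false, hw4] at hreal hnreal
            refine ⟨by omega, ?_⟩
            by_cases hR : Realized (s.mem wt) N (s.mem tri i 1) (s.mem tri i 2) a b
            · obtain ⟨r1, r2, r3⟩ := hreal hR
              rw [r1, r2, r3]
              rcases hI4 with ⟨h1, h2⟩ | ⟨h1, -⟩
              · refine Or.inl ⟨h1, fun x' hx' y' hy' i' hi' hS => ?_⟩
                by_cases heq : x' = a ∧ y' = b ∧ i' = i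
                · obtain ⟨rfl, rfl, rfl⟩ := heq
                  exact fun _ _ => hR
                · exact h2 x' hx' y' hy' i' hi' (by omega)
              · omega
            · obtain ⟨r1, r2, r3⟩ := hnreal hR
              rw [r1, r2, r3]
              exact Or.inr ⟨rfl, ha, hb, hwab, i, hi, hti, hR⟩
          · intro hcon
            refine ⟨by omega, ?_⟩
            by_cases hfl4 : s4.reg fail = 0
            · rcases hI4 with ⟨h1, h2⟩ | ⟨h1, -⟩
              · refine Or.inl ⟨h1, fun x' hx' y' hy' i' hi' hS hw' ht' => ?_⟩
                by_cases heq : x' = a ∧ y' = b ∧ i' = i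
                · obtain ⟨rfl, rfl, rfl⟩ := heq
                  exact absurd ⟨hfl4, ht'⟩ hcon
                · exact h2 x' hx' y' hy' i' hi' (by omega) hw' ht'
              · omega
            · exact hI4.of_ne_zero hfl4
        · rintro t s4 - ⟨ht, hI⟩
          rw [wp_block_nil]
          refine ⟨?_, hI.mono (by omega)⟩
          have : K * (150 * N + 26) = 150 * (K * N) + 26 * K := by ring
          omega
      · intro hcon
        refine ⟨by omega, ?_⟩
        by_cases hfl : s2.reg fail = 0
        · refine hI2.mono fun x' hx' y' hy' i hi hS hw' => ?_
          by_cases heq : x' = a ∧ y' = b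
          · obtain ⟨rfl, rfl⟩ := heq
            exact absurd ⟨hfl, hw'⟩ hcon
          · omega
        · exact hI2.of_ne_zero hfl
    · rintro t s2 - ⟨ht, hI⟩
      refine ⟨?_, hI.mono (by omega)⟩
      have : N * (220 * (K * N) + 26) = 220 * (K * N ^ 2) + 26 * N := by ring
      omega
  · rintro t s1 - ⟨ht, hI⟩
    rw [wp_block_nil]
    refine ⟨?_, hI.mono (by omega)⟩
    have : N * (252 * (K * N ^ 2) + 26) = 252 * (K * N ^ 3) + 26 * N := by ring
    simp only [Expr.cost]
    omega


/-! ### Pruning -/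

theorem IsDist.congr {N a : ℕ} {A A' : ℕ → ℕ → Prop} {f : ℕ → ℕ} (h : IsDist N A a f)
    (hA : ∀ i < N, ∀ j < N, (A' i j ↔ A i j)) : IsDist N A' a f where
  zero := h.zero
  le := h.le
  step x hx y hy hxy := h.step x hx y hy ((hA x hx y hy).1 hxy)
  pred y hy l hl hlt := by
    obtain ⟨x, hx, hxy, hfx⟩ := h.pred y hy l hl hlt
    exact ⟨x, hx, (hA x hx y hy).2 hxy, hfx⟩

theorem OddGirthInv.congr {N g : ℕ} {A A' : ℕ → ℕ → Prop} {F : ℕ → ℕ → ℕ}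
    {S : ℕ → ℕ → ℕ → Prop} (h : OddGirthInv N A F S g)
    (hA : ∀ i < N, ∀ j < N, (A' i j ↔ A i j)) : OddGirthInv N A' F S g := by
  refine ⟨fun a ha x hx y hy hS hxy => h.1 a ha x hx y hy hS ((hA x hx y hy).1 hxy), fun hg => ?_⟩
  obtain ⟨a, ha, x, hx, y, hy, hxy, h'⟩ := h.2 hg
  exact ⟨a, ha, x, hx, y, hy, (hA x hx y hy).2 hxy, h'⟩

/-- The conventions for unreachable pairs agree: the marker N is rejected by d < N, while `dist` is
0 there, and both give weight 0. -/
theorem weightOf_distNat {N K : ℕ} (G : SimpleGraph (Fin N)) (a b : Fin N) :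
    weightOf N K (distNat G a b) = distWeight K G a b := by
  unfold weightOf distWeight
  by_cases h : G.Reachable a b
  · rw [distNat_of_reachable h]
    have := dist_lt_of_reachable h
    split_ifs <;> omega
  · rw [distNat_of_not_reachable h, SimpleGraph.dist_eq_zero_of_not_reachable h]
    split_ifs <;> omega

/-! ### Invariants of the pruning loop -/

/-- The array `A` holds the adjacency matrix of `G`. -/
def AdjRep {N : ℕ} (A : ℕ → ℕ → ℕ) (G : SimpleGraph (Fin N)) : Prop :=
  ∀ i < N, ∀ j < N, (A i j = 1 ↔ adjNat G i j)

/-- The invariant of the partial distance graph. -/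
structure WeightInv {N : ℕ} (K : ℕ) (G : SimpleGraph (Fin N)) (w : ℕ → ℕ → ℕ) : Prop where
  symm : ∀ a < N, ∀ b < N, w a b = w b a
  self : ∀ a < N, w a a = 0
  one : ∀ a b : Fin N, w a b = 1 ↔ G.Adj a b
  universal : Bounds G (SP (2 * K + 1)) → Universal K fun a b : Fin N => w a b

theorem weightInv_distNat {N K : ℕ} {G : SimpleGraph (Fin N)} {w : ℕ → ℕ → ℕ} (hK : 1 ≤ K)
    (hG : ∀ (a : Fin N) (w : G.Walk a a), Odd w.length → 2 * K + 1 ≤ w.length)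
    (hw : ∀ a < N, ∀ b < N, w a b = weightOf N K (distNat G a b)) : WeightInv K G w := by
  have hw' : ∀ a b : Fin N, w a b = distWeight K G a b := fun a b =>
    (hw a a.2 b b.2).trans (weightOf_distNat G a b)
  refine ⟨fun a ha b hb => ?_, fun a ha => ?_, fun a b => ?_, fun hB => ?_⟩
  · rw [hw' ⟨a, ha⟩ ⟨b, hb⟩, hw' ⟨b, hb⟩ ⟨a, ha⟩, distWeight, SimpleGraph.dist_comm]
    rfl
  · rw [hw' ⟨a, ha⟩ ⟨a, ha⟩, distWeight, SimpleGraph.dist_self, ite_self]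
  · rw [hw', distWeight, ← SimpleGraph.dist_eq_one_iff_adj]
    split_ifs
    · rfl
    · simp only [false_iff]
      omega
  · have := universal_distWeight hK hG hB
    simp only [hw']
    exact this

/-- Delete the edge `ef` from a symmetric matrix. -/
def eraseEdge (w : ℕ → ℕ → ℕ) (e f : ℕ) (i j : ℕ) : ℕ :=
  if (i = e ∧ j = f) ∨ (i = f ∧ j = e) then 0 else w i j

theorem setMem_setMem_mem (s : State) (A : Arr) (e f : ℕ) :
    ((s.setMem A e f 0).setMem A f e 0).mem A = eraseEdge (s.mem A) e f := by
  funext i j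
  rw [setMem_mem, setMem_mem, eraseEdge]
  simp only [true_and]
  split_ifs <;> first | rfl | tauto

theorem WeightInv.universal_erase {N K : ℕ} {G : SimpleGraph (Fin N)} {w t : ℕ → ℕ → ℕ} {C e f : ℕ}
    (h : WeightInv K G w) (ht : TriplesInv K t C fun _ _ _ => True) (he : e < N) (hf : f < N)
    (hfail : ∃ i < C, t i 0 = w e f ∧ ¬ Realized w N (t i 1) (t i 2) e f)
    (hB : Bounds G (SP (2 * K + 1))) :
    Universal K fun a b : Fin N => eraseEdge w e f a b := by
  obtain ⟨i, hi, h0, hreal⟩ := hfail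
  have hg := ht.1 i hi
  rw [h0] at hg
  refine SPBound.universal_erase (h.universal hB) (x := ⟨e, he⟩) (y := ⟨f, hf⟩) hg (h.symm e he f hf)
    ?_ ?_
  · by_contra! hcon
    obtain ⟨⟨z, h1, h2⟩, ⟨z', h3, h4⟩⟩ := hcon
    exact hreal ⟨⟨z, z.2, h1, h2⟩, ⟨z', z'.2, h3, h4⟩⟩
  · intro a b h1 h2
    rw [eraseEdge, if_neg]
    simp only [Fin.ext_iff] at h1 h2
    tauto

theorem WeightInv.erase {N K : ℕ} {G : SimpleGraph (Fin N)} {w t : ℕ → ℕ → ℕ} {C e f : ℕ}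
    (h : WeightInv K G w) (ht : TriplesInv K t C fun _ _ _ => True) (he : e < N) (hf : f < N)
    (hfail : ∃ i < C, t i 0 = w e f ∧ ¬ Realized w N (t i 1) (t i 2) e f) (h2 : 2 ≤ w e f) :
    WeightInv K G (eraseEdge w e f) := by
  refine ⟨fun a ha b hb => ?_, fun a ha => ?_, fun a b => ?_, h.universal_erase ht he hf hfail⟩
  · rw [eraseEdge, eraseEdge, h.symm a ha b hb]
    simp only [and_comm, or_comm]
  · rw [eraseEdge, h.self a ha, ite_self]
  · rw [← h.one, eraseEdge]
    split_ifs with hab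
    · have := h.symm e he f hf
      rcases hab with ⟨h3, h4⟩ | ⟨h3, h4⟩ <;> rw [h3, h4] <;> simp only [false_iff] <;> omega
    · rfl

theorem WeightInv.bounds {N K : ℕ} {G : SimpleGraph (Fin N)} {w t : ℕ → ℕ → ℕ} {C : ℕ} (hK : 1 ≤ K)
    (h : WeightInv K G w) (ht : TriplesInv K t C fun _ _ _ => True) (hE : ∃ a b, G.Adj a b)
    (hreal : ∀ x < N, ∀ y < x, ∀ i < C, 1 ≤ w x y → t i 0 = w x y →
      Realized w N (t i 1) (t i 2) x y) : Bounds G (SP (2 * K + 1)) := by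
  refine bounds_of_universal (D := fun a b : Fin N => w a b) hK
    (universal_of_realized hK (fun a b => h.symm a a.2 b b.2) ?_ ?_) (fun a b => (h.one a b).1)
  · obtain ⟨a, b, hab⟩ := hE
    exact ⟨a, b, (h.one a b).2 hab⟩
  · intro x y q r hg
    have hpos : 1 ≤ w x y := hg.1
    obtain ⟨i, hi, h0, rfl, rfl⟩ := ht.2 _ q r trivial hg
    -- Only pairs with the larger vertex first are scanned; the reversed pair uses the second half
    -- of `Realized`.
    rcases lt_trichotomy (x : ℕ) y with hxy | hxy | hxy
    · have hs := h.symm x x.2 y y.2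
      obtain ⟨-, z, hz, h1, h2⟩ := hreal y y.2 x hxy i hi (by omega) (by omega)
      exact ⟨⟨z, hz⟩, h2, h1⟩
    · rw [hxy, h.self y y.2] at hpos
      omega
    · obtain ⟨⟨z, hz, h1, h2⟩, -⟩ := hreal x x.2 y hxy i hi hpos h0
      exact ⟨⟨z, hz⟩, h1, h2⟩

/-- The erased weighted graph is still universal, and its weight-one edges survive in the smaller
graph, so `bounds_of_universal` applies to the latter. -/
theorem WeightInv.bounds_deleteEdges {N K : ℕ} {G : SimpleGraph (Fin N)} {w t : ℕ → ℕ → ℕ}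
    {C e f : ℕ} (hK : 1 ≤ K) (h : WeightInv K G w) (ht : TriplesInv K t C fun _ _ _ => True)
    (he : e < N) (hf : f < N)
    (hfail : ∃ i < C, t i 0 = w e f ∧ ¬ Realized w N (t i 1) (t i 2) e f)
    (hB : Bounds G (SP (2 * K + 1))) :
    Bounds (G.deleteEdges {s(⟨e, he⟩, ⟨f, hf⟩)}) (SP (2 * K + 1)) := by
  refine bounds_of_universal hK (h.universal_erase ht he hf hfail hB) fun a b hab => ?_
  simp only [eraseEdge] at hab
  split_ifs at hab with hcon
  rw [SimpleGraph.deleteEdges_adj, Set.mem_singleton_iff, Sym2.eq_iff, ← h.one]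
  simp only [Fin.ext_iff]
  exact ⟨hab, hcon⟩

theorem AdjRep.deleteEdges {N : ℕ} {A : ℕ → ℕ → ℕ} {G : SimpleGraph (Fin N)} {e f : ℕ}
    (h : AdjRep A G) (he : e < N) (hf : f < N) :
    AdjRep (eraseEdge A e f) (G.deleteEdges {s(⟨e, he⟩, ⟨f, hf⟩)}) := by
  intro i hi j hj
  rw [eraseEdge]
  have : adjNat (G.deleteEdges {s(⟨e, he⟩, ⟨f, hf⟩)}) i j ↔
      adjNat G i j ∧ ¬ ((i = e ∧ j = f) ∨ (i = f ∧ j = e)) := by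
    simp only [adjNat, SimpleGraph.deleteEdges_adj, Set.mem_singleton_iff, Sym2.eq_iff,
      Fin.mk.injEq, hi, hj, exists_true_left]
  rw [this, ← h i hi j hj]
  split_ifs with hcon
  · simp [hcon]
  · simp [hcon]

theorem ncard_deleteEdges_lt {N : ℕ} {G : SimpleGraph (Fin N)} {a b : Fin N} (h : G.Adj a b) :
    (G.deleteEdges {s(a, b)}).edgeSet.ncard < G.edgeSet.ncard := by
  refine Set.ncard_lt_ncard ?_ (Set.toFinite _)
  rw [SimpleGraph.edgeSet_deleteEdges]
  exact Set.sdiff_singleton_ssubset.2 h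

/-- The number of nonzero entries of an `N × N` matrix. -/
def support (N : ℕ) (w : ℕ → ℕ → ℕ) : ℕ :=
  ((Finset.range N ×ˢ Finset.range N).filter fun p => w p.1 p.2 ≠ 0).card

theorem support_le (N : ℕ) (w : ℕ → ℕ → ℕ) : support N w ≤ N ^ 2 := by
  refine (Finset.card_filter_le _ _).trans ?_
  rw [Finset.card_product, Finset.card_range, sq]

theorem support_eraseEdge_lt {N e f : ℕ} {w : ℕ → ℕ → ℕ} (he : e < N) (hf : f < N)
    (h : w e f ≠ 0) : support N (eraseEdge w e f) < support N w := by
  refine Finset.card_lt_card ((Finset.ssubset_iff_of_subset ?_).2 ⟨(e, f), ?_, ?_⟩)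
  · intro p hp
    rw [Finset.mem_filter] at hp ⊢
    refine ⟨hp.1, fun h0 => hp.2 ?_⟩
    rw [eraseEdge, h0, ite_self]
  · simp [he, hf, h]
  · simp [eraseEdge]

/-! ### Correctness and cost of the calls -/

/-- The result of one call of the algorithm on the graph `G`: an answer, or a proper subgraph. -/
def CallResult {N : ℕ} (K : ℕ) (G : SimpleGraph (Fin N)) (s : State) : Prop :=
  (s.reg halt = 1 ∧ s.reg ans = 1 ∧ Bounds G (SP (2 * K + 1))) ∨
  (s.reg halt = 1 ∧ s.reg ans = 0 ∧ ¬ Bounds G (SP (2 * K + 1))) ∨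
  (s.reg halt = 0 ∧ ∃ G' : SimpleGraph (Fin N), G' ≤ G ∧ G'.edgeSet.ncard < G.edgeSet.ncard ∧
    AdjRep (s.mem adj) G' ∧ (Bounds G (SP (2 * K + 1)) → Bounds G' (SP (2 * K + 1))))

/-- Each restart lowers the number of nonzero weights, at most N². The measure is that number plus
one while a scan is pending and 0 once the loop is about to stop, so at most N² + 1 scans occur. -/
theorem wp_pruneLoop {N K C M : ℕ} {G : SimpleGraph (Fin N)} {s : State} (hn : s.reg n = N)
    (hN1 : 1 ≤ N) (hK : 1 ≤ K) (hC : s.reg cnt = C) (hCM : C ≤ M) (hM : 1 ≤ M)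
    (ht : TriplesInv K (s.mem tri) C fun _ _ _ => True) (hadj : AdjRep (s.mem adj) G)
    (hw : WeightInv K G (s.mem wt)) (hE : ∃ a b, G.Adj a b) (hhalt : s.reg halt = 0) :
    wp pruneLoop s fun t s' => t ≤ 1000 * (M * N ^ 5) ∧ CallResult K G s' := by
  rw [pruneLoop, wp_block_cons, wp_assign, wp_block_cons]
  refine wp.mono (wp_loop (T := 350 * (M * N ^ 3)) (fun m s' => s'.reg n = N ∧ s'.reg cnt = C ∧
      s'.mem tri = s.mem tri ∧
      ((s'.reg restart = 1 ∧ s'.reg halt = 0 ∧ AdjRep (s'.mem adj) G ∧ WeightInv K G (s'.mem wt) ∧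
          m = support N (s'.mem wt) + 1) ∨
        (s'.reg restart = 0 ∧ m = 0 ∧ CallResult K G s'))) ?_ (support N (s.mem wt) + 1) _
      ⟨hn, hC, rfl, Or.inl ⟨rfl, hhalt, hadj, hw, rfl⟩⟩) ?_
  · rintro m s1 ⟨hn1, hC1, ht1, hI⟩ hb
    rw [eval_eq_true] at hb
    have hb' : s1.reg restart = 1 := hb
    obtain ⟨-, hh1, hadj1, hw1, hm⟩ := hI.resolve_right (fun h => by omega)
    rw [wp_block_cons, wp_assign, wp_block_cons]
    refine wp.mono (wp_scanEdges (N := N) (C := C) (K := M) hn1 hN1 hC1 hCM hM) ?_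
    rintro t s2 hfr2 ⟨ht2, hscan⟩
    have hn2 : s2.reg n = N := (hfr2.1 n rfl).trans hn1
    have hC2 : s2.reg cnt = C := (hfr2.1 cnt rfl).trans hC1
    have hh2 : s2.reg halt = 0 := (hfr2.1 halt rfl).trans hh1
    have hr2 : s2.reg restart = 0 := hfr2.1 restart rfl
    have hw2 : s2.mem wt = s1.mem wt := hfr2.2 wt rfl
    have ha2 : s2.mem adj = s1.mem adj := hfr2.2 adj rfl
    have htri2 : s2.mem tri = s.mem tri := (hfr2.2 tri rfl).trans ht1
    have hpos : 1 ≤ M * N ^ 3 := Nat.mul_pos hM (Nat.pow_pos hN1)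
    rw [setReg_mem, ht1] at hscan
    simp only [wp_block_cons, wp_block_nil, wp_ite, wp_assign, wp_put, eval_eq_true, eval_le_true,
      Expr.eval, Test.cost, Expr.cost, setMem_reg]
    refine ⟨fun hfail => ?_, fun hfail => ?_⟩
    · obtain ⟨-, hreal⟩ := hscan.resolve_right (fun h => by omega)
      have hB := hw1.bounds hK ht hE (fun x hx y hy i hi => hreal x hx y hy i hi trivial)
      refine ⟨by omega, 0, by omega, hn2, hC2, htri2, Or.inr ⟨?_, rfl, Or.inl ⟨?_, ?_, hB⟩⟩⟩ <;>
        simp [setReg_reg, hr2]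
    · obtain ⟨-, he, hf, hpos', hbad⟩ := hscan.resolve_left (fun h => hfail h.1)
      have hf' : s2.reg ey < N := by omega
      refine ⟨fun h2 => ?_, fun h2 => ?_⟩
      · rw [hw2] at h2
        have hlt := support_eraseEdge_lt he hf' (w := s1.mem wt) (by omega)
        refine ⟨by omega, support N (eraseEdge (s1.mem wt) (s2.reg ex) (s2.reg ey)) + 1, by omega,
          hn2, hC2, htri2, Or.inl ⟨rfl, hh2, ?_, ?_, ?_⟩⟩
        · rw [← ha2] at hadj1
          exact hadj1
        · rw [setReg_mem, setMem_setMem_mem, hw2]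
          exact hw1.erase ht he hf' hbad h2
        · rw [setReg_mem, setMem_setMem_mem, hw2]
      · rw [hw2] at h2
        refine ⟨by omega, 0, by omega, hn2, hC2, htri2, Or.inr ⟨hr2, rfl, Or.inr (Or.inr ⟨hh2,
          G.deleteEdges {s(⟨_, he⟩, ⟨_, hf'⟩)}, SimpleGraph.deleteEdges_le _,
          ncard_deleteEdges_lt ((hw1.one _ _).1 ?_), ?_,
          hw1.bounds_deleteEdges hK ht he hf' hbad⟩)⟩⟩
        · simp only
          omega
        · rw [setMem_setMem_mem, ha2]
          exact hadj1.deleteEdges he hf'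
  · rintro t s1 - ⟨ht1, hb, m, hn1, hC1, htri1, hI⟩
    rw [wp_block_nil]
    have hb' : ¬ s1.reg restart = 1 := by
      intro h
      rw [← Bool.not_eq_true, eval_eq_true] at hb
      exact hb h
    obtain ⟨-, -, hres⟩ := hI.resolve_left (fun h => hb' h.1)
    refine ⟨?_, hres⟩
    simp only [Test.cost, Expr.cost] at ht1 ⊢
    have h1 : support N (s.mem wt) + 1 ≤ 2 * N ^ 2 := by
      have := support_le N (s.mem wt)
      have := Nat.pow_pos (n := 2) hN1
      omega
    have h2 := Nat.mul_le_mul_right (350 * (M * N ^ 3) + (1 + 1 + 1 + 1)) h1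
    have h3 : 2 * N ^ 2 * (350 * (M * N ^ 3) + (1 + 1 + 1 + 1)) = 700 * (M * N ^ 5) + 8 * N ^ 2 := by
      ring
    have h4 : N ^ 2 ≤ M * N ^ 5 :=
      (Nat.pow_le_pow_right hN1 (by omega)).trans (Nat.le_mul_of_pos_left _ hM)
    have h5 : 1 ≤ M * N ^ 5 := Nat.mul_pos hM (Nat.pow_pos hN1)
    omega

/-- Pruning dominates. The triple loops run over 0, …, K, and their (K+1)³ passes are at most 8K³
because K ≥ 1. -/
theorem wp_callBody {N K : ℕ} {G : SimpleGraph (Fin N)} {s : State} (hn : s.reg n = N)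
    (hk : s.reg k = K) (hN1 : 1 ≤ N) (hK : 1 ≤ K) (hadj : AdjRep (s.mem adj) G)
    (hG : ∀ (a : Fin N) (w : G.Walk a a), Odd w.length → 2 * K + 1 ≤ w.length)
    (hhalt : s.reg halt = 0) :
    wp callBody s fun t s' => t ≤ 20000 * (N ^ 5 * K ^ 3) ∧ CallResult K G s' := by
  have hM : (K + 1) ^ 3 ≤ 8 * K ^ 3 := by
    have := Nat.pow_le_pow_left (show K + 1 ≤ 2 * K by omega) 3
    rwa [Nat.mul_pow] at this
  have hX : N ^ 5 ≤ N ^ 5 * K ^ 3 := Nat.le_mul_of_pos_right _ (Nat.pow_pos hK)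
  have hY : K ^ 3 ≤ N ^ 5 * K ^ 3 := Nat.le_mul_of_pos_left _ (Nat.pow_pos hN1)
  have h45 : N ^ 4 ≤ N ^ 5 := Nat.pow_le_pow_right hN1 (by omega)
  have h25 : N ^ 2 ≤ N ^ 5 := Nat.pow_le_pow_right hN1 (by omega)
  have h05 : 1 ≤ N ^ 5 := Nat.pow_pos hN1
  have hdist : ∀ a < N, IsDist N (fun x y => s.mem adj x y = 1) a (distNat G a) := fun a ha =>
    (isDist_distNat G ha).congr hadj
  rw [callBody, wp_block_cons]
  refine wp.mono (wp_computeOddGirth hn hN1 hdist) ?_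
  rintro t1 s1 hfr1 ⟨ht1, hog⟩
  have hn1 : s1.reg n = N := (hfr1.1 n rfl).trans hn
  have hk1 : s1.reg k = K := (hfr1.1 k rfl).trans hk
  have hh1 : s1.reg halt = 0 := (hfr1.1 halt rfl).trans hhalt
  have ha1 : s1.mem adj = s.mem adj := hfr1.2 adj rfl
  have hgiff := oddGirthInv_eq_iff hG (hog.congr fun i hi j hj => (hadj i hi j hj).symm)
  rw [wp_block_cons, wp_ite]
  simp only [eval_eq_true, Expr.eval, Test.cost, Expr.cost, hk1, wp_block_nil]
  refine ⟨fun hg => ?_, fun hg => ?_⟩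
  · obtain ⟨a, W, hW⟩ := hgiff.1 hg
    have hE : ∃ a b, G.Adj a b := by
      cases W with
      | nil => simp at hW
      | cons h _ => exact ⟨_, _, h⟩
    rw [wp_block_cons]
    refine wp.mono (wp_computeDist (F := distNat G) hn1 hN1 (by rwa [ha1])) ?_
    rintro t2 s2 hfr2 ⟨ht2, hF⟩
    have hn2 : s2.reg n = N := (hfr2.1 n rfl).trans hn1
    have hk2 : s2.reg k = K := (hfr2.1 k rfl).trans hk1
    have hh2 : s2.reg halt = 0 := (hfr2.1 halt rfl).trans hh1
    have ha2 : s2.mem adj = s.mem adj := (hfr2.2 adj rfl).trans ha1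
    rw [wp_block_cons]
    refine wp.mono (wp_computeWeights hn2 hk2 hN1 hF) ?_
    rintro t3 s3 hfr3 ⟨ht3, hw3⟩
    have hn3 : s3.reg n = N := (hfr3.1 n rfl).trans hn2
    have hk3 : s3.reg k = K := (hfr3.1 k rfl).trans hk2
    have hh3 : s3.reg halt = 0 := (hfr3.1 halt rfl).trans hh2
    have ha3 : s3.mem adj = s.mem adj := (hfr3.2 adj rfl).trans ha2
    rw [wp_block_cons]
    refine wp.mono (wp_computeTriples hk3) ?_
    rintro t4 s4 hfr4 ⟨ht4, hcnt, htri⟩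
    have hn4 : s4.reg n = N := (hfr4.1 n rfl).trans hn3
    have hh4 : s4.reg halt = 0 := (hfr4.1 halt rfl).trans hh3
    have ha4 : s4.mem adj = s.mem adj := (hfr4.2 adj rfl).trans ha3
    have hw4 : s4.mem wt = s3.mem wt := hfr4.2 wt rfl
    rw [wp_block_cons]
    refine wp.mono (wp_pruneLoop (G := G) (M := 8 * K ^ 3) hn4 hN1 hK rfl (hcnt.trans hM)
      (by have := Nat.pow_pos (n := 3) hK; omega) htri (by rwa [ha4])
      (by rw [hw4]; exact weightInv_distNat hK hG hw3) hE hh4) ?_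
    rintro t5 s5 - ⟨ht5, hres⟩
    rw [wp_block_nil]
    refine ⟨?_, hres⟩
    have : 1000 * (8 * K ^ 3 * N ^ 5) = 8000 * (N ^ 5 * K ^ 3) := by ring
    omega
  · simp only [wp_block_cons, wp_block_nil, wp_assign, Expr.eval, Expr.cost]
    refine ⟨by omega, Or.inr (Or.inl ⟨?_, ?_, fun hB => hg (hgiff.2 (exists_odd_walk_of_bounds hK hB))⟩)⟩
      <;> simp [setReg_reg]

/-- The current graph is a subgraph of `B` that bounds the class whenever `B` does. YES therefore
passes up to `B` by inclusion and NO by contraposition. The lower bound on odd-girth is inherited,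
and the number of edges decreases with each unanswered call. -/
theorem wp_algorithm {N K : ℕ} {B : SimpleGraph (Fin N)} (hN1 : 1 ≤ N) (hK : 1 ≤ K)
    (hB : ∀ (a : Fin N) (w : B.Walk a a), Odd w.length → 2 * K + 1 ≤ w.length) :
    wp algorithm (input K B) fun t s' =>
      t ≤ (B.edgeSet.ncard + 1) * (20010 * (N ^ 5 * K ^ 3)) + 20 ∧
      ((s'.reg ans = 1 ∧ Bounds B (SP (2 * K + 1))) ∨
        (s'.reg ans = 0 ∧ ¬ Bounds B (SP (2 * K + 1)))) := by
  simp only [algorithm, wp_block_cons, wp_block_nil, wp_assign, Expr.cost]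
  refine wp.mono (wp_loop (T := 20000 * (N ^ 5 * K ^ 3)) (fun m s => s.reg n = N ∧ s.reg k = K ∧
    ((s.reg halt = 0 ∧ ∃ G : SimpleGraph (Fin N), G ≤ B ∧ G.edgeSet.ncard + 1 = m ∧
        AdjRep (s.mem adj) G ∧ (Bounds B (SP (2 * K + 1)) → Bounds G (SP (2 * K + 1)))) ∨
      (s.reg halt = 1 ∧ m = 0 ∧ ((s.reg ans = 1 ∧ Bounds B (SP (2 * K + 1))) ∨
        (s.reg ans = 0 ∧ ¬ Bounds B (SP (2 * K + 1))))))) ?_ (B.edgeSet.ncard + 1) _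
      ⟨rfl, rfl, Or.inl ⟨rfl, B, le_rfl, rfl, ?_, id⟩⟩) ?_
  · rintro m s ⟨hn, hk, hI⟩ hb
    have hh : s.reg halt = 0 := (eval_eq_true _ _ _).1 hb
    obtain ⟨-, G, hGB, rfl, hadj, hBG⟩ := hI.resolve_right (fun h => by omega)
    refine wp.mono (wp_callBody hn hk hN1 hK hadj (fun a w hw => ?_) hh) ?_
    · rw [← SimpleGraph.Walk.length_map (SimpleGraph.Hom.ofLE hGB) w] at hw ⊢
      exact hB _ _ hw
    · rintro t s' hfr ⟨ht, hres⟩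
      have hn' : s'.reg n = N := (hfr.1 n rfl).trans hn
      have hk' : s'.reg k = K := (hfr.1 k rfl).trans hk
      refine ⟨ht, ?_⟩
      rcases hres with ⟨h1, h2, h3⟩ | ⟨h1, h2, h3⟩ | ⟨h1, G', hle, hlt, hadj', hGG'⟩
      · exact ⟨0, by omega, hn', hk', Or.inr ⟨h1, rfl, Or.inl ⟨h2, h3.mono hGB⟩⟩⟩
      · exact ⟨0, by omega, hn', hk', Or.inr ⟨h1, rfl, Or.inr ⟨h2, fun h => h3 (hBG h)⟩⟩⟩
      · exact ⟨_, Nat.add_lt_add_right hlt 1, hn', hk', Or.inl ⟨h1, G', hle.trans hGB, rfl, hadj',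
          fun h => hGG' (hBG h)⟩⟩
  · intro i hi j hj
    simp only [setReg_mem, input, adjNat]
    split_ifs with h
    · exact iff_of_true rfl h.2
    · exact iff_of_false not_false fun h' => h ⟨rfl, h'⟩
  · rintro t s - ⟨ht, hb, m, hn, hk, hI⟩
    have hh : ¬ s.reg halt = 0 := fun h => by
      rw [← Bool.not_eq_true, eval_eq_true] at hb
      exact hb h
    obtain ⟨-, -, hres⟩ := hI.resolve_left (fun h => hh h.1)
    refine ⟨?_, hres⟩
    simp only [Test.cost, Expr.cost] at ht
    have h1 : 1 ≤ N ^ 5 * K ^ 3 := Nat.mul_pos (Nat.pow_pos hN1) (Nat.pow_pos hK)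
    have h2 : (B.edgeSet.ncard + 1) * (20000 * (N ^ 5 * K ^ 3) + (1 + 1 + 1 + 1)) ≤
        (B.edgeSet.ncard + 1) * (20010 * (N ^ 5 * K ^ 3)) := Nat.mul_le_mul_left _ (by omega)
    omega

end SPBound

theorem mainTheorem7 :
    ∃ C : ℕ, ∀ (n k : ℕ) (B : SimpleGraph (Fin n)),
      SPBound.oddGirth B = ((2 * k + 1 : ℕ) : ℕ∞) →
      ∃ (final : SPBound.State) (time : ℕ),
        SPBound.Exec SPBound.algorithm (SPBound.input k B) final time ∧
        (final.reg SPBound.Reg.ans = 1 ↔ SPBound.Bounds B (SPBound.SP (2 * k + 1))) ∧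
        (final.reg SPBound.Reg.ans = 0 ↔ ¬ SPBound.Bounds B (SPBound.SP (2 * k + 1))) ∧
        time ≤ C * (B.edgeSet.ncard * n ^ 5 * k ^ 3) ∧
        B.edgeSet.ncard * n ^ 5 * k ^ 3 ≤ B.edgeSet.ncard * n ^ 8 := by
  -- 40040 = 2 · 20010 + 20: since there is an edge, m + 1 ≤ 2m, and the additive 20 is absorbed by
  -- the product.
  refine ⟨40040, fun n k B hB => ?_⟩
  obtain ⟨a, w, hc, hodd, hlen⟩ := SPBound.exists_walk_of_oddGirth_eq hB
  have h3 := hc.three_le_length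
  have hk : 1 ≤ k := by omega
  -- A cycle of length 2k+1 has that many vertices; its tail is a path, whose length 2k is less than
  -- n.
  have hkn : k ≤ n := by
    have := hc.isPath_tail.length_lt
    rw [Fintype.card_fin] at this
    have h4 := SimpleGraph.Walk.length_tail_add_one hc.not_nil
    omega
  have hn : 1 ≤ n := hk.trans hkn
  have hm : 1 ≤ B.edgeSet.ncard := by
    refine (Set.ncard_pos (Set.toFinite _)).2 ?_
    cases w with
    | nil => simp at h3
    | cons h _ => exact ⟨_, (SimpleGraph.mem_edgeSet _).2 h⟩
  obtain ⟨final, time, hexec, ht, hres⟩ :=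
    SPBound.wp_algorithm hn hk ((SPBound.le_oddGirth_iff B _).1 hB.ge)
  refine ⟨final, time, hexec, ?_, ?_, ?_, ?_⟩
  · rcases hres with ⟨h1, h2⟩ | ⟨h1, h2⟩
    · exact ⟨fun _ => h2, fun _ => h1⟩
    · exact ⟨fun h => by omega, fun h => absurd h h2⟩
  · rcases hres with ⟨h1, h2⟩ | ⟨h1, h2⟩
    · exact ⟨fun h => by omega, fun h => absurd h2 h⟩
    · exact ⟨fun _ => h2, fun _ => h1⟩
  · have h1 : 1 ≤ n ^ 5 * k ^ 3 := Nat.mul_pos (Nat.pow_pos hn) (Nat.pow_pos hk)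
    rw [Nat.mul_assoc]
    generalize n ^ 5 * k ^ 3 = X at *
    generalize B.edgeSet.ncard = m at *
    nlinarith
  · rw [Nat.mul_assoc]
    refine Nat.mul_le_mul_left _ ?_
    calc n ^ 5 * k ^ 3 ≤ n ^ 5 * n ^ 3 := Nat.mul_le_mul_left _ (Nat.pow_le_pow_left hkn 3)
      _ = n ^ 8 := by ring
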